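/- **Setting.** Let $L>0$, let $D_i=(x_i^-,x_i^+)$, $i=1,\dots,N$, be disjoint intervals in $(0,L)$, ordered from left to right, with lengths $\ell_i=x_i^+-x_i^-$, let $D=\bigcup_i D_i$, and fix $\alpha\in(-\pi/L,\pi/L]$. Consider media given by constants $\kappa_0,\rho_0,\kappa_{\mathrm r},\rho_{\mathrm r},\Omega>0$ and by real functions $\kappa_i(t)>0$, $s_i(t)\neq0$ such that, for all $i$, $1/\kappa_i$ and $1/s_i$ are trigonometric polynomials $\sum_{|n|\le M}c_n e^{\mathrm in\Omega t}$. Put $\delta=\rho_{\mathrm r}/\rho_0$, $v_0=\sqrt{\kappa_0/\rho_0}$, $v_{\mathrm r}=\sqrt{\kappa_{\mathrm r}/\rho_{\mathrm r}}$ and $T=2\pi/\Omega$. A Bloch wave with quasifrequency $\omega\in\mathbb C$ is a classical solution $u(x,t)$ ($C^2$ up to the boundary on each resonator and on each gap between resonators) of $$\partial_t^2u-v_0^2\,\partial_x^2u=0\ \text{ off the closures of all translates } D_i+mL,\ m\in\mathbb Z,\qquad \partial_t\Big(\tfrac1{\kappa_i}\partial_tu\Big)-v_{\mathrm r}^2\,\partial_x^2u=0\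 \text{ in }D_i,$$ $$u|_\pm(x_i^\pm,t)=\tfrac1{s_i(t)}\,u|_\mp(x_i^\pm,t),\qquad \delta\,\partial_xu|_\pm(x_i^\pm,t)=\tfrac1{s_i(t)}\,\partial_xu|_\mp(x_i^\pm,t),$$ with $u(x+L,t)=e^{\mathrm i\alpha L}u(x,t)$ and $u(x,t+T)=e^{\mathrm i\omega T}u(x,t)$. Its harmonics are $v_n(x)=\frac1T\int_0^Tu(x,t)e^{-\mathrm i(\omega+n\Omega)t}\,dt$, $n\in\mathbb Z$. Consider a family of such media, for the fixed geometry and the fixed $\alpha$, along which $\delta\to0$, while $v_0$, $v_{\mathrm r}$, $\kappa_i(t)$, $|s_i(t)|$ and $\Omega/\sqrt\delta$ remain between two positive constants and $M=O(\delta^{-\gamma/2})$ for some $\gamma\in(0,1)$. A family of subwavelength quasifrequencies is a family $\omega=\omega(\delta)\to0$ of quasifrequencies with Bloch waves normalised by $\sum_n\|v_n\|_{L^2(D)}=1$ such that, for some integers $K=K(\delta)\ge 0$ with $K\Omega\to0$, $\sum_{|n|\le K}\|v_n\|_{L^2(D)}\to1$. Let $V_j^\alpha$ be the continuous function on $\mathbb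 R$ that is affine on each gap between resonators, equals $\delta_{ij}$ (the Kronecker delta) on $D_i$ for each $i$, and satisfies $V_j^\alpha(x+mL)=e^{\mathrm i\alpha mL}V_j^\alpha(x)$ for $m\in\mathbb Z$. The quasiperiodic capacitance matrix is $C^\alpha_{ij}=\frac{dV_j^\alpha}{dx}\big|_-(x_i^-)-\frac{dV_j^\alpha}{dx}\big|_+(x_i^+)$. Put $$M^\alpha(t)=\frac{\delta\kappa_{\mathrm r}}{\rho_{\mathrm r}}W_1(t)C^\alpha W_2(t)+W_3(t),$$ with diagonal matrices $$(W_1)_{ii}=\frac{\sqrt{\kappa_i}\,s_i}{\ell_i},\qquad (W_2)_{ii}=\frac{\sqrt{\kappa_i}}{s_i},\qquad (W_3)_{ii}=\frac{\sqrt{\kappa_i}}2\,\frac{d}{dt}\frac{\kappa_i'}{\kappa_i^{3/2}}.$$ A quasifrequency of the ODE $M^\alpha(t)\Psi(t)+\Psi''(t)=0$ is an $\omega_0\in\mathbb C$ for which the ODE has a solution $\Psi\not\equiv0$ with $\Psi(t+T)=e^{\mathrm i\omega_0T}\Psi(t)$. **Theorem.** As $\delta\to0$, the subwavelength quasifrequencies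 are, at leading order, quasifrequencies of the ODE $M^\alpha(t)\Psi+\Psi''=0$: for every family $\omega(\delta)$ of subwavelength quasifrequencies there are quasifrequencies $\omega_0(\delta)$ of the ODE (for all media far enough along the family) such that $\omega(\delta)=\omega_0(\delta)+o(\sqrt\delta)$. -/

import Mathlib

open Filter Topology Set Asymptotics

noncomputable section

namespace SpaceTimeResonators

/-- The unit cell `(0, L)` with `N` disjoint resonators `D i = (xm i, xp i)`, ordered from left
to right. -/
structure Geometry (N : ℕ) where
  L : ℝ
  xm : Fin N → ℝ
  xp : Fin N → ℝ
  L_pos : 0 < L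
  xm_pos : ∀ i, 0 < xm i
  xm_lt_xp : ∀ i, xm i < xp i
  xp_lt_L : ∀ i, xp i < L
  ordered : ∀ i j, i < j → xp i < xm j

namespace Geometry

variable {N : ℕ} (G : Geometry N)

/-- The length of the `i`-th resonator. -/
def ell (i : Fin N) : ℝ := G.xp i - G.xm i

/-- All resonators of the infinite crystal: the translates by `m L`, `m ∈ ℤ`, of the `D i`. -/
def resonators : Set ℝ := ⋃ (m : ℤ) (i : Fin N), Ioo (G.xm i + m * G.L) (G.xp i + m * G.L)

/-- The background: the complement of the closures of all resonators of the crystal. -/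
def background : Set ℝ := (⋃ (m : ℤ) (i : Fin N), Icc (G.xm i + m * G.L) (G.xp i + m * G.L))ᶜ

/-- `I_{∂D_i}[f] = f'|₋(x_i⁻) - f'|₊(x_i⁺)`, with one-sided limits of the derivative. -/
def boundaryFlux (i : Fin N) (f : ℝ → ℂ) : ℂ :=
  Function.leftLim (deriv f) (G.xm i) - Function.rightLim (deriv f) (G.xp i)

/-- The boundary value problem for `V_j^α`: continuous, equal to `δ_{ij}` on `D_i`, with vanishing
second derivative off the resonators, and `α`-quasiperiodic. -/
structure IsPotential (α : ℝ) (j : Fin N) (V : ℝ → ℂ) : Prop where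
  continuous : Continuous V
  on_resonator : ∀ i, ∀ x ∈ Ioo (G.xm i) (G.xp i), V x = if i = j then 1 else 0
  contDiffOn : ContDiffOn ℝ 2 V G.background
  harmonic : ∀ x ∈ G.background, -deriv (deriv V) x = 0
  quasiperiodic : ∀ (m : ℤ) (x : ℝ),
    V (x + m * G.L) = Complex.exp (Complex.I * α * m * G.L) * V x

/-- `V_j^α`, the (unique) solution of the above boundary value problem. -/
def potential (α : ℝ) (j : Fin N) : ℝ → ℂ := Classical.epsilon (G.IsPotential α j)

/-- The quasiperiodic capacitance matrix `C^α_{ij} = I_{∂D_i}[V_j^α]`. -/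
def capacitance (α : ℝ) : Matrix (Fin N) (Fin N) ℂ :=
  Matrix.of fun i j => G.boundaryFlux i (G.potential α j)

/-- The norm of `L²(D)`, where `D` is the union of the resonators of the unit cell. -/
def normD (f : ℝ → ℂ) : ℝ := √(∑ i, ∫ x in G.xm i..G.xp i, ‖f x‖ ^ 2)

end Geometry

/-- The material parameters, at one value of the contrast: background and resonator constants,
modulation frequency `Ω`, and the modulations `κ i` and `s i`, whose inverses are trigonometric
polynomials of degree at most `M` in `Ω t`. -/
structure Medium (N : ℕ) where
  κ₀ : ℝ
  ρ₀ : ℝ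
  κr : ℝ
  ρr : ℝ
  Ω : ℝ
  κ : Fin N → ℝ → ℝ
  s : Fin N → ℝ → ℝ
  M : ℕ
  kHat : Fin N → ℤ → ℂ
  sHat : Fin N → ℤ → ℂ
  κ₀_pos : 0 < κ₀
  ρ₀_pos : 0 < ρ₀
  κr_pos : 0 < κr
  ρr_pos : 0 < ρr
  Ω_pos : 0 < Ω
  κ_pos : ∀ i t, 0 < κ i t
  s_ne_zero : ∀ i t, s i t ≠ 0
  inv_κ : ∀ i (t : ℝ), 1 / (κ i t : ℂ) =
    ∑ n ∈ Finset.Icc (-(M : ℤ)) M, kHat i n * Complex.exp (Complex.I * n * Ω * t)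
  inv_s : ∀ i (t : ℝ), 1 / (s i t : ℂ) =
    ∑ n ∈ Finset.Icc (-(M : ℤ)) M, sHat i n * Complex.exp (Complex.I * n * Ω * t)

namespace Medium

variable {N : ℕ} (P : Medium N)

/-- The contrast `δ`. -/
def δ : ℝ := P.ρr / P.ρ₀

/-- The wave speed in the background. -/
def v₀ : ℝ := √(P.κ₀ / P.ρ₀)

/-- The wave speed in the resonators. -/
def vr : ℝ := √(P.κr / P.ρr)

/-- The modulation period. -/
def T : ℝ := 2 * Real.pi / P.Ω

/-- `u` is a classical solution of the time-modulated wave problem: `u e^{-iωt}` is `T`-periodic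
in time, `u` is `α`-quasiperiodic in space, `u` is `C²` up to the boundary of each resonator and of
each gap between resonators, it satisfies the wave equations there, and the transmission conditions
hold at the boundary points. The values of `u` at the boundary points themselves play no role. -/
structure IsBlochWave (G : Geometry N) (α : ℝ) (ω : ℂ) (u : ℝ → ℝ → ℂ) : Prop where
  floquet : ∀ x t, u x (t + P.T) = Complex.exp (Complex.I * ω * P.T) * u x t
  quasiperiodic : ∀ x t, u (x + G.L) t = Complex.exp (Complex.I * α * G.L) * u x t
  regular : ∀ a b, Ioo a b ⊆ G.resonators ∪ G.background →
    ∃ g : ℝ × ℝ → ℂ, ContDiff ℝ 2 g ∧ ∀ x ∈ Ioo a b, ∀ t, u x t = g (x, t)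
  wave_background : ∀ x ∈ G.background, ∀ t,
    deriv (deriv fun τ => u x τ) t - (P.v₀ : ℂ) ^ 2 * deriv (deriv fun y => u y t) x = 0
  wave_resonator : ∀ i, ∀ x ∈ Ioo (G.xm i) (G.xp i), ∀ t,
    deriv (fun τ => 1 / (P.κ i τ : ℂ) * deriv (fun τ' => u x τ') τ) t
      - (P.vr : ℂ) ^ 2 * deriv (deriv fun y => u y t) x = 0
  value_right : ∀ i t, Function.rightLim (fun x => u x t) (G.xp i) =
    1 / (P.s i t : ℂ) * Function.leftLim (fun x => u x t) (G.xp i)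
  value_left : ∀ i t, Function.leftLim (fun x => u x t) (G.xm i) =
    1 / (P.s i t : ℂ) * Function.rightLim (fun x => u x t) (G.xm i)
  flux_right : ∀ i t, (P.δ : ℂ) * Function.rightLim (deriv fun x => u x t) (G.xp i) =
    1 / (P.s i t : ℂ) * Function.leftLim (deriv fun x => u x t) (G.xp i)
  flux_left : ∀ i t, (P.δ : ℂ) * Function.leftLim (deriv fun x => u x t) (G.xm i) =
    1 / (P.s i t : ℂ) * Function.rightLim (deriv fun x => u x t) (G.xm i)

/-- The harmonic `v_n` in `u(x,t) = e^{iωt} ∑ v_n(x) e^{inΩt}`. -/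
def harmonic (ω : ℂ) (u : ℝ → ℝ → ℂ) (n : ℤ) (x : ℝ) : ℂ :=
  (1 / P.T : ℂ) * ∫ t in (0 : ℝ)..P.T, u x t * Complex.exp (-Complex.I * (ω + n * P.Ω) * t)

/-- The weight `W₁`. -/
def W₁ (G : Geometry N) (t : ℝ) : Matrix (Fin N) (Fin N) ℂ :=
  Matrix.diagonal fun i => ((√(P.κ i t) * P.s i t / G.ell i : ℝ) : ℂ)

/-- The weight `W₂`. -/
def W₂ (t : ℝ) : Matrix (Fin N) (Fin N) ℂ :=
  Matrix.diagonal fun i => ((√(P.κ i t) / P.s i t : ℝ) : ℂ)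

/-- The weight `W₃`. -/
def W₃ (t : ℝ) : Matrix (Fin N) (Fin N) ℂ :=
  Matrix.diagonal fun i =>
    ((√(P.κ i t) / 2 * deriv (fun τ => deriv (P.κ i) τ / P.κ i τ ^ (3 / 2 : ℝ)) t : ℝ) : ℂ)

/-- `M^α(t) = (δ κr / ρr) W₁(t) C^α W₂(t) + W₃(t)`. -/
def odeMatrix (G : Geometry N) (α t : ℝ) : Matrix (Fin N) (Fin N) ℂ :=
  ((P.δ * P.κr / P.ρr : ℝ) : ℂ) • (P.W₁ G t * G.capacitance α * P.W₂ t) + P.W₃ t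

/-- `ω` is a (Floquet) quasifrequency of `M^α(t) Ψ(t) + Ψ''(t) = 0`. -/
def IsODEQuasifrequency (G : Geometry N) (α : ℝ) (ω : ℂ) : Prop :=
  ∃ Ψ : ℝ → Fin N → ℂ, Ψ ≠ 0 ∧ ContDiff ℝ 2 Ψ ∧
    (∀ t, (P.odeMatrix G α t).mulVec (Ψ t) + deriv (deriv Ψ) t = 0) ∧
    ∀ t, Ψ (t + P.T) = Complex.exp (Complex.I * ω * P.T) • Ψ t

end Medium

/-- A family of media, indexed along a filter, in the high-contrast regime with slow modulation:
the contrast tends to `0`, the wave speeds and the modulations `κ i`, `|s i|` stay between two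
positive constants, `Ω` is of order `δ^{1/2}`, and `M = O(δ^{-γ/2})` with `0 < γ < 1`. -/
structure IsHighContrastFamily {N : ℕ} {ι : Type*} (l : Filter ι) (P : ι → Medium N) : Prop where
  contrast : Tendsto (fun k => (P k).δ) l (𝓝 0)
  order_one : ∃ c > 0, ∃ C : ℝ, ∀ᶠ k in l,
    (P k).v₀ ∈ Icc c C ∧ (P k).vr ∈ Icc c C ∧ (P k).Ω / √(P k).δ ∈ Icc c C ∧
    ∀ i t, (P k).κ i t ∈ Icc c C ∧ |(P k).s i t| ∈ Icc c C
  bandwidth : ∃ γ ∈ Ioo (0 : ℝ) 1,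
    (fun k => ((P k).M : ℝ)) =O[l] fun k => (P k).δ ^ (-γ / 2)

/-- `ω` is a family of subwavelength quasifrequencies: `ω → 0`, and there are corresponding Bloch
waves `u`, normalised by `∑ ‖v_n‖_{L²(D)} = 1`, which are asymptotically carried by the harmonics
`|n| ≤ K` for some integers `K` with `K Ω → 0`. -/
def IsSubwavelengthFamily {N : ℕ} {ι : Type*} (G : Geometry N) (α : ℝ) (l : Filter ι)
    (P : ι → Medium N) (ω : ι → ℂ) : Prop :=
  Tendsto ω l (𝓝 0) ∧
  ∃ (u : ι → ℝ → ℝ → ℂ) (K : ι → ℕ),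
    Tendsto (fun k => (K k : ℝ) * (P k).Ω) l (𝓝 0) ∧
    (∀ᶠ k in l, (P k).IsBlochWave G α (ω k) (u k) ∧
      HasSum (fun n : ℤ => G.normD ((P k).harmonic (ω k) (u k) n)) 1) ∧
    Tendsto (fun k => ∑ n ∈ Finset.Icc (-(K k : ℤ)) (K k),
      G.normD ((P k).harmonic (ω k) (u k) n)) l (𝓝 1)

end SpaceTimeResonators

end

/-!
# Subwavelength quasifrequencies of space-time modulated resonators

Let `u` be a Bloch wave with small quasifrequency `ω`, and let `δ` be the contrast. In each
resonator the harmonics `v_n` satisfy second-order equations coupled by convolution with the Fourier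
coefficients of `1 / κ_i`; in the gaps they satisfy Helmholtz equations, and convolution with the
coefficients of `1 / s_i` links the two sides of each interface
(`Medium.IsBlochWave.exists_isModeSystem`). Since the frequencies `ω + n Ω` of the harmonics that
matter are small, the outer field is almost affine in the gaps, and the flux into a resonator is
given by the capacitance matrix. The flux carries a factor `δ`, so the inner field is almost
constant in space. The means over the resonators then satisfy the asserted ordinary differential
equation up to small errors, with a time scale `δ^{-1/2}` comparable to the period.

The comparison of Floquet spectra takes place in finite dimensions, so the infinite system of
harmonics has to be truncated. Multiplication by `1 / κ_i` and `1 / s_i`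
couples harmonics at distance at most `M`, and a truncation at `|n| ≤ I` costs the part of the
energy which is carried by the window `I < |n| ≤ I + 2 M`. Two elementary devices deal with windows.
An inequality which bounds `E(I)` by the increment `E(I + 2M) - E(I)` can be iterated, and gives
geometric decay of the a priori bound (`le_of_increment_bound`). This yields the bounds `O(δ)` for
the boundary derivatives (`IsControlled.energy_dv_left_le`, `IsControlled.energy_dv_right_le`) and
`O(√δ)` for the time derivatives (`IsControlled.timeMass_le_δ`). Moreover, among `r` consecutive
windows there is one with at most the `r`-th part of the total energy
(`IsControlled.exists_good_truncation`). The assumption `M = O(δ^{-γ/2})` with `γ < 1` leaves room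
for `r → ∞` windows among the harmonics with small frequencies
(`IsHighContrastFamily.exists_steps`). For the good truncation, the means of the harmonics form an
approximate Floquet solution of the limiting equation, with an error that is small in `L²` over a
period (`IsControlled.msq_amplitudeError_le`, `IsControlled.msq_momentumError_le`).

A one-dimensional Sobolev inequality in the time variable (`sq_sum_le_weighted`) shows that
`Im ω = O(√δ)` and that the approximate solution is bounded away from zero
(`IsControlled.sum_harmonicNorm_le`). By Grönwall's inequality its initial value is an approximate
eigenvector of the monodromy operator of the limiting equation, for the approximate eigenvalue
`e^{iωT}`. By the Cayley–Hamilton theorem there is an exact eigenvalue nearby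
(`exists_eigenvalue_near`), and since `T` is of order `δ^{-1/2}`, its logarithm gives a
quasifrequency at distance `o(√δ)` from `ω`. Finally, the substitution `Ψ_i = κ_i^{-1/2} c_i`
transforms the equation for the means into `M^α Ψ + Ψ'' = 0` (`isODEQuasifrequency_of_generator`).

Throughout, `Λ ≥ 1` bounds all material and geometric parameters and their inverses; the numerical
constants and the powers of `Λ` in the estimates are not optimised.
-/

noncomputable section

namespace SpaceTimeResonators

/-! ### Trigonometric polynomials and multipliers of finite bandwidth -/

/-- The symmetric band `|n| ≤ J` of Fourier indices. -/
def band (J : ℕ) : Finset ℤ := Finset.Icc (-(J : ℤ)) J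

/-- The squared `ℓ²` norm of a sequence over the band `|n| ≤ J`. -/
def energy (J : ℕ) (f : ℤ → ℂ) : ℝ := ∑ n ∈ band J, ‖f n‖ ^ 2

/-- The trigonometric polynomial with frequencies `n Ω`, `n ∈ S`, and coefficients `f n`. -/
def trigSum (Ω : ℝ) (S : Finset ℤ) (f : ℤ → ℂ) (t : ℝ) : ℂ :=
  ∑ n ∈ S, f n * Complex.exp (Complex.I * n * Ω * t)

/-- The convolution of `f` with the sequence `h`, cut off to the band `|m| ≤ M`: the action on
Fourier coefficients of multiplication by `trigSum Ω (band M) h`. -/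
def conv (M : ℕ) (h f : ℤ → ℂ) (n : ℤ) : ℂ := ∑ m ∈ band M, h m * f (n - m)

/-- The sequence `f` set to zero off `S`. -/
def restrict (S : Finset ℤ) (f : ℤ → ℂ) (n : ℤ) : ℂ := if n ∈ S then f n else 0

/-- The mean square of a function over one period `2π / Ω`. -/
def msq (Ω : ℝ) (h : ℝ → ℂ) : ℝ := Ω / (2 * Real.pi) * ∫ t in (0 : ℝ)..2 * Real.pi / Ω, ‖h t‖ ^ 2

lemma mem_band {J : ℕ} {n : ℤ} : n ∈ band J ↔ -(J : ℤ) ≤ n ∧ n ≤ J := Finset.mem_Icc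

lemma band_mono {I J : ℕ} (h : I ≤ J) : band I ⊆ band J := by
  intro n hn
  rw [mem_band] at *
  omega

lemma energy_nonneg (J : ℕ) (f : ℤ → ℂ) : 0 ≤ energy J f :=
  Finset.sum_nonneg fun _ _ => by positivity

lemma energy_mono {I J : ℕ} (h : I ≤ J) (f : ℤ → ℂ) : energy I f ≤ energy J f :=
  Finset.sum_le_sum_of_subset_of_nonneg (band_mono h) fun _ _ _ => by positivity

lemma energy_window {I J : ℕ} (h : I ≤ J) (f : ℤ → ℂ) :
    ∑ n ∈ band J \ band I, ‖f n‖ ^ 2 = energy J f - energy I f := by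
  have := Finset.sum_sdiff (f := fun n => ‖f n‖ ^ 2) (band_mono h)
  unfold energy
  linarith

lemma continuous_trigSum (Ω : ℝ) (S : Finset ℤ) (f : ℤ → ℂ) : Continuous (trigSum Ω S f) := by
  unfold trigSum
  fun_prop

lemma trigSum_sub (Ω : ℝ) (S : Finset ℤ) (f g : ℤ → ℂ) (t : ℝ) :
    trigSum Ω S (fun n => f n - g n) t = trigSum Ω S f t - trigSum Ω S g t := by
  simp [trigSum, sub_mul]

lemma trigSum_add (Ω : ℝ) (S : Finset ℤ) (f g : ℤ → ℂ) (t : ℝ) :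
    trigSum Ω S (fun n => f n + g n) t = trigSum Ω S f t + trigSum Ω S g t := by
  simp [trigSum, add_mul, Finset.sum_add_distrib]

lemma trigSum_mul_left (Ω : ℝ) (S : Finset ℤ) (c : ℂ) (f : ℤ → ℂ) (t : ℝ) :
    trigSum Ω S (fun n => c * f n) t = c * trigSum Ω S f t := by
  simp [trigSum, Finset.mul_sum, mul_assoc]

lemma trigSum_congr {Ω : ℝ} {S : Finset ℤ} {f g : ℤ → ℂ} (h : ∀ n ∈ S, f n = g n) (t : ℝ) :
    trigSum Ω S f t = trigSum Ω S g t :=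
  Finset.sum_congr rfl fun n hn => by rw [h n hn]

lemma trigSum_periodic {Ω : ℝ} (hΩ : 0 < Ω) (S : Finset ℤ) (f : ℤ → ℂ) (t : ℝ) :
    trigSum Ω S f (t + 2 * Real.pi / Ω) = trigSum Ω S f t := by
  refine Finset.sum_congr rfl fun n _ => ?_
  congr 1
  rw [Complex.exp_eq_exp_iff_exists_int]
  refine ⟨n, ?_⟩
  have : (Ω : ℂ) ≠ 0 := by exact_mod_cast hΩ.ne'
  push_cast
  field_simp

lemma integral_exp_int {Ω : ℝ} (hΩ : 0 < Ω) (n : ℤ) :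
    ∫ t in (0 : ℝ)..2 * Real.pi / Ω, Complex.exp (Complex.I * n * Ω * t) =
      if n = 0 then ((2 * Real.pi / Ω : ℝ) : ℂ) else 0 := by
  split_ifs with hn
  · simp [hn]
  · have hΩ' : (Ω : ℂ) ≠ 0 := by exact_mod_cast hΩ.ne'
    have hn' : (n : ℂ) ≠ 0 := by exact_mod_cast hn
    rw [integral_exp_mul_complex (by simp [hΩ', hn', Complex.I_ne_zero])]
    have : Complex.I * n * Ω * ((2 * Real.pi / Ω : ℝ) : ℂ) = n * (2 * Real.pi * Complex.I) := by
      push_cast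
      field_simp
    rw [this, Complex.exp_int_mul_two_pi_mul_I]
    simp

lemma integral_trigSum_mul_conj {Ω : ℝ} (hΩ : 0 < Ω) (S : Finset ℤ) (f g : ℤ → ℂ) :
    ∫ t in (0 : ℝ)..2 * Real.pi / Ω,
      trigSum Ω S f t * (starRingEnd ℂ) (trigSum Ω S g t) =
      ((2 * Real.pi / Ω : ℝ) : ℂ) * ∑ n ∈ S, f n * (starRingEnd ℂ) (g n) := by
  have h : ∀ t : ℝ, trigSum Ω S f t * (starRingEnd ℂ) (trigSum Ω S g t) =
      ∑ n ∈ S, ∑ m ∈ S, f n * (starRingEnd ℂ) (g m) *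
        Complex.exp (Complex.I * (n - m : ℤ) * Ω * t) := by
    intro t
    simp only [trigSum, map_sum, Finset.sum_mul_sum, map_mul, ← Complex.exp_conj]
    refine Finset.sum_congr rfl fun n _ => Finset.sum_congr rfl fun m _ => ?_
    have : Complex.exp (Complex.I * (n - m : ℤ) * Ω * t) =
        Complex.exp (Complex.I * n * Ω * t) * Complex.exp (-(Complex.I * m * Ω * t)) := by
      rw [← Complex.exp_add]
      push_cast
      ring_nf
    rw [this]
    simp only [Complex.conj_I, Complex.conj_ofReal, map_intCast]
    ring_nf
  simp_rw [h]
  rw [intervalIntegral.integral_finsetSum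
    (fun n _ => Continuous.intervalIntegrable (by fun_prop) _ _), Finset.mul_sum]
  refine Finset.sum_congr rfl fun n hn => ?_
  rw [intervalIntegral.integral_finsetSum
    (fun n _ => Continuous.intervalIntegrable (by fun_prop) _ _)]
  simp_rw [intervalIntegral.integral_const_mul, integral_exp_int hΩ, sub_eq_zero]
  rw [Finset.sum_eq_single n (fun m _ hm => by simp [hm.symm]) (fun h => absurd hn h)]
  simp
  ring

lemma two_pi_div_pos {Ω : ℝ} (hΩ : 0 < Ω) : 0 < 2 * Real.pi / Ω := by positivity

/-- Parseval's identity for trigonometric polynomials. -/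
lemma msq_trigSum {Ω : ℝ} (hΩ : 0 < Ω) (S : Finset ℤ) (f : ℤ → ℂ) :
    msq Ω (trigSum Ω S f) = ∑ n ∈ S, ‖f n‖ ^ 2 := by
  have h := integral_trigSum_mul_conj hΩ S f f
  simp only [Complex.mul_conj, Complex.normSq_eq_norm_sq] at h
  rw [intervalIntegral.integral_ofReal] at h
  have h' : ∫ t in (0 : ℝ)..2 * Real.pi / Ω, ‖trigSum Ω S f t‖ ^ 2 =
      2 * Real.pi / Ω * ∑ n ∈ S, ‖f n‖ ^ 2 := by
    exact_mod_cast h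
  unfold msq
  rw [h']
  field_simp

lemma msq_nonneg {Ω : ℝ} (hΩ : 0 < Ω) (h : ℝ → ℂ) : 0 ≤ msq Ω h := by
  unfold msq
  have := intervalIntegral.integral_nonneg (μ := MeasureTheory.volume) (two_pi_div_pos hΩ).le
    (fun t _ => by positivity : ∀ t ∈ Icc 0 (2 * Real.pi / Ω), 0 ≤ ‖h t‖ ^ 2)
  positivity

lemma msq_mono {Ω : ℝ} (hΩ : 0 < Ω) {h k : ℝ → ℂ} (hh : Continuous h) (hk : Continuous k)
    {C : ℝ} (hle : ∀ t, ‖h t‖ ^ 2 ≤ C * ‖k t‖ ^ 2) : msq Ω h ≤ C * msq Ω k := by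
  unfold msq
  have := intervalIntegral.integral_mono_on (μ := MeasureTheory.volume) (two_pi_div_pos hΩ).le
    (Continuous.intervalIntegrable (by fun_prop) 0 _)
    (Continuous.intervalIntegrable (by fun_prop) _ _)
    (fun t _ => hle t)
  rw [intervalIntegral.integral_const_mul] at this
  calc _ ≤ Ω / (2 * Real.pi) * (C * ∫ t in (0 : ℝ)..2 * Real.pi / Ω, ‖k t‖ ^ 2) := by gcongr
    _ = _ := by ring

lemma msq_sub_le {Ω : ℝ} (hΩ : 0 < Ω) {h k : ℝ → ℂ} (hh : Continuous h) (hk : Continuous k) :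
    msq Ω (fun t => h t - k t) ≤ 2 * msq Ω h + 2 * msq Ω k := by
  unfold msq
  have := intervalIntegral.integral_mono_on (μ := MeasureTheory.volume) (two_pi_div_pos hΩ).le
    (f := fun t => ‖h t - k t‖ ^ 2) (g := fun t => 2 * ‖h t‖ ^ 2 + 2 * ‖k t‖ ^ 2)
    (Continuous.intervalIntegrable (by fun_prop) 0 _)
    (Continuous.intervalIntegrable (by fun_prop) _ _)
    (fun t _ => by
      have h1 := norm_sub_le (h t) (k t)
      have h2 := norm_nonneg (h t - k t)
      nlinarith [sq_nonneg (‖h t‖ - ‖k t‖)])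
  rw [intervalIntegral.integral_add (Continuous.intervalIntegrable (by fun_prop) _ _)
    (Continuous.intervalIntegrable (by fun_prop) _ _), intervalIntegral.integral_const_mul,
    intervalIntegral.integral_const_mul] at this
  calc _ ≤ Ω / (2 * Real.pi) * (2 * (∫ t in (0 : ℝ)..2 * Real.pi / Ω, ‖h t‖ ^ 2) +
        2 * ∫ t in (0 : ℝ)..2 * Real.pi / Ω, ‖k t‖ ^ 2) := by gcongr
    _ = _ := by ring

lemma trigSum_restrict {Ω : ℝ} {S S' : Finset ℤ} (hS : S ⊆ S') (f : ℤ → ℂ) (t : ℝ) :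
    trigSum Ω S' (restrict S f) t = trigSum Ω S f t := by
  unfold trigSum restrict
  rw [← Finset.sum_subset hS (fun n _ hn => by simp [hn])]
  exact Finset.sum_congr rfl fun n hn => by simp [hn]

lemma sum_restrict {S S' : Finset ℤ} (hS : S ⊆ S') (f : ℤ → ℂ) :
    ∑ n ∈ S', ‖restrict S f n‖ ^ 2 = ∑ n ∈ S, ‖f n‖ ^ 2 := by
  unfold restrict
  rw [← Finset.sum_subset hS (fun n _ hn => by simp [hn])]
  exact Finset.sum_congr rfl fun n hn => by simp [hn]

/-- Multiplication by a trigonometric polynomial of degree `M` acts on coefficients by `conv`. -/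
lemma trigSum_mul_trigSum (Ω : ℝ) (M I : ℕ) (h f : ℤ → ℂ) (t : ℝ) :
    trigSum Ω (band M) h t * trigSum Ω (band I) f t =
      trigSum Ω (band (I + M)) (conv M h (restrict (band I) f)) t := by
  have key : ∀ m ∈ band M, ∑ k ∈ band (I + M), restrict (band I) f (k - m) *
      Complex.exp (Complex.I * k * Ω * t) =
      ∑ n ∈ band I, f n * Complex.exp (Complex.I * (n + m : ℤ) * Ω * t) := by
    intro m hm
    have hsub : (band I).map (addRightEmbedding m) ⊆ band (I + M) := by
      intro k hk
      simp only [Finset.mem_map, addRightEmbedding_apply] at hk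
      obtain ⟨n, hn, rfl⟩ := hk
      rw [mem_band] at *
      push_cast
      omega
    rw [← Finset.sum_subset hsub, Finset.sum_map]
    · refine Finset.sum_congr rfl fun n hn => ?_
      simp [restrict, hn]
    · intro k _ hk
      have : k - m ∉ band I := fun h' => hk (by
        simp only [Finset.mem_map, addRightEmbedding_apply]
        exact ⟨k - m, h', by ring⟩)
      simp [restrict, this]
  have : trigSum Ω (band (I + M)) (conv M h (restrict (band I) f)) t =
      ∑ m ∈ band M, h m * ∑ k ∈ band (I + M), restrict (band I) f (k - m) *
        Complex.exp (Complex.I * k * Ω * t) := by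
    simp only [trigSum, conv, Finset.sum_mul, Finset.mul_sum]
    rw [Finset.sum_comm]
    simp [mul_assoc]
  rw [this, trigSum, trigSum, Finset.sum_mul]
  refine Finset.sum_congr rfl fun m hm => ?_
  rw [key m hm, Finset.mul_sum, Finset.mul_sum]
  refine Finset.sum_congr rfl fun n _ => ?_
  have : Complex.exp (Complex.I * (n + m : ℤ) * Ω * t) =
      Complex.exp (Complex.I * m * Ω * t) * Complex.exp (Complex.I * n * Ω * t) := by
    rw [← Complex.exp_add]
    push_cast
    ring_nf
  rw [this]
  ring

/-- Truncating before convolving, rather than after, only costs a term from the window of indices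
within `2M` above the truncation. -/
lemma conv_restrict (M I : ℕ) (h f : ℤ → ℂ) {n : ℤ} (hn : n ∈ band (I + M)) :
    conv M h (restrict (band I) f) n =
      conv M h f n - conv M h (restrict (band (I + 2 * M) \ band I) f) n := by
  unfold conv
  rw [← Finset.sum_sub_distrib]
  refine Finset.sum_congr rfl fun m hm => ?_
  have h1 : n - m ∈ band (I + 2 * M) := by
    rw [mem_band] at *
    push_cast at *
    omega
  by_cases h2 : n - m ∈ band I <;> simp [restrict, h1, h2]

lemma mul_trigSum_eq (Ω : ℝ) (M I : ℕ) (h f : ℤ → ℂ) (t : ℝ) :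
    trigSum Ω (band M) h t * trigSum Ω (band I) f t =
      trigSum Ω (band (I + M)) (conv M h f) t -
      trigSum Ω (band (I + M)) (conv M h (restrict (band (I + 2 * M) \ band I) f)) t := by
  rw [trigSum_mul_trigSum, ← trigSum_sub]
  exact trigSum_congr (fun n hn => conv_restrict M I h f hn) t

lemma energy_conv_restrict_le {Ω : ℝ} (hΩ : 0 < Ω) {M : ℕ} {h : ℤ → ℂ} {C : ℝ}
    (hC : ∀ t, ‖trigSum Ω (band M) h t‖ ≤ C) (J I : ℕ)
    (hJ : J ≤ I + M) {S : Finset ℤ} (hS : S ⊆ band I) (f : ℤ → ℂ) :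
    energy J (conv M h (restrict S f)) ≤ C ^ 2 * ∑ n ∈ S, ‖f n‖ ^ 2 := by
  have hres : restrict (band I) (restrict S f) = restrict S f := by
    funext n
    by_cases hn : n ∈ S
    · simp [restrict, hn, hS hn]
    · simp [restrict, hn]
  refine (energy_mono hJ _).trans ?_
  have e1 := msq_trigSum hΩ (band (I + M)) (conv M h (restrict S f))
  have e2 := msq_trigSum hΩ (band I) (restrict S f)
  rw [sum_restrict hS] at e2
  rw [energy, ← e1, ← e2]
  refine msq_mono hΩ (continuous_trigSum _ _ _) (continuous_trigSum _ _ _) fun t => ?_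
  rw [← hres, ← trigSum_mul_trigSum, hres, norm_mul, mul_pow]
  gcongr
  exact hC t

lemma energy_conv_le {Ω : ℝ} (hΩ : 0 < Ω) {M : ℕ} {h : ℤ → ℂ} {C : ℝ}
    (hC : ∀ t, ‖trigSum Ω (band M) h t‖ ≤ C) (J : ℕ) (f : ℤ → ℂ) :
    energy J (conv M h f) ≤ C ^ 2 * energy (J + M) f := by
  have h1 : energy J (conv M h f) = energy J (conv M h (restrict (band (J + M)) f)) := by
    unfold energy conv
    refine Finset.sum_congr rfl fun n hn => ?_
    congr 2
    refine Finset.sum_congr rfl fun m hm => ?_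
    have : n - m ∈ band (J + M) := by
      rw [mem_band] at *
      push_cast
      omega
    simp [restrict, this]
  rw [h1]
  exact energy_conv_restrict_le hΩ hC J (J + M) (by omega) (Finset.Subset.refl _) f

lemma energy_conv_window_le {Ω : ℝ} (hΩ : 0 < Ω) {M : ℕ} {h : ℤ → ℂ} {C : ℝ}
    (hC : ∀ t, ‖trigSum Ω (band M) h t‖ ≤ C) (I : ℕ) (f : ℤ → ℂ) :
    energy (I + M) (conv M h (restrict (band (I + 2 * M) \ band I) f)) ≤
      C ^ 2 * (energy (I + 2 * M) f - energy I f) := by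
  have := energy_conv_restrict_le hΩ hC (I + M) (I + 2 * M) (by omega)
    (S := band (I + 2 * M) \ band I) Finset.sdiff_subset f
  rwa [energy_window (by omega)] at this

/-- Division by a multiplier bounded below, up to a window term. -/
lemma energy_le_energy_conv {Ω : ℝ} (hΩ : 0 < Ω) {M : ℕ} {h : ℤ → ℂ} {c C : ℝ}
    (hC : ∀ t, ‖trigSum Ω (band M) h t‖ ≤ C)
    (hc0 : 0 ≤ c) (hc : ∀ t, c ≤ ‖trigSum Ω (band M) h t‖) (I : ℕ) (f : ℤ → ℂ) :
    c ^ 2 * energy I f ≤ 2 * energy (I + M) (conv M h f) +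
      2 * C ^ 2 * (energy (I + 2 * M) f - energy I f) := by
  have e1 := msq_trigSum hΩ (band I) f
  have e2 := msq_trigSum hΩ (band (I + M)) (conv M h f)
  have e3 := msq_trigSum hΩ (band (I + M)) (conv M h (restrict (band (I + 2 * M) \ band I) f))
  have h3 := energy_conv_window_le hΩ hC I f
  have hle := msq_sub_le hΩ (continuous_trigSum Ω (band (I + M)) (conv M h f))
    (continuous_trigSum Ω (band (I + M)) (conv M h (restrict (band (I + 2 * M) \ band I) f)))
  simp_rw [← mul_trigSum_eq] at hle
  have hlow : msq Ω (fun t => (c : ℂ) * trigSum Ω (band I) f t) ≤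
      1 * msq Ω (fun t => trigSum Ω (band M) h t * trigSum Ω (band I) f t) := by
    refine msq_mono hΩ (by have := continuous_trigSum Ω (band I) f; fun_prop)
      ((continuous_trigSum _ _ _).mul (continuous_trigSum _ _ _)) fun t => ?_
    rw [one_mul, Pi.mul_apply, norm_mul, norm_mul, mul_pow, mul_pow, Complex.norm_real,
      Real.norm_of_nonneg hc0]
    gcongr
    exact hc t
  have hcm : msq Ω (fun t => (c : ℂ) * trigSum Ω (band I) f t) = c ^ 2 * energy I f := by
    simp_rw [← trigSum_mul_left]
    rw [msq_trigSum hΩ]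
    simp [energy, mul_pow, Finset.mul_sum]
  rw [e2, e3, ← energy, ← energy] at hle
  linarith

/-- Coercivity of a positive multiplier, up to a window term. -/
lemma energy_le_re_inner {Ω : ℝ} (hΩ : 0 < Ω) {M : ℕ} {h : ℤ → ℂ} {c C : ℝ}
    (hC : ∀ t, ‖trigSum Ω (band M) h t‖ ≤ C) (hc0 : 0 < c)
    {g : ℝ → ℝ} (hg : ∀ t, trigSum Ω (band M) h t = g t) (hc : ∀ t, c ≤ g t)
    (I : ℕ) (f : ℤ → ℂ) :
    c / 2 * energy I f ≤ (∑ n ∈ band I, conv M h f n * (starRingEnd ℂ) (f n)).re +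
      C ^ 2 / (2 * c) * (energy (I + 2 * M) f - energy I f) := by
  set w := conv M h (restrict (band (I + 2 * M) \ band I) f) with hw
  have hwin : energy I w ≤ C ^ 2 * (energy (I + 2 * M) f - energy I f) :=
    (energy_mono (by omega) _).trans (energy_conv_window_le hΩ hC I f)
  have hsub : band I ⊆ band (I + M) := band_mono (by omega)
  have hin := integral_trigSum_mul_conj hΩ (band (I + M)) (conv M h (restrict (band I) f))
    (restrict (band I) f)
  simp_rw [← trigSum_mul_trigSum, trigSum_restrict hsub, mul_assoc, Complex.mul_conj,
    Complex.normSq_eq_norm_sq, hg, ← Complex.ofReal_mul] at hin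
  rw [intervalIntegral.integral_ofReal] at hin
  have hsum : ∑ n ∈ band (I + M), conv M h (restrict (band I) f) n *
      (starRingEnd ℂ) (restrict (band I) f n) =
      ∑ n ∈ band I, (conv M h f n - w n) * (starRingEnd ℂ) (f n) := by
    rw [← Finset.sum_subset hsub (fun n _ hn => by simp [restrict, hn])]
    refine Finset.sum_congr rfl fun n hn => ?_
    rw [conv_restrict M I h f (hsub hn)]
    simp [restrict, hn, hw]
  rw [hsum] at hin
  have hre := congrArg Complex.re hin
  rw [Complex.re_ofReal_mul, Complex.ofReal_re] at hre
  have hcoer : c * ∫ t in (0 : ℝ)..2 * Real.pi / Ω, ‖trigSum Ω (band I) f t‖ ^ 2 ≤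
      ∫ t in (0 : ℝ)..2 * Real.pi / Ω, g t * ‖trigSum Ω (band I) f t‖ ^ 2 := by
    rw [← intervalIntegral.integral_const_mul]
    have hgc : Continuous g := by
      have : g = fun t => (trigSum Ω (band M) h t).re := by
        funext t
        simp [hg]
      rw [this]
      exact Complex.continuous_re.comp (continuous_trigSum _ _ _)
    have := continuous_trigSum Ω (band I) f
    refine intervalIntegral.integral_mono_on (two_pi_div_pos hΩ).le
      (Continuous.intervalIntegrable (by fun_prop) _ _)
      (Continuous.intervalIntegrable (by fun_prop) _ _) fun t _ => ?_
    gcongr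
    exact hc t
  have e1 := msq_trigSum hΩ (band I) f
  rw [msq, ← energy] at e1
  have hT := two_pi_div_pos hΩ
  have hlow : c * energy I f ≤
      (∑ n ∈ band I, (conv M h f n - w n) * (starRingEnd ℂ) (f n)).re := by
    have h1 : (2 * Real.pi / Ω) * (c * energy I f) ≤ (2 * Real.pi / Ω) *
        (∑ n ∈ band I, (conv M h f n - w n) * (starRingEnd ℂ) (f n)).re := by
      rw [← hre]
      refine le_trans (le_of_eq ?_) hcoer
      rw [← e1]
      field_simp
    exact le_of_mul_le_mul_left h1 hT
  have hcross : -(∑ n ∈ band I, w n * (starRingEnd ℂ) (f n)).re ≤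
      1 / (2 * c) * energy I w + c / 2 * energy I f := by
    rw [Complex.re_sum, energy, energy, Finset.mul_sum, Finset.mul_sum, ← Finset.sum_add_distrib,
      ← Finset.sum_neg_distrib]
    refine Finset.sum_le_sum fun n _ => ?_
    have h1 : -(w n * (starRingEnd ℂ) (f n)).re ≤ ‖w n‖ * ‖f n‖ := by
      have := Complex.abs_re_le_norm (w n * (starRingEnd ℂ) (f n))
      rw [norm_mul, RCLike.norm_conj] at this
      exact (neg_le_abs _).trans this
    have h2 : ‖w n‖ * ‖f n‖ ≤ 1 / (2 * c) * ‖w n‖ ^ 2 + c / 2 * ‖f n‖ ^ 2 := by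
      have : 1 / (2 * c) * ‖w n‖ ^ 2 + c / 2 * ‖f n‖ ^ 2 - ‖w n‖ * ‖f n‖ =
        (‖w n‖ - c * ‖f n‖) ^ 2 / (2 * c) := by
        field_simp
        ring
      have h0 : 0 ≤ (‖w n‖ - c * ‖f n‖) ^ 2 / (2 * c) := by positivity
      linarith
    linarith
  have hsplit : (∑ n ∈ band I, (conv M h f n - w n) * (starRingEnd ℂ) (f n)).re =
      (∑ n ∈ band I, conv M h f n * (starRingEnd ℂ) (f n)).re -
      (∑ n ∈ band I, w n * (starRingEnd ℂ) (f n)).re := by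
    rw [← Complex.sub_re, ← Finset.sum_sub_distrib]
    simp_rw [sub_mul]
  have hw2 : 1 / (2 * c) * energy I w ≤
      C ^ 2 / (2 * c) * (energy (I + 2 * M) f - energy I f) := by
    calc _ ≤ 1 / (2 * c) * (C ^ 2 * (energy (I + 2 * M) f - energy I f)) := by gcongr
      _ = _ := by ring
  linarith

/-- A quantity which, up to a bound `B`, is controlled by its own increments decays geometrically
to the bound `B / c` as the number of available increments grows. -/
lemma le_of_increment_bound {E : ℕ → ℝ} {c C B : ℝ} (hc : 0 < c) (hC : 0 ≤ C) (hB : 0 ≤ B)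
    (p : ℕ) : ∀ (r I : ℕ),
    (∀ j < r, c * E (I + p * j) ≤ B + C * (E (I + p * (j + 1)) - E (I + p * j))) →
    E I ≤ B / c + (C / (c + C)) ^ r * E (I + p * r) := by
  intro r
  induction r with
  | zero => intro I _; simp; positivity
  | succ r ih =>
    intro I hI
    have h1 := ih (I + p) fun j hj => by
      have := hI (j + 1) (by omega)
      have e1 : I + p + p * j = I + p * (j + 1) := by ring
      have e2 : I + p + p * (j + 1) = I + p * (j + 1 + 1) := by ring
      rwa [e1, e2]
    have h2 := hI 0 (by omega)
    simp only [mul_zero, add_zero, zero_add, mul_one] at h2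
    have hcC : 0 < c + C := by positivity
    have e : I + p + p * r = I + p * (r + 1) := by ring
    rw [e] at h1
    have h3 : (c + C) * E I ≤ B + C * E (I + p) := by linarith
    have h4 : E I ≤ B / (c + C) + C / (c + C) * E (I + p) := by
      rw [div_mul_eq_mul_div, ← add_div, le_div_iff₀ hcC]
      linarith
    have h5 : C / (c + C) * E (I + p) ≤
        C / (c + C) * (B / c + (C / (c + C)) ^ r * E (I + p * (r + 1))) := by gcongr
    have h6 : B / (c + C) + C / (c + C) * (B / c) = B / c := by field_simp
    rw [pow_succ]
    linarith

/-- Among `r` consecutive increments of a bounded monotone quantity, one is small. -/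
lemma exists_small_increment {S : ℕ → ℝ} {A : ℝ} (p r I : ℕ) (hr : 0 < r)
    (h0 : 0 ≤ S I) (hA : S (I + p * r) ≤ A) :
    ∃ j < r, S (I + p * (j + 1)) - S (I + p * j) ≤ A / r := by
  by_contra! hcon
  have h1 : ∑ j ∈ Finset.range r, (S (I + p * (j + 1)) - S (I + p * j)) =
      S (I + p * r) - S I := by
    have := Finset.sum_range_sub (fun j => S (I + p * j)) r
    simpa using this
  have h2 : ∑ j ∈ Finset.range r, A / (r : ℝ) <
      ∑ j ∈ Finset.range r, (S (I + p * (j + 1)) - S (I + p * j)) :=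
    Finset.sum_lt_sum_of_nonempty (by simp; omega) fun j hj => hcon j (Finset.mem_range.1 hj)
  have hr' : (r : ℝ) ≠ 0 := by positivity
  rw [h1, Finset.sum_const, Finset.card_range, nsmul_eq_mul, mul_div_cancel₀ _ hr'] at h2
  linarith

/-! ### Calculus on an interval -/

lemma sq_integral_le {u : ℝ → ℝ} (hu : Continuous u) {p q : ℝ} (hpq : p < q) :
    (∫ x in p..q, u x) ^ 2 ≤ (q - p) * ∫ x in p..q, u x ^ 2 := by
  set m := (∫ x in p..q, u x) / (q - p) with hm
  have hd : 0 < q - p := sub_pos.2 hpq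
  have h0 : 0 ≤ ∫ x in p..q, (u x - m) ^ 2 :=
    intervalIntegral.integral_nonneg hpq.le fun x _ => sq_nonneg _
  have h1 : ∫ x in p..q, (u x - m) ^ 2 =
      (∫ x in p..q, u x ^ 2) - 2 * m * (∫ x in p..q, u x) + m ^ 2 * (q - p) := by
    have : ∀ x, (u x - m) ^ 2 = u x ^ 2 - 2 * m * u x + m ^ 2 := fun x => by ring
    simp_rw [this]
    rw [intervalIntegral.integral_add (Continuous.intervalIntegrable (by fun_prop) _ _)
      (Continuous.intervalIntegrable (by fun_prop) _ _),
      intervalIntegral.integral_sub (Continuous.intervalIntegrable (by fun_prop) _ _)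
      (Continuous.intervalIntegrable (by fun_prop) _ _), intervalIntegral.integral_const_mul,
      intervalIntegral.integral_const]
    simp
    ring
  have h2 : ∫ x in p..q, u x = m * (q - p) := by
    rw [hm]
    field_simp
  rw [h1, h2] at h0
  rw [h2]
  nlinarith

lemma norm_sq_integral_le {f : ℝ → ℂ} (hf : Continuous f) {p q : ℝ} (hpq : p < q) :
    ‖∫ x in p..q, f x‖ ^ 2 ≤ (q - p) * ∫ x in p..q, ‖f x‖ ^ 2 := by
  refine le_trans ?_ (sq_integral_le hf.norm hpq)
  gcongr
  exact intervalIntegral.norm_integral_le_integral_norm hpq.le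

section

variable {f f' f'' : ℝ → ℂ} {p q : ℝ}

lemma norm_slope_sub_le (hf : ∀ x, HasDerivAt f (f' x) x) {B : ℝ} {z : ℂ}
    (hB : ∀ s ∈ Icc p q, ‖f' s - z‖ ≤ B) {x y : ℝ} (hx : x ∈ Icc p q) (hy : y ∈ Icc p q) :
    ‖f y - f x - z * (y - x)‖ ≤ B * |y - x| := by
  have := (convex_Icc p q).norm_image_sub_le_of_norm_hasDerivWithin_le
    (f := fun t : ℝ => f t - z * t) (f' := fun t => f' t - z) (C := B)
    (fun t _ => by
      have h1 : HasDerivAt (fun t : ℝ => z * (t : ℂ)) z t := by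
        simpa using (Complex.ofRealCLM.hasDerivAt (x := t)).const_mul z
      exact ((hf t).sub h1).hasDerivWithinAt) hB hx hy
  rw [Real.norm_eq_abs] at this
  refine le_of_eq_of_le ?_ this
  congr 1
  ring

/-- On an interval short compared with the wavelength, the derivative of a solution of the
Helmholtz equation is close to the slope of its boundary values. -/
lemma helmholtz_slope (hf : ∀ x, HasDerivAt f (f' x) x) (hf' : ∀ x, HasDerivAt f' (f'' x) x)
    (hpq : p < q) {z : ℂ} (heq : ∀ x ∈ Icc p q, f'' x = -z ^ 2 * f x)
    (hz : ‖z‖ ^ 2 * (q - p) ^ 2 ≤ 1 / 2) {x : ℝ} (hx : x ∈ Icc p q) :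
    ‖f' x - (f q - f p) / (q - p)‖ ≤ 4 * (q - p) * ‖z‖ ^ 2 * (‖f p‖ + ‖f q‖) := by
  have hd : 0 < q - p := sub_pos.2 hpq
  have hfc : Continuous f := continuous_iff_continuousAt.2 fun x => (hf x).continuousAt
  obtain ⟨x₀, hx₀, hmax⟩ := isCompact_Icc.exists_isMaxOn (nonempty_Icc.2 hpq.le)
    hfc.norm.continuousOn
  set m := ‖f x₀‖ with hm
  have hle : ∀ t ∈ Icc p q, ‖f t‖ ≤ m := fun t ht => hmax ht
  have hp : p ∈ Icc p q := left_mem_Icc.2 hpq.le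
  have hq : q ∈ Icc p q := right_mem_Icc.2 hpq.le
  set B := (q - p) * ‖z‖ ^ 2 * m with hB
  have hvar : ∀ s ∈ Icc p q, ∀ t ∈ Icc p q, ‖f' t - f' s‖ ≤ B := by
    intro s hs t ht
    have := (convex_Icc p q).norm_image_sub_le_of_norm_hasDerivWithin_le (f := f') (f' := f'')
      (C := ‖z‖ ^ 2 * m) (fun t _ => (hf' t).hasDerivWithinAt) (fun t ht => by
        rw [heq t ht, norm_mul, norm_neg, norm_pow]
        gcongr
        exact hle t ht) hs ht
    refine this.trans ?_
    have : ‖t - s‖ ≤ q - p := by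
      rw [Real.norm_eq_abs, abs_le]
      constructor <;> linarith [hs.1, hs.2, ht.1, ht.2]
    calc ‖z‖ ^ 2 * m * ‖t - s‖ ≤ ‖z‖ ^ 2 * m * (q - p) := by gcongr
      _ = B := by rw [hB]; ring
  have hslope : ∀ s ∈ Icc p q, ‖f' s - (f q - f p) / (q - p)‖ ≤ B := by
    intro s hs
    have h1 := norm_slope_sub_le hf (fun t ht => hvar s hs t ht) hp hq
    rw [abs_of_pos hd] at h1
    have hdc : ((q : ℂ) - p) ≠ 0 := by
      rw [← Complex.ofReal_sub]
      exact_mod_cast hd.ne'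
    have h2 : f' s - (f q - f p) / (q - p) = -(f q - f p - f' s * (q - p)) / (q - p) := by
      field_simp
      ring
    rw [h2, norm_div, norm_neg, ← Complex.ofReal_sub, Complex.norm_real,
      Real.norm_of_nonneg hd.le, div_le_iff₀ hd, Complex.ofReal_sub]
    exact h1
  have hmle : m ≤ 4 * (‖f p‖ + ‖f q‖) := by
    have h1 := norm_slope_sub_le hf (fun t ht => hslope t ht) hp hx₀
    have habs : |x₀ - p| = x₀ - p := abs_of_nonneg (by linarith [hx₀.1])
    rw [habs] at h1
    set σ := (f q - f p) / (q - p) with hσ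
    have h2 : ‖σ * (x₀ - p)‖ ≤ ‖f p‖ + ‖f q‖ := by
      rw [hσ, norm_mul, norm_div, ← Complex.ofReal_sub, ← Complex.ofReal_sub, Complex.norm_real,
        Complex.norm_real, Real.norm_of_nonneg hd.le, Real.norm_of_nonneg (by linarith [hx₀.1])]
      calc ‖f q - f p‖ / (q - p) * (x₀ - p) ≤ ‖f q - f p‖ / (q - p) * (q - p) := by
            gcongr
            exact hx₀.2
        _ = ‖f q - f p‖ := by field_simp
        _ ≤ _ := by linarith [norm_sub_le (f q) (f p)]
    have h3 : f x₀ = (f x₀ - f p - σ * (x₀ - p)) + (f p + σ * (x₀ - p)) := by ring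
    have h4 : m ≤ B * (x₀ - p) + (‖f p‖ + (‖f p‖ + ‖f q‖)) := by
      rw [hm, h3]
      refine (norm_add_le _ _).trans (add_le_add h1 ((norm_add_le _ _).trans ?_))
      linarith
    have h5 : B * (x₀ - p) ≤ 1 / 2 * m := by
      have hm0 : 0 ≤ m := norm_nonneg _
      calc B * (x₀ - p) ≤ B * (q - p) := by
            gcongr
            exact hx₀.2
        _ = ‖z‖ ^ 2 * (q - p) ^ 2 * m := by rw [hB]; ring
        _ ≤ 1 / 2 * m := by gcongr
    linarith [norm_nonneg (f p), norm_nonneg (f q)]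
  calc _ ≤ B := hslope x hx
    _ ≤ (q - p) * ‖z‖ ^ 2 * (4 * (‖f p‖ + ‖f q‖)) := by rw [hB]; gcongr
    _ = _ := by ring

lemma norm_sub_sq_le_integral (hf' : ∀ x, HasDerivAt f' (f'' x) x) (hc : Continuous f'')
    (hpq : p < q) {x y : ℝ} (hx : x ∈ Icc p q) (hy : y ∈ Icc p q) :
    ‖f' y - f' x‖ ^ 2 ≤ (q - p) * ∫ s in p..q, ‖f'' s‖ ^ 2 := by
  wlog hxy : x ≤ y generalizing x y
  · rw [norm_sub_rev]
    exact this hy hx (le_of_not_ge hxy)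
  refine le_trans ?_ (sq_integral_le hc.norm hpq)
  rw [← intervalIntegral.integral_eq_sub_of_hasDerivAt (fun t _ => hf' t)
    (hc.intervalIntegrable _ _)]
  gcongr
  refine (intervalIntegral.norm_integral_le_integral_norm hxy).trans ?_
  exact intervalIntegral.integral_mono_interval hx.1 hxy hy.2
    (Eventually.of_forall fun t => norm_nonneg _) (hc.norm.intervalIntegrable _ _)

lemma norm_deriv_sq_le (hf' : ∀ x, HasDerivAt f' (f'' x) x) (hc : Continuous f'')
    (hpq : p < q) {x : ℝ} (hx : x ∈ Icc p q) :
    ‖f' x‖ ^ 2 ≤ 2 * ‖f' p‖ ^ 2 + 2 * ((q - p) * ∫ s in p..q, ‖f'' s‖ ^ 2) := by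
  have h1 := norm_sub_sq_le_integral hf' hc hpq (left_mem_Icc.2 hpq.le) hx
  have h2 : ‖f' x‖ ≤ ‖f' p‖ + ‖f' x - f' p‖ := by
    have := norm_add_le (f' p) (f' x - f' p)
    simpa using this
  nlinarith [sq_nonneg (‖f' p‖ - ‖f' x - f' p‖), norm_nonneg (f' x)]

lemma norm_sub_left_sq_le (hf : ∀ x, HasDerivAt f (f' x) x) (hf' : ∀ x, HasDerivAt f' (f'' x) x)
    (hc : Continuous f'') (hpq : p < q) {x : ℝ} (hx : x ∈ Icc p q) :
    ‖f x - f p‖ ^ 2 ≤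
      (q - p) ^ 2 * (2 * ‖f' p‖ ^ 2 + 2 * ((q - p) * ∫ s in p..q, ‖f'' s‖ ^ 2)) := by
  set R := 2 * ‖f' p‖ ^ 2 + 2 * ((q - p) * ∫ s in p..q, ‖f'' s‖ ^ 2) with hR
  have hR0 : 0 ≤ R := (sq_nonneg _).trans (norm_deriv_sq_le hf' hc hpq hx)
  have h1 := norm_slope_sub_le (B := √R) (z := 0) hf (fun s hs => by
    rw [sub_zero]
    exact Real.le_sqrt_of_sq_le (norm_deriv_sq_le hf' hc hpq hs)) (left_mem_Icc.2 hpq.le) hx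
  rw [zero_mul, sub_zero, abs_of_nonneg (by linarith [hx.1])] at h1
  calc ‖f x - f p‖ ^ 2 ≤ (√R * (x - p)) ^ 2 := by gcongr
    _ = (x - p) ^ 2 * R := by rw [mul_pow, Real.sq_sqrt hR0]; ring
    _ ≤ (q - p) ^ 2 * R := by
      gcongr
      · linarith [hx.1]
      · exact hx.2

lemma exists_norm_sq_le_average {f : ℝ → ℂ} (hf : Continuous f) {p q a b : ℝ} (hpa : p ≤ a)
    (hab : a < b) (hbq : b ≤ q) :
    ∃ y ∈ Icc a b, (b - a) * ‖f y‖ ^ 2 ≤ ∫ s in p..q, ‖f s‖ ^ 2 := by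
  obtain ⟨y, hy, hmin⟩ := isCompact_Icc.exists_isMinOn (nonempty_Icc.2 hab.le)
    (hf.norm.pow 2).continuousOn
  refine ⟨y, hy, ?_⟩
  have h1 : ∫ _ in a..b, ‖f y‖ ^ 2 ≤ ∫ s in a..b, ‖f s‖ ^ 2 :=
    intervalIntegral.integral_mono_on hab.le (by simp)
      (Continuous.intervalIntegrable (by fun_prop) _ _) fun s hs => hmin hs
  rw [intervalIntegral.integral_const, smul_eq_mul] at h1
  refine h1.trans ?_
  exact intervalIntegral.integral_mono_interval hpa hab.le hbq
    (Eventually.of_forall fun t => by positivity)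
    (Continuous.intervalIntegrable (by fun_prop) _ _)

/-- Pointwise control of a function and its derivative by the `L²` norms of the function and its
second derivative. -/
lemma norm_sq_le_of_integral (hf : ∀ x, HasDerivAt f (f' x) x)
    (hf' : ∀ x, HasDerivAt f' (f'' x) x) (hc : Continuous f'') {Λ : ℝ} (hΛ : 1 ≤ Λ)
    (hd1 : Λ⁻¹ ≤ q - p) (hd2 : q - p ≤ Λ) {x : ℝ} (hx : x ∈ Icc p q) :
    ‖f x‖ ^ 2 ≤ 500 * Λ ^ 3 * ((∫ s in p..q, ‖f s‖ ^ 2) + ∫ s in p..q, ‖f'' s‖ ^ 2) ∧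
    ‖f' x‖ ^ 2 ≤ 500 * Λ ^ 3 * ((∫ s in p..q, ‖f s‖ ^ 2) + ∫ s in p..q, ‖f'' s‖ ^ 2) := by
  set d := q - p with hd
  have hd0 : 0 < d := lt_of_lt_of_le (by positivity) hd1
  have hpq : p < q := by linarith
  have hfc : Continuous f := continuous_iff_continuousAt.2 fun x => (hf x).continuousAt
  obtain ⟨y, hy, hy'⟩ := exists_norm_sq_le_average hfc (le_refl p)
    (show p < p + d / 3 by linarith) (show p + d / 3 ≤ q by linarith)
  obtain ⟨w, hw, hw'⟩ := exists_norm_sq_le_average hfc (show p ≤ q - d / 3 by linarith)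
    (show q - d / 3 < q by linarith) (le_refl q)
  set X := ∫ s in p..q, ‖f s‖ ^ 2 with hX
  set Y := ∫ s in p..q, ‖f'' s‖ ^ 2 with hY
  have hX0 : 0 ≤ X := intervalIntegral.integral_nonneg hpq.le fun _ _ => by positivity
  have hY0 : 0 ≤ Y := intervalIntegral.integral_nonneg hpq.le fun _ _ => by positivity
  have hyI : y ∈ Icc p q := ⟨hy.1, by linarith [hy.2]⟩
  have hwI : w ∈ Icc p q := ⟨by linarith [hw.1], hw.2⟩
  have hder : ∀ t ∈ Icc p q, ‖f' t‖ ^ 2 ≤ 216 * X / d ^ 3 + 18 * d * Y := by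
    intro t ht
    have h1 := norm_slope_sub_le (B := √(d * Y)) (z := f' t) hf (fun s hs =>
      Real.le_sqrt_of_sq_le (norm_sub_sq_le_integral hf' hc hpq ht hs)) hyI hwI
    have hwy : d / 3 ≤ w - y := by linarith [hw.1, hy.2]
    have hwy2 : w - y ≤ d := by linarith [hw.2, hy.1]
    rw [abs_of_nonneg (by linarith)] at h1
    have h2 : ‖f' t * (w - y)‖ ≤ ‖f w‖ + ‖f y‖ + √(d * Y) * (w - y) := by
      have e : f' t * (w - y) = (f w - f y) - (f w - f y - f' t * (w - y)) := by ring
      rw [e]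
      exact (norm_sub_le _ _).trans (add_le_add (norm_sub_le _ _) h1)
    rw [norm_mul, ← Complex.ofReal_sub, Complex.norm_real, Real.norm_of_nonneg (by linarith)] at h2
    have h3 : ‖f w‖ ^ 2 ≤ 3 * X / d := by
      rw [le_div_iff₀ hd0]; linarith
    have h4 : ‖f y‖ ^ 2 ≤ 3 * X / d := by
      rw [le_div_iff₀ hd0]; linarith
    have h5 : ‖f w‖ ≤ √(3 * X / d) := Real.le_sqrt_of_sq_le h3
    have h6 : ‖f y‖ ≤ √(3 * X / d) := Real.le_sqrt_of_sq_le h4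
    have h7 : ‖f' t‖ ≤ 6 / d * √(3 * X / d) + √(d * Y) := by
      have hs0 := Real.sqrt_nonneg (d * Y)
      have h8 : (‖f' t‖ - √(d * Y)) * (w - y) ≤ 2 * √(3 * X / d) := by linarith
      have h9 : ‖f' t‖ - √(d * Y) ≤ 6 / d * √(3 * X / d) := by
        by_cases hneg : ‖f' t‖ - √(d * Y) ≤ 0
        · exact hneg.trans (by positivity)
        · push Not at hneg
          have : (‖f' t‖ - √(d * Y)) * (d / 3) ≤ 2 * √(3 * X / d) :=
            (mul_le_mul_of_nonneg_left hwy hneg.le).trans h8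
          rw [div_mul_eq_mul_div, le_div_iff₀ hd0]
          linarith
      linarith
    calc ‖f' t‖ ^ 2 ≤ (6 / d * √(3 * X / d) + √(d * Y)) ^ 2 := by gcongr
      _ ≤ 2 * (6 / d * √(3 * X / d)) ^ 2 + 2 * √(d * Y) ^ 2 := by
        nlinarith [sq_nonneg (6 / d * √(3 * X / d) - √(d * Y))]
      _ = 216 * X / d ^ 3 + 2 * d * Y := by
        rw [mul_pow, Real.sq_sqrt (by positivity), Real.sq_sqrt (by positivity)]
        field_simp
        ring
      _ ≤ _ := by nlinarith [mul_nonneg hd0.le hY0]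
  have hΛ3 : Λ ≤ Λ ^ 3 := by
    calc Λ = Λ * 1 * 1 := by ring
      _ ≤ Λ * Λ * Λ := by gcongr
      _ = _ := by ring
  have hdi : d⁻¹ ≤ Λ := inv_le_of_inv_le₀ (by positivity) hd1
  have hval : ‖f x‖ ^ 2 ≤ 438 * X / d + 36 * d ^ 3 * Y := by
    have h1 := norm_slope_sub_le (B := √(216 * X / d ^ 3 + 18 * d * Y)) (z := 0) hf (fun s hs => by
      rw [sub_zero]
      exact Real.le_sqrt_of_sq_le (hder s hs)) hyI hx
    rw [zero_mul, sub_zero] at h1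
    have hxy : |x - y| ≤ d := by
      rw [abs_le]
      constructor <;> linarith [hx.1, hx.2, hyI.1, hyI.2]
    have h2 : ‖f x - f y‖ ^ 2 ≤ (216 * X / d ^ 3 + 18 * d * Y) * d ^ 2 := by
      calc ‖f x - f y‖ ^ 2 ≤ (√(216 * X / d ^ 3 + 18 * d * Y) * d) ^ 2 := by
            gcongr
            exact h1.trans (by gcongr)
        _ = _ := by rw [mul_pow, Real.sq_sqrt (by positivity)]
    have h3 : ‖f x‖ ≤ ‖f x - f y‖ + ‖f y‖ := by
      have := norm_add_le (f x - f y) (f y)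
      simpa using this
    have h4 : ‖f y‖ ^ 2 ≤ 3 * X / d := by
      rw [le_div_iff₀ hd0]; linarith
    have h5 : ‖f x‖ ^ 2 ≤ 2 * ‖f x - f y‖ ^ 2 + 2 * ‖f y‖ ^ 2 := by
      nlinarith [sq_nonneg (‖f x - f y‖ - ‖f y‖), norm_nonneg (f x)]
    calc ‖f x‖ ^ 2 ≤ 2 * ((216 * X / d ^ 3 + 18 * d * Y) * d ^ 2) + 2 * (3 * X / d) := by linarith
      _ = _ := by
        field_simp
        ring
  have hd3 : d ^ 3 ≤ Λ ^ 3 := by gcongr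
  have hdi3 : (d⁻¹) ^ 3 ≤ Λ ^ 3 := by gcongr
  constructor
  · refine hval.trans ?_
    rw [div_eq_mul_inv]
    have e1 : X * d⁻¹ ≤ X * Λ ^ 3 := by gcongr; exact hdi.trans hΛ3
    have e2 : d ^ 3 * Y ≤ Λ ^ 3 * Y := by gcongr
    have e3 : 0 ≤ X * Λ ^ 3 := by positivity
    have e4 : 0 ≤ Λ ^ 3 * Y := by positivity
    linarith
  · refine (hder x hx).trans ?_
    have e1 : X * (d⁻¹) ^ 3 ≤ X * Λ ^ 3 := by gcongr
    have e2 : d * Y ≤ Λ ^ 3 * Y := by gcongr; exact hd2.trans hΛ3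
    have e3 : 0 ≤ X * Λ ^ 3 := by positivity
    have e4 : 0 ≤ Λ ^ 3 * Y := by positivity
    have e5 : 216 * X / d ^ 3 = 216 * (X * (d⁻¹) ^ 3) := by
      field_simp
    rw [e5]
    linarith

end

/-! ### Gaps, potentials and the capacitance matrix -/

namespace Geometry

variable {N : ℕ} (G : Geometry N)

lemma xm_mono {i k : Fin N} (h : i ≤ k) : G.xm i ≤ G.xm k := by
  rcases h.eq_or_lt with rfl | h
  · rfl
  · linarith [G.ordered i k h, G.xm_lt_xp i]

lemma xp_mono {i k : Fin N} (h : i ≤ k) : G.xp i ≤ G.xp k := by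
  rcases h.eq_or_lt with rfl | h
  · rfl
  · linarith [G.ordered i k h, G.xm_lt_xp k]

lemma mem_background {x : ℝ} : x ∈ G.background ↔
    ∀ (m : ℤ) (i : Fin N), x < G.xm i + m * G.L ∨ G.xp i + m * G.L < x := by
  simp only [background, mem_compl_iff, mem_iUnion, mem_Icc, not_exists, not_and_or, not_le]

/-- The left end of the first resonator to the right of the `k`-th one. -/
def next (k : Fin N) : ℝ :=
  if h : k.val + 1 < N then G.xm ⟨k + 1, h⟩ else G.xm ⟨0, k.pos⟩ + G.L

lemma xp_lt_next (k : Fin N) : G.xp k < G.next k := by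
  unfold next
  split_ifs with h
  · exact G.ordered _ _ (Fin.lt_def.2 (by simp))
  · linarith [G.xp_lt_L k, G.xm_pos ⟨0, k.pos⟩]

lemma next_le_xm {k i : Fin N} (h : k < i) : G.next k ≤ G.xm i := by
  have h1 : k.val + 1 < N := by have := i.isLt; have := Fin.lt_def.1 h; omega
  rw [next, dif_pos h1]
  exact G.xm_mono (Fin.le_def.2 (by have := Fin.lt_def.1 h; simp; omega))

lemma next_le (k i : Fin N) (hi : i.val = 0) : G.next k ≤ G.xm i + G.L := by
  obtain rfl : i = ⟨0, k.pos⟩ := Fin.ext hi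
  unfold next
  split_ifs with h
  · linarith [G.xm_lt_xp ⟨k + 1, h⟩, G.xp_lt_L ⟨k + 1, h⟩, G.xm_pos ⟨0, k.pos⟩]
  · rfl

lemma gap_subset_background (k : Fin N) : Ioo (G.xp k) (G.next k) ⊆ G.background := by
  intro x hx
  rw [mem_background]
  intro m i
  have hL := G.L_pos
  rcases lt_trichotomy m 0 with hm | rfl | hm
  · right
    have hm' : (m : ℝ) ≤ -1 := by exact_mod_cast (by omega : m ≤ -1)
    have : m * G.L ≤ -G.L := by nlinarith
    linarith [G.xp_lt_L i, G.xm_pos k, G.xm_lt_xp k, hx.1]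
  · simp only [Int.cast_zero, zero_mul, add_zero]
    rcases le_or_gt i k with h | h
    · right
      exact (G.xp_mono h).trans_lt hx.1
    · left
      exact hx.2.trans_le (G.next_le_xm h)
  · left
    have hm' : (1 : ℝ) ≤ m := by exact_mod_cast hm
    have h1 : G.L ≤ m * G.L := by nlinarith
    have h2 := G.next_le k ⟨0, k.pos⟩ rfl
    have h3 : G.xm ⟨0, k.pos⟩ ≤ G.xm i := G.xm_mono (Fin.le_def.2 (Nat.zero_le _))
    linarith [hx.2]

lemma background_translate {x : ℝ} (hx : x ∈ G.background) (n : ℤ) :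
    x + n * G.L ∈ G.background := by
  rw [mem_background] at *
  intro m i
  have := hx (m - n) i
  push_cast at this
  rcases this with h | h
  · left; linarith
  · right; linarith

lemma exists_right_gap (i : Fin N) : ∃ (k : Fin N) (m : ℤ), G.xp i < G.xm k + m * G.L ∧
    Ioo (G.xp i) (G.xm k + m * G.L) ⊆ G.background := by
  have h1 := G.xp_lt_next i
  have h2 := G.gap_subset_background i
  by_cases h : i.val + 1 < N
  · rw [next, dif_pos h] at h1 h2
    exact ⟨⟨i + 1, h⟩, 0, by simpa using h1, by simpa using h2⟩
  · rw [next, dif_neg h] at h1 h2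
    exact ⟨⟨0, i.pos⟩, 1, by simpa using h1, by simpa using h2⟩

lemma exists_left_gap (i : Fin N) : ∃ (k : Fin N) (m : ℤ), G.xp k + m * G.L < G.xm i ∧
    Ioo (G.xp k + m * G.L) (G.xm i) ⊆ G.background := by
  by_cases h : 0 < i.val
  · have h' : i.val - 1 + 1 < N := by have := i.isLt; omega
    set k : Fin N := ⟨i.val - 1, by omega⟩ with hk
    have e : G.next k = G.xm i := by
      rw [next, dif_pos h']
      congr 1
      exact Fin.ext (by simp [hk]; omega)
    have h1 := G.xp_lt_next k
    have h2 := G.gap_subset_background k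
    rw [e] at h1 h2
    exact ⟨k, 0, by simpa using h1, by simpa using h2⟩
  · set k : Fin N := ⟨N - 1, by have := i.pos; omega⟩ with hk
    have hi0 : i = ⟨0, k.pos⟩ := Fin.ext (by simp; omega)
    have e : G.next k = G.xm i + G.L := by
      rw [next, dif_neg (by simp [hk]; omega), hi0]
    have h1 := G.xp_lt_next k
    have h2 := G.gap_subset_background k
    rw [e] at h1 h2
    refine ⟨k, -1, by push_cast; linarith, fun x hx => ?_⟩
    push_cast at hx
    have h3 : x + G.L ∈ G.background := h2 ⟨by linarith [hx.1], by linarith [hx.2]⟩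
    have := G.background_translate h3 (-1)
    push_cast at this
    convert this using 1
    ring

/-- The continuous function which is `0` up to the `k`-th resonator, `1` from the following one
on, and affine in between. -/
def ramp (k : Fin N) (x : ℝ) : ℝ := max 0 (min 1 ((x - G.xp k) / (G.next k - G.xp k)))

lemma continuous_ramp (k : Fin N) : Continuous (G.ramp k) := by
  unfold ramp
  fun_prop

lemma ramp_eq_zero {k : Fin N} {x : ℝ} (hx : x ≤ G.xp k) : G.ramp k x = 0 := by
  have h := G.xp_lt_next k
  exact max_eq_left ((min_le_right _ _).trans
    (div_nonpos_of_nonpos_of_nonneg (by linarith) (by linarith)))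

lemma ramp_eq_one {k : Fin N} {x : ℝ} (hx : G.next k ≤ x) : G.ramp k x = 1 := by
  have h := G.xp_lt_next k
  have : 1 ≤ (x - G.xp k) / (G.next k - G.xp k) := by
    rw [le_div_iff₀ (by linarith)]
    linarith
  rw [ramp, min_eq_left this]
  norm_num

lemma ramp_eventually_affine {k : Fin N} {x : ℝ} (h1 : x ≠ G.xp k) (h2 : x ≠ G.next k) :
    ∃ a b : ℝ, ∀ᶠ y in 𝓝 x, G.ramp k y = a + b * y := by
  rcases lt_or_gt_of_ne h1 with h | h
  · exact ⟨0, 0, by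
      filter_upwards [Iio_mem_nhds h] with y hy
      rw [G.ramp_eq_zero (le_of_lt hy)]
      simp⟩
  rcases lt_or_gt_of_ne h2 with h' | h'
  · have hd : 0 < G.next k - G.xp k := by linarith
    refine ⟨-G.xp k / (G.next k - G.xp k), 1 / (G.next k - G.xp k), ?_⟩
    filter_upwards [Ioo_mem_nhds h h'] with y hy
    have e1 : (y - G.xp k) / (G.next k - G.xp k) ≤ 1 := by
      rw [div_le_one hd]
      linarith [hy.2]
    have e2 : 0 ≤ (y - G.xp k) / (G.next k - G.xp k) := div_nonneg (by linarith [hy.1]) hd.le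
    rw [ramp, min_eq_right e1, max_eq_right e2]
    ring
  · exact ⟨1, 0, by
      filter_upwards [Ioi_mem_nhds h'] with y hy
      rw [G.ramp_eq_one (le_of_lt hy)]
      simp⟩

/-- The potential of the `j`-th resonator over one period, which starts at the first resonator. -/
def cellPotential (α : ℝ) (j : Fin N) (x : ℝ) : ℂ :=
  (if h : j.val = 0 then 1 else (G.ramp ⟨j - 1, by omega⟩ x : ℂ)) - G.ramp j x +
    if j.val = 0 then Complex.exp (Complex.I * α * G.L) *
      G.ramp ⟨N - 1, by have := j.pos; omega⟩ x else 0

lemma continuous_cellPotential (α : ℝ) (j : Fin N) : Continuous (G.cellPotential α j) := by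
  have := G.continuous_ramp
  unfold cellPotential
  split_ifs <;> fun_prop

lemma cellPotential_resonator (α : ℝ) (j i : Fin N) {x : ℝ} (hx : x ∈ Icc (G.xm i) (G.xp i)) :
    G.cellPotential α j x = if i = j then 1 else 0 := by
  have h0 : ∀ k : Fin N, i ≤ k → G.ramp k x = 0 := fun k hk =>
    G.ramp_eq_zero (hx.2.trans (G.xp_mono hk))
  have h1 : ∀ k : Fin N, k < i → G.ramp k x = 1 := fun k hk =>
    G.ramp_eq_one ((G.next_le_xm hk).trans hx.1)
  have hr : ∀ k : Fin N, G.ramp k x = if k < i then 1 else 0 := fun k => by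
    split_ifs with h
    · exact h1 k h
    · exact h0 k (not_lt.1 h)
  unfold cellPotential
  have hlast : ¬ (⟨N - 1, by have := j.pos; omega⟩ : Fin N) < i := by
    rw [Fin.lt_def]
    have := i.isLt
    simp
    omega
  simp only [hr, hlast, if_false, Fin.lt_def, Fin.ext_iff]
  split_ifs <;> first | omega | simp

lemma cellPotential_end (α : ℝ) (j k : Fin N) (hk : k.val = 0) :
    G.cellPotential α j (G.xm k + G.L) =
      Complex.exp (Complex.I * α * G.L) * G.cellPotential α j (G.xm k) := by
  have h1 : ∀ l : Fin N, G.ramp l (G.xm k + G.L) = 1 := fun l => G.ramp_eq_one (G.next_le l k hk)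
  have h2 := G.cellPotential_resonator α j k (left_mem_Icc.2 (G.xm_lt_xp k).le)
  rw [h2]
  unfold cellPotential
  simp only [h1, Fin.ext_iff, hk]
  split_ifs <;> first | omega | simp

lemma cellPotential_eventually_affine (α : ℝ) (j : Fin N) {x : ℝ} (h1 : ∀ k, x ≠ G.xp k)
    (h2 : ∀ k, x ≠ G.next k) :
    ∃ a b : ℂ, ∀ᶠ y : ℝ in 𝓝 x, G.cellPotential α j y = a + b * y := by
  choose a b hab using fun k => G.ramp_eventually_affine (h1 k) (h2 k)
  unfold cellPotential
  by_cases h : j.val = 0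
  · simp only [h, dif_pos, if_pos]
    set l : Fin N := ⟨N - 1, by have := j.pos; omega⟩
    refine ⟨1 - a j + Complex.exp (Complex.I * α * G.L) * a l,
      -b j + Complex.exp (Complex.I * α * G.L) * b l, ?_⟩
    filter_upwards [hab j, hab l] with y hy hy'
    rw [hy, hy']
    push_cast
    ring
  · simp only [h, dif_neg, if_neg, not_false_eq_true]
    set l : Fin N := ⟨j - 1, by omega⟩
    refine ⟨a l - a j, b l - b j, ?_⟩
    filter_upwards [hab j, hab l] with y hy hy'
    rw [hy, hy']
    push_cast
    ring

lemma exists_isPotential (α : ℝ) (j : Fin N) : ∃ V, G.IsPotential α j V := by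
  set k₀ : Fin N := ⟨0, j.pos⟩ with hk₀
  set a := G.xm k₀ with ha
  have hL := G.L_pos
  have : Fact (0 < G.L) := ⟨hL⟩
  set f : ℝ → ℂ := fun x => Complex.exp (-(Complex.I * α * x)) * G.cellPotential α j x with hf
  have hfc : Continuous f := by
    have := G.continuous_cellPotential α j
    fun_prop
  have hfa : f a = f (a + G.L) := by
    simp only [hf]
    rw [ha, G.cellPotential_end α j k₀ rfl, ← mul_assoc, ← Complex.exp_add]
    congr 2
    push_cast
    ring
  set V : ℝ → ℂ := fun x => Complex.exp (Complex.I * α * x) * AddCircle.liftIco G.L a f x with hV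
  have hper : ∀ (m : ℤ) (x : ℝ), ((x + m * G.L : ℝ) : AddCircle G.L) = x := by
    intro m x
    rw [AddCircle.coe_add, show (m : ℝ) * G.L = m • G.L by simp, AddCircle.coe_zsmul,
      AddCircle.coe_period]
    simp
  have hquasi : ∀ (m : ℤ) (x : ℝ),
      V (x + m * G.L) = Complex.exp (Complex.I * α * m * G.L) * V x := by
    intro m x
    simp only [hV]
    rw [hper, ← mul_assoc, ← Complex.exp_add]
    congr 2
    push_cast
    ring
  have hcell : ∀ x ∈ Ico a (a + G.L), V x = G.cellPotential α j x := by
    intro x hx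
    simp only [hV]
    rw [AddCircle.liftIco_coe_apply hx, hf, ← mul_assoc, ← Complex.exp_add]
    simp
  have haff : ∀ x ∈ G.background, ∃ c d : ℂ, ∀ᶠ y : ℝ in 𝓝 x, V y = c + d * y := by
    intro x hx
    obtain ⟨m, hm, -⟩ := existsUnique_sub_zsmul_mem_Ico hL x a
    simp only [zsmul_eq_mul] at hm
    have hx0 : x - m * G.L ∈ G.background := by
      have := G.background_translate hx (-m)
      push_cast at this
      convert this using 1
      ring
    have hb := G.mem_background.1 hx0
    have hne : ∀ k, x - m * G.L ≠ G.xm k ∧ x - m * G.L ≠ G.xp k := by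
      intro k
      have := hb 0 k
      have := G.xm_lt_xp k
      simp only [Int.cast_zero, zero_mul, add_zero] at *
      constructor <;> intro h <;> rcases hb 0 k with h' | h' <;> simp at h' <;> linarith
    have hnext : ∀ k, x - m * G.L ≠ G.next k := by
      intro k
      unfold next
      split_ifs
      · exact (hne _).1
      · exact ne_of_lt hm.2
    obtain ⟨c, d, hcd⟩ := G.cellPotential_eventually_affine α j (fun k => (hne k).2) hnext
    have hIoo : Ioo a (a + G.L) ∈ 𝓝 (x - m * G.L) :=
      Ioo_mem_nhds (lt_of_le_of_ne hm.1 (Ne.symm (hne k₀).1)) hm.2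
    have hcont : Tendsto (fun y : ℝ => y - m * G.L) (𝓝 x) (𝓝 (x - m * G.L)) :=
      (continuous_id.sub continuous_const).tendsto x
    set E := Complex.exp (Complex.I * α * m * G.L)
    refine ⟨E * (c - d * m * G.L), E * d, ?_⟩
    filter_upwards [hcont.eventually hcd, hcont.eventually hIoo] with y hy hy'
    have e := hquasi m (y - m * G.L)
    rw [sub_add_cancel, hcell _ ⟨hy'.1.le, hy'.2⟩, hy] at e
    rw [e]
    push_cast
    ring
  refine ⟨V, ⟨?_, ?_, ?_, ?_, hquasi⟩⟩
  · have h1 : Continuous (AddCircle.liftIco G.L a f) :=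
      AddCircle.liftIco_continuous hfa hfc.continuousOn
    have h2 : Continuous fun x : ℝ => (x : AddCircle G.L) := AddCircle.continuous_mk' G.L
    exact Continuous.mul (by fun_prop) (h1.comp h2)
  · intro i x hx
    rw [hcell x ⟨(G.xm_mono (Fin.le_def.2 (Nat.zero_le _))).trans hx.1.le, by
      linarith [hx.2, G.xp_lt_L i, G.xm_pos k₀]⟩]
    exact G.cellPotential_resonator α j i (Ioo_subset_Icc_self hx)
  · intro x hx
    obtain ⟨c, d, hcd⟩ := haff x hx
    have h1 : ContDiffAt ℝ 2 (fun y : ℝ => c + d * (y : ℂ)) x :=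
      (contDiff_const.add (contDiff_const.mul Complex.ofRealCLM.contDiff)).contDiffAt
    exact (h1.congr_of_eventuallyEq hcd).contDiffWithinAt
  · intro x hx
    obtain ⟨c, d, hcd⟩ := haff x hx
    have h1 : deriv V =ᶠ[𝓝 x] fun _ => d := by
      have h2 : deriv V =ᶠ[𝓝 x] deriv fun y : ℝ => c + d * (y : ℂ) := EventuallyEq.deriv hcd
      refine h2.trans (Eventually.of_forall fun y => ?_)
      have h3 : HasDerivAt (fun y : ℝ => c + d * (y : ℂ)) d y := by
        simpa using ((Complex.ofRealCLM.hasDerivAt (x := y)).const_mul d).const_add c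
      exact h3.deriv
    rw [h1.deriv_eq]
    simp

variable {G}

/-- In a gap a potential is affine. -/
lemma IsPotential.deriv_eq_slope {α : ℝ} {j : Fin N} {V : ℝ → ℂ} (hV : G.IsPotential α j V)
    {p q : ℝ} (hpq : p < q) (hsub : Ioo p q ⊆ G.background) :
    ∀ x ∈ Ioo p q, deriv V x = (V q - V p) / (q - p) := by
  have hC : ContDiffOn ℝ 2 V (Ioo p q) := hV.contDiffOn.mono hsub
  have hd1 : DifferentiableOn ℝ V (Ioo p q) := hC.differentiableOn (by norm_num)
  have hd2 : DifferentiableOn ℝ (deriv V) (Ioo p q) :=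
    ((contDiffOn_succ_iff_deriv_of_isOpen (n := 1) isOpen_Ioo).1 hC).2.2.differentiableOn
      (by norm_num)
  have hconst : ∀ x ∈ Ioo p q, ∀ y ∈ Ioo p q, deriv V x = deriv V y := fun x hx y hy =>
    isOpen_Ioo.is_const_of_deriv_eq_zero isPreconnected_Ioo hd2
      (fun z hz => by simpa using hV.harmonic z (hsub hz)) hx hy
  intro x hx
  have h1 : ∫ y in p..q, deriv V x = V q - V p :=
    intervalIntegral.integral_eq_sub_of_hasDerivAt_of_le hpq.le hV.continuous.continuousOn
      (fun y hy => by
        rw [hconst x hx y hy]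
        exact (hd1.differentiableAt (Ioo_mem_nhds hy.1 hy.2)).hasDerivAt)
      (by simp)
  rw [intervalIntegral.integral_const, Complex.real_smul, Complex.ofReal_sub] at h1
  have : (q : ℂ) - p ≠ 0 := by
    rw [← Complex.ofReal_sub]
    exact_mod_cast (sub_pos.2 hpq).ne'
  rw [← h1]
  field_simp

lemma IsPotential.eq_on_closure {α : ℝ} {j : Fin N} {V : ℝ → ℂ} (hV : G.IsPotential α j V)
    (i : Fin N) {x : ℝ} (hx : x ∈ Icc (G.xm i) (G.xp i)) : V x = if i = j then 1 else 0 := by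
  have h1 : EqOn V (fun _ => if i = j then 1 else 0) (Ioo (G.xm i) (G.xp i)) :=
    fun y hy => hV.on_resonator i y hy
  have h2 := h1.closure hV.continuous continuous_const
  rw [closure_Ioo (G.xm_lt_xp i).ne] at h2
  exact h2 hx

/-- The entries of the capacitance matrix in terms of the two gaps adjacent to a resonator. -/
lemma capacitance_apply (α : ℝ) {i kl kr : Fin N} {ml mr : ℤ}
    (hl : G.xp kl + ml * G.L < G.xm i)
    (hl' : Ioo (G.xp kl + ml * G.L) (G.xm i) ⊆ G.background)
    (hr : G.xp i < G.xm kr + mr * G.L)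
    (hr' : Ioo (G.xp i) (G.xm kr + mr * G.L) ⊆ G.background) (j : Fin N) :
    G.capacitance α i j =
      ((if i = j then 1 else 0) - Complex.exp (Complex.I * α * ml * G.L) *
        (if kl = j then 1 else 0)) / (G.xm i - (G.xp kl + ml * G.L) : ℝ) -
      (Complex.exp (Complex.I * α * mr * G.L) * (if kr = j then 1 else 0) -
        (if i = j then 1 else 0)) / (G.xm kr + mr * G.L - G.xp i : ℝ) := by
  have hV : G.IsPotential α j (G.potential α j) := Classical.epsilon_spec (G.exists_isPotential α j)
  set V := G.potential α j
  have e1 : Function.leftLim (deriv V) (G.xm i) =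
      (V (G.xm i) - V (G.xp kl + ml * G.L)) / (G.xm i - (G.xp kl + ml * G.L : ℝ)) := by
    refine leftLim_eq_of_tendsto ?_
    refine tendsto_const_nhds.congr' ?_
    filter_upwards [Ioo_mem_nhdsLT hl] with x hx
    rw [hV.deriv_eq_slope hl hl' x hx]
  have e2 : Function.rightLim (deriv V) (G.xp i) =
      (V (G.xm kr + mr * G.L) - V (G.xp i)) / ((G.xm kr + mr * G.L : ℝ) - G.xp i) := by
    refine rightLim_eq_of_tendsto ?_
    refine tendsto_const_nhds.congr' ?_
    filter_upwards [Ioo_mem_nhdsGT hr] with x hx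
    rw [hV.deriv_eq_slope hr hr' x hx]
  rw [capacitance, Matrix.of_apply, boundaryFlux, e1, e2, hV.quasiperiodic, hV.quasiperiodic,
    hV.eq_on_closure i (left_mem_Icc.2 (G.xm_lt_xp i).le),
    hV.eq_on_closure i (right_mem_Icc.2 (G.xm_lt_xp i).le),
    hV.eq_on_closure kl (right_mem_Icc.2 (G.xm_lt_xp kl).le),
    hV.eq_on_closure kr (left_mem_Icc.2 (G.xm_lt_xp kr).le)]
  push_cast
  rfl

end Geometry

/-! ### Floquet coefficients and the system satisfied by the harmonics of a Bloch wave -/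

namespace Medium

variable {N : ℕ} (P : Medium N)

/-- The frequency `ω + n Ω` of the `n`-th harmonic. -/
def freq (ω : ℂ) (n : ℤ) : ℂ := ω + n * P.Ω

/-- The coefficient of `e^{i(ω + nΩ)t}` in a function `f` of time for which `f e^{-iωt}` is
periodic. -/
def coeff (ω : ℂ) (f : ℝ → ℂ) (n : ℤ) : ℂ :=
  (1 / P.T : ℂ) * ∫ t in (0 : ℝ)..P.T, f t * Complex.exp (-Complex.I * (ω + n * P.Ω) * t)

lemma T_pos : 0 < P.T := two_pi_div_pos P.Ω_pos

lemma exp_freq_period (ω : ℂ) (n : ℤ) :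
    Complex.exp (Complex.I * ω * P.T) * Complex.exp (-Complex.I * (ω + n * P.Ω) * P.T) = 1 := by
  rw [← Complex.exp_add, Complex.exp_eq_one_iff]
  refine ⟨-n, ?_⟩
  have : (P.Ω : ℂ) ≠ 0 := by exact_mod_cast P.Ω_pos.ne'
  unfold T
  push_cast
  field_simp
  ring

lemma coeff_deriv {ω : ℂ} {f f' : ℝ → ℂ} (hf : ∀ t, HasDerivAt f (f' t) t) (hf' : Continuous f')
    (hper : f P.T = Complex.exp (Complex.I * ω * P.T) * f 0) (n : ℤ) :
    P.coeff ω f' n = Complex.I * P.freq ω n * P.coeff ω f n := by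
  set c : ℂ := -Complex.I * (ω + n * P.Ω) with hc
  have hexp : ∀ t : ℝ, HasDerivAt (fun t : ℝ => Complex.exp (c * t)) (c * Complex.exp (c * t)) t := by
    intro t
    have h1 : HasDerivAt (fun t : ℝ => c * (t : ℂ)) c t := by
      simpa using (Complex.ofRealCLM.hasDerivAt (x := t)).const_mul c
    simpa [mul_comm] using h1.cexp
  have hfc : Continuous f := continuous_iff_continuousAt.2 fun t => (hf t).continuousAt
  have h := intervalIntegral.integral_mul_deriv_eq_deriv_mul (a := 0) (b := P.T)
    (u := fun t : ℝ => Complex.exp (c * t)) (u' := fun t : ℝ => c * Complex.exp (c * t))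
    (v := f) (v' := f') (fun t _ => hexp t) (fun t _ => hf t)
    (Continuous.intervalIntegrable (by fun_prop) _ _) (hf'.intervalIntegrable _ _)
  have hb : Complex.exp (c * P.T) * f P.T - Complex.exp (c * (0 : ℝ)) * f 0 = 0 := by
    rw [hper, ← mul_assoc, mul_comm (Complex.exp (c * P.T)), hc, P.exp_freq_period]
    simp
  rw [hb, zero_sub] at h
  unfold coeff
  simp_rw [← hc]
  have e1 : ∫ t in (0 : ℝ)..P.T, f' t * Complex.exp (c * t) =
      ∫ t in (0 : ℝ)..P.T, Complex.exp (c * t) * f' t := by simp_rw [mul_comm]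
  have e2 : ∫ t in (0 : ℝ)..P.T, c * Complex.exp (c * t) * f t =
      c * ∫ t in (0 : ℝ)..P.T, f t * Complex.exp (c * t) := by
    rw [← intervalIntegral.integral_const_mul]
    congr 1
    funext t
    ring
  rw [e1, h, e2, hc]
  unfold freq
  ring

lemma coeff_mul {ω : ℂ} {f g : ℝ → ℂ} (hf : Continuous f) {h : ℤ → ℂ}
    (hg : ∀ t, g t = trigSum P.Ω (band P.M) h t) (n : ℤ) :
    P.coeff ω (fun t => g t * f t) n = conv P.M h (P.coeff ω f) n := by
  unfold coeff conv
  have : ∀ t : ℝ, g t * f t * Complex.exp (-Complex.I * (ω + n * P.Ω) * t) =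
      ∑ m ∈ band P.M, h m * (f t * Complex.exp (-Complex.I * (ω + (n - m : ℤ) * P.Ω) * t)) := by
    intro t
    rw [hg, trigSum, Finset.sum_mul, Finset.sum_mul]
    refine Finset.sum_congr rfl fun m _ => ?_
    have : Complex.exp (-Complex.I * (ω + (n - m : ℤ) * P.Ω) * t) =
        Complex.exp (Complex.I * m * P.Ω * t) *
          Complex.exp (-Complex.I * (ω + n * P.Ω) * t) := by
      rw [← Complex.exp_add]
      push_cast
      ring_nf
    rw [this]
    ring
  simp_rw [this]
  rw [intervalIntegral.integral_finsetSum
    (fun m _ => Continuous.intervalIntegrable (by fun_prop) _ _), Finset.mul_sum]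
  refine Finset.sum_congr rfl fun m _ => ?_
  rw [intervalIntegral.integral_const_mul]
  ring

lemma coeff_const_mul (ω : ℂ) (c : ℂ) (f : ℝ → ℂ) (n : ℤ) :
    P.coeff ω (fun t => c * f t) n = c * P.coeff ω f n := by
  unfold coeff
  simp_rw [mul_assoc c]
  rw [intervalIntegral.integral_const_mul]
  ring

lemma continuous_coeff (ω : ℂ) {F : ℝ × ℝ → ℂ} (hF : Continuous F) (n : ℤ) :
    Continuous fun x => P.coeff ω (fun t => F (x, t)) n := by
  unfold coeff
  refine continuous_const.mul ?_
  exact intervalIntegral.continuous_parametric_intervalIntegral_of_continuous'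
    (f := fun x t => F (x, t) * Complex.exp (-Complex.I * (ω + n * P.Ω) * t)) (by
      unfold Function.uncurry
      fun_prop) _ _

lemma hasDerivAt_coeff (ω : ℂ) {F F' : ℝ × ℝ → ℂ} (hF : Continuous F) (hF' : Continuous F')
    (h : ∀ x t, HasDerivAt (fun x => F (x, t)) (F' (x, t)) x) (n : ℤ) (x : ℝ) :
    HasDerivAt (fun x => P.coeff ω (fun t => F (x, t)) n)
      (P.coeff ω (fun t => F' (x, t)) n) x := by
  unfold coeff
  refine HasDerivAt.const_mul _ ?_
  set e : ℝ → ℂ := fun t => Complex.exp (-Complex.I * (ω + n * P.Ω) * t) with he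
  have hec : Continuous e := by fun_prop
  have hcont : Continuous fun p : ℝ × ℝ => F' p * e p.2 := by fun_prop
  obtain ⟨C, hC⟩ := ((isCompact_Icc (a := x - 1) (b := x + 1)).prod
    (isCompact_Icc (a := (0 : ℝ)) (b := P.T))).exists_bound_of_continuousOn hcont.continuousOn
  refine (intervalIntegral.hasDerivAt_integral_of_dominated_loc_of_deriv_le
    (F := fun x t => F (x, t) * e t) (F' := fun x t => F' (x, t) * e t) (bound := fun _ => C)
    (Icc_mem_nhds (show x - 1 < x by linarith) (show x < x + 1 by linarith))
    ?_ ?_ ?_ ?_ (by simp) ?_).2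
  · exact Eventually.of_forall fun y => Continuous.aestronglyMeasurable (by fun_prop)
  · exact Continuous.intervalIntegrable (by fun_prop) _ _
  · exact Continuous.aestronglyMeasurable (by fun_prop)
  · refine Eventually.of_forall fun t ht y hy => ?_
    rw [uIoc_of_le P.T_pos.le] at ht
    exact hC (y, t) ⟨hy, Ioc_subset_Icc_self ht⟩
  · exact Eventually.of_forall fun t _ y _ => (h y t).mul_const _

lemma hasSymbol_κ (i : Fin N) (t : ℝ) :
    trigSum P.Ω (band P.M) (P.kHat i) t = 1 / (P.κ i t : ℂ) := (P.inv_κ i t).symm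

lemma hasSymbol_s (i : Fin N) (t : ℝ) :
    trigSum P.Ω (band P.M) (P.sHat i) t = 1 / (P.s i t : ℂ) := (P.inv_s i t).symm

end Medium

section Partials

variable {g : ℝ × ℝ → ℂ}

/-- The partial derivative in the first variable. -/
def partialX (g : ℝ × ℝ → ℂ) (p : ℝ × ℝ) : ℂ := fderiv ℝ g p (1, 0)

/-- The partial derivative in the second variable. -/
def partialT (g : ℝ × ℝ → ℂ) (p : ℝ × ℝ) : ℂ := fderiv ℝ g p (0, 1)

lemma contDiff_partialX {n : WithTop ℕ∞} (hg : ContDiff ℝ (n + 1) g) :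
    ContDiff ℝ n (partialX g) := (hg.fderiv_right le_rfl).clm_apply contDiff_const

lemma contDiff_partialT {n : WithTop ℕ∞} (hg : ContDiff ℝ (n + 1) g) :
    ContDiff ℝ n (partialT g) := (hg.fderiv_right le_rfl).clm_apply contDiff_const

lemma hasDerivAt_partialX (hg : ContDiff ℝ 1 g) (x t : ℝ) :
    HasDerivAt (fun x => g (x, t)) (partialX g (x, t)) x := by
  have h1 : HasFDerivAt g (fderiv ℝ g (x, t)) (x, t) :=
    (hg.differentiable (by norm_num) (x, t)).hasFDerivAt
  exact h1.comp_hasDerivAt x ((hasDerivAt_id x).prodMk (hasDerivAt_const x t))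

lemma hasDerivAt_partialT (hg : ContDiff ℝ 1 g) (x t : ℝ) :
    HasDerivAt (fun t => g (x, t)) (partialT g (x, t)) t := by
  have h1 : HasFDerivAt g (fderiv ℝ g (x, t)) (x, t) :=
    (hg.differentiable (by norm_num) (x, t)).hasFDerivAt
  exact h1.comp_hasDerivAt t ((hasDerivAt_const t x).prodMk (hasDerivAt_id t))

end Partials

/-- The harmonics `v i n` of a Bloch wave in the resonators, with their derivatives `dv`, `ddv`.
The harmonics in the gaps enter only through the ordinary differential equations which they
satisfy and through their boundary values, which the transmission conditions express in terms of
the values of `v` and `dv` at the ends of the resonators. -/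
structure IsModeSystem {N : ℕ} (P : Medium N) (G : Geometry N) (α : ℝ) (ω : ℂ)
    (v dv ddv : Fin N → ℤ → ℝ → ℂ) : Prop where
  hasDerivAt : ∀ i n x, HasDerivAt (v i n) (dv i n x) x
  hasDerivAt_dv : ∀ i n x, HasDerivAt (dv i n) (ddv i n x) x
  continuous : ∀ i n, Continuous (ddv i n)
  resonator : ∀ i n, ∀ x ∈ Icc (G.xm i) (G.xp i), (P.vr : ℂ) ^ 2 * ddv i n x =
    -(P.freq ω n * conv P.M (P.kHat i) (fun m => P.freq ω m * v i m x) n)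
  left_gap : ∀ (i k : Fin N) (m : ℤ), G.xp k + m * G.L < G.xm i →
    Ioo (G.xp k + m * G.L) (G.xm i) ⊆ G.background → ∀ n, ∃ y y' y'' : ℝ → ℂ,
      (∀ x, HasDerivAt y (y' x) x) ∧ (∀ x, HasDerivAt y' (y'' x) x) ∧
      (∀ x ∈ Icc (G.xp k + m * G.L) (G.xm i), y'' x = -(P.freq ω n / P.v₀) ^ 2 * y x) ∧
      y (G.xp k + m * G.L) = Complex.exp (Complex.I * α * m * G.L) *
        conv P.M (P.sHat k) (fun l => v k l (G.xp k)) n ∧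
      y (G.xm i) = conv P.M (P.sHat i) (fun l => v i l (G.xm i)) n ∧
      P.δ * y' (G.xm i) = conv P.M (P.sHat i) (fun l => dv i l (G.xm i)) n
  right_gap : ∀ (i k : Fin N) (m : ℤ), G.xp i < G.xm k + m * G.L →
    Ioo (G.xp i) (G.xm k + m * G.L) ⊆ G.background → ∀ n, ∃ y y' y'' : ℝ → ℂ,
      (∀ x, HasDerivAt y (y' x) x) ∧ (∀ x, HasDerivAt y' (y'' x) x) ∧
      (∀ x ∈ Icc (G.xp i) (G.xm k + m * G.L), y'' x = -(P.freq ω n / P.v₀) ^ 2 * y x) ∧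
      y (G.xm k + m * G.L) = Complex.exp (Complex.I * α * m * G.L) *
        conv P.M (P.sHat k) (fun l => v k l (G.xm k)) n ∧
      y (G.xp i) = conv P.M (P.sHat i) (fun l => v i l (G.xp i)) n ∧
      P.δ * y' (G.xp i) = conv P.M (P.sHat i) (fun l => dv i l (G.xp i)) n

section Bloch

variable {N : ℕ} {P : Medium N} {G : Geometry N} {α : ℝ} {ω : ℂ} {u : ℝ → ℝ → ℂ}

namespace Medium.IsBlochWave

lemma quasiperiodic_int (hu : P.IsBlochWave G α ω u) (m : ℤ) (x t : ℝ) :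
    u (x + m * G.L) t = Complex.exp (Complex.I * α * m * G.L) * u x t := by
  induction m using Int.induction_on with
  | zero => simp
  | succ k ih =>
    have e : x + ((k : ℤ) + 1 : ℤ) * G.L = (x + (k : ℤ) * G.L) + G.L := by push_cast; ring
    rw [e, hu.quasiperiodic, ih, ← mul_assoc, ← Complex.exp_add]
    congr 2
    push_cast
    ring
  | pred k ih =>
    have h := hu.quasiperiodic (x + (-(k : ℤ) - 1 : ℤ) * G.L) t
    have e : x + (-(k : ℤ) - 1 : ℤ) * G.L + G.L = x + (-(k : ℤ) : ℤ) * G.L := by push_cast; ring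
    rw [e, ih] at h
    have e2 : Complex.exp (Complex.I * α * (-(k : ℤ) : ℤ) * G.L) =
        Complex.exp (Complex.I * α * G.L) *
          Complex.exp (Complex.I * α * (-(k : ℤ) - 1 : ℤ) * G.L) := by
      rw [← Complex.exp_add]
      congr 1
      push_cast
      ring
    rw [e2, mul_assoc] at h
    exact (mul_left_cancel₀ (Complex.exp_ne_zero _) h).symm

variable {a b : ℝ} {g : ℝ × ℝ → ℂ}

lemma floquet_of_eq (hu : P.IsBlochWave G α ω u) (hug : ∀ x ∈ Ioo a b, ∀ t, u x t = g (x, t))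
    {x : ℝ} (hx : x ∈ Ioo a b) (t : ℝ) :
    g (x, t + P.T) = Complex.exp (Complex.I * ω * P.T) * g (x, t) := by
  rw [← hug x hx, ← hug x hx, hu.floquet]

lemma floquet_partialT (hu : P.IsBlochWave G α ω u) (hg : ContDiff ℝ 1 g)
    (hug : ∀ x ∈ Ioo a b, ∀ t, u x t = g (x, t)) {x : ℝ} (hx : x ∈ Ioo a b) (t : ℝ) :
    partialT g (x, t + P.T) = Complex.exp (Complex.I * ω * P.T) * partialT g (x, t) := by
  have h1 : HasDerivAt (fun t => g (x, t + P.T)) (partialT g (x, t + P.T)) t :=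
    (hasDerivAt_partialT hg x (t + P.T)).comp_add_const t P.T
  have h2 := (hasDerivAt_partialT hg x t).const_mul (Complex.exp (Complex.I * ω * P.T))
  have e : (fun t => g (x, t + P.T)) = fun t => Complex.exp (Complex.I * ω * P.T) * g (x, t) :=
    funext fun t => hu.floquet_of_eq hug hx t
  rw [e] at h1
  exact h1.unique h2

lemma coeff_partialT (hu : P.IsBlochWave G α ω u) (hg : ContDiff ℝ 1 g)
    (hug : ∀ x ∈ Ioo a b, ∀ t, u x t = g (x, t)) {x : ℝ} (hx : x ∈ Ioo a b) (n : ℤ) :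
    P.coeff ω (fun t => partialT g (x, t)) n =
      Complex.I * P.freq ω n * P.coeff ω (fun t => g (x, t)) n := by
  have hc : Continuous (partialT g) := (contDiff_partialT (n := 0) hg).continuous
  refine P.coeff_deriv (fun t => hasDerivAt_partialT hg x t) (by fun_prop) ?_ n
  have := hu.floquet_of_eq hug hx 0
  rwa [zero_add] at this

lemma deriv_deriv_eq (hg : ContDiff ℝ 2 g) (hug : ∀ x ∈ Ioo a b, ∀ t, u x t = g (x, t))
    {x : ℝ} (hx : x ∈ Ioo a b) (t : ℝ) :
    deriv (deriv fun y => u y t) x = partialX (partialX g) (x, t) := by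
  have h1 : (deriv fun y => u y t) =ᶠ[𝓝 x] fun y => partialX g (y, t) := by
    filter_upwards [Ioo_mem_nhds hx.1 hx.2] with y hy
    have h2 : (fun z => u z t) =ᶠ[𝓝 y] fun z => g (z, t) := by
      filter_upwards [Ioo_mem_nhds hy.1 hy.2] with z hz using hug z hz t
    rw [h2.deriv_eq]
    exact (hasDerivAt_partialX (hg.of_le (by norm_num)) y t).deriv
  rw [h1.deriv_eq]
  exact (hasDerivAt_partialX (contDiff_partialX (n := 1) hg) x t).deriv

lemma deriv_eq (hg : ContDiff ℝ 2 g) (hug : ∀ x ∈ Ioo a b, ∀ t, u x t = g (x, t))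
    {x : ℝ} (hx : x ∈ Ioo a b) (t : ℝ) : deriv (fun y => u y t) x = partialX g (x, t) := by
  have h2 : (fun z => u z t) =ᶠ[𝓝 x] fun z => g (z, t) := by
    filter_upwards [Ioo_mem_nhds hx.1 hx.2] with z hz using hug z hz t
  rw [h2.deriv_eq]
  exact (hasDerivAt_partialX (hg.of_le (by norm_num)) x t).deriv

/-- The time-harmonic wave equation in a gap. -/
lemma coeff_background (hu : P.IsBlochWave G α ω u) (hg : ContDiff ℝ 2 g) (hab : a < b)
    (hsub : Ioo a b ⊆ G.background) (hug : ∀ x ∈ Ioo a b, ∀ t, u x t = g (x, t)) (n : ℤ) :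
    ∀ x ∈ Icc a b, P.coeff ω (fun t => partialX (partialX g) (x, t)) n =
      -(P.freq ω n / P.v₀) ^ 2 * P.coeff ω (fun t => g (x, t)) n := by
  have hg1 : ContDiff ℝ 1 g := hg.of_le (by norm_num)
  have hxx : Continuous (partialX (partialX g)) :=
    (contDiff_partialX (n := 0) (contDiff_partialX (n := 1) hg)).continuous
  have hv0 : (P.v₀ : ℂ) ≠ 0 := by
    have : 0 < P.v₀ := Real.sqrt_pos.2 (div_pos P.κ₀_pos P.ρ₀_pos)
    exact_mod_cast this.ne'
  have hint : EqOn (fun x => P.coeff ω (fun t => partialX (partialX g) (x, t)) n)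
      (fun x => -(P.freq ω n / P.v₀) ^ 2 * P.coeff ω (fun t => g (x, t)) n) (Ioo a b) := by
    intro x hx
    have hT1 : ContDiff ℝ 1 (partialT g) := contDiff_partialT (n := 1) hg
    have hT2 : Continuous (partialT (partialT g)) := (contDiff_partialT (n := 0) hT1).continuous
    have e1 : (fun t => partialT (partialT g) (x, t)) =
        fun t => (P.v₀ : ℂ) ^ 2 * partialX (partialX g) (x, t) := by
      funext t
      have h1 := hu.wave_background x (hsub hx) t
      rw [deriv_deriv_eq hg hug hx t] at h1
      have h2 : (fun τ => u x τ) = fun τ => g (x, τ) := funext fun τ => hug x hx τ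
      have h3 : deriv (fun τ => u x τ) = fun τ => partialT g (x, τ) := by
        rw [h2]
        exact funext fun τ => (hasDerivAt_partialT hg1 x τ).deriv
      rw [h3, (hasDerivAt_partialT hT1 x t).deriv] at h1
      exact sub_eq_zero.1 h1
    have e2 : P.coeff ω (fun t => partialT (partialT g) (x, t)) n =
        Complex.I * P.freq ω n * P.coeff ω (fun t => partialT g (x, t)) n := by
      refine P.coeff_deriv (fun t => hasDerivAt_partialT hT1 x t) (by fun_prop) ?_ n
      have := hu.floquet_partialT hg1 hug hx 0
      rwa [zero_add] at this
    rw [e1, P.coeff_const_mul, hu.coeff_partialT hg1 hug hx n] at e2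
    have e3 : P.coeff ω (fun t => partialX (partialX g) (x, t)) n =
        Complex.I * P.freq ω n * (Complex.I * P.freq ω n * P.coeff ω (fun t => g (x, t)) n) /
          (P.v₀ : ℂ) ^ 2 := by
      rw [← e2]
      field_simp
    simp only
    rw [e3]
    field_simp
    ring_nf
    simp
  have := hint.closure (P.continuous_coeff ω hxx n)
    (continuous_const.mul (P.continuous_coeff ω hg.continuous n))
  rw [closure_Ioo hab.ne] at this
  exact fun x hx => this hx

/-- The coupled system satisfied by the harmonics in a resonator. -/
lemma coeff_resonator (hu : P.IsBlochWave G α ω u) (hg : ContDiff ℝ 2 g) (i : Fin N)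
    (hug : ∀ x ∈ Ioo (G.xm i) (G.xp i), ∀ t, u x t = g (x, t)) (n : ℤ) :
    ∀ x ∈ Icc (G.xm i) (G.xp i),
      (P.vr : ℂ) ^ 2 * P.coeff ω (fun t => partialX (partialX g) (x, t)) n =
      -(P.freq ω n * conv P.M (P.kHat i)
        (fun m => P.freq ω m * P.coeff ω (fun t => g (x, t)) m) n) := by
  have hg1 : ContDiff ℝ 1 g := hg.of_le (by norm_num)
  have hxx : Continuous (partialX (partialX g)) :=
    (contDiff_partialX (n := 0) (contDiff_partialX (n := 1) hg)).continuous
  have hint : EqOn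
      (fun x => (P.vr : ℂ) ^ 2 * P.coeff ω (fun t => partialX (partialX g) (x, t)) n)
      (fun x => -(P.freq ω n * conv P.M (P.kHat i)
        (fun m => P.freq ω m * P.coeff ω (fun t => g (x, t)) m) n))
      (Ioo (G.xm i) (G.xp i)) := by
    intro x hx
    have hT1 : ContDiff ℝ 1 (partialT g) := contDiff_partialT (n := 1) hg
    have hTc := hT1.continuous
    have hT2 : Continuous (partialT (partialT g)) := (contDiff_partialT (n := 0) hT1).continuous
    set F : ℝ → ℂ := fun t => 1 / (P.κ i t : ℂ) * partialT g (x, t) with hF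
    have hκ : (fun t => 1 / (P.κ i t : ℂ)) = trigSum P.Ω (band P.M) (P.kHat i) :=
      funext fun t => (P.hasSymbol_κ i t).symm
    have hκd : ContDiff ℝ 1 (trigSum P.Ω (band P.M) (P.kHat i)) := by
      unfold trigSum
      have : ContDiff ℝ 1 fun t : ℝ => (t : ℂ) := Complex.ofRealCLM.contDiff
      fun_prop
    have hFd : ContDiff ℝ 1 F := by
      have h1 : F = fun t => trigSum P.Ω (band P.M) (P.kHat i) t * partialT g (x, t) := by
        rw [← hκ]
      rw [h1]
      exact hκd.mul (hT1.comp (contDiff_const.prodMk contDiff_id))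
    have e1 : deriv F = fun t => (P.vr : ℂ) ^ 2 * partialX (partialX g) (x, t) := by
      funext t
      have h1 := hu.wave_resonator i x hx t
      rw [deriv_deriv_eq hg hug hx t] at h1
      have h2 : (fun τ => u x τ) = fun τ => g (x, τ) := funext fun τ => hug x hx τ
      have h3 : (fun τ => 1 / (P.κ i τ : ℂ) * deriv (fun τ' => u x τ') τ) = F := by
        funext τ
        rw [h2, (hasDerivAt_partialT hg1 x τ).deriv]
      rw [h3] at h1
      exact sub_eq_zero.1 h1
    have e2 : P.coeff ω (deriv F) n = Complex.I * P.freq ω n * P.coeff ω F n := by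
      refine P.coeff_deriv (fun t => (hFd.differentiable (by norm_num) t).hasDerivAt)
        (hFd.continuous_deriv (by norm_num)) ?_ n
      have h1 := hu.floquet_partialT hg1 hug hx 0
      have h2 : 1 / (P.κ i P.T : ℂ) = 1 / (P.κ i 0 : ℂ) := by
        rw [← P.hasSymbol_κ, ← P.hasSymbol_κ]
        have := trigSum_periodic P.Ω_pos (band P.M) (P.kHat i) 0
        rwa [zero_add] at this
      rw [zero_add] at h1
      simp only [hF]
      rw [h1, h2]
      ring
    have e3 : P.coeff ω F n = conv P.M (P.kHat i)
        (fun m => Complex.I * (P.freq ω m * P.coeff ω (fun t => g (x, t)) m)) n := by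
      rw [P.coeff_mul (f := fun t => partialT g (x, t)) (by fun_prop)
        (fun t => (P.hasSymbol_κ i t).symm) n]
      congr 1
      funext m
      rw [hu.coeff_partialT hg1 hug hx m]
      ring
    have e4 : conv P.M (P.kHat i)
        (fun m => Complex.I * (P.freq ω m * P.coeff ω (fun t => g (x, t)) m)) n =
        Complex.I * conv P.M (P.kHat i)
        (fun m => P.freq ω m * P.coeff ω (fun t => g (x, t)) m) n := by
      unfold conv
      rw [Finset.mul_sum]
      exact Finset.sum_congr rfl fun m _ => by ring
    rw [e1, P.coeff_const_mul, e3, e4] at e2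
    simp only
    rw [e2]
    ring_nf
    simp
  have hcont : Continuous fun x => -(P.freq ω n * conv P.M (P.kHat i)
        (fun m => P.freq ω m * P.coeff ω (fun t => g (x, t)) m) n) := by
    have := fun m => P.continuous_coeff ω hg.continuous m
    unfold conv
    fun_prop
  have := hint.closure (continuous_const.mul (P.continuous_coeff ω hxx n)) hcont
  rw [closure_Ioo (G.xm_lt_xp i).ne] at this
  exact fun x hx => this hx

lemma tendsto_left (hg : Continuous g) (hab : a < b) {f : ℝ → ℂ} {t : ℝ}
    (hf : ∀ x ∈ Ioo a b, f x = g (x, t)) : Function.leftLim f b = g (b, t) := by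
  refine leftLim_eq_of_tendsto ?_
  have h1 : Tendsto (fun x => g (x, t)) (𝓝[<] b) (𝓝 (g (b, t))) :=
    ((by fun_prop : Continuous fun x => g (x, t)).tendsto b).mono_left nhdsWithin_le_nhds
  refine h1.congr' ?_
  filter_upwards [Ioo_mem_nhdsLT hab] with x hx using (hf x hx).symm

lemma tendsto_right (hg : Continuous g) (hab : a < b) {f : ℝ → ℂ} {t : ℝ}
    (hf : ∀ x ∈ Ioo a b, f x = g (x, t)) : Function.rightLim f a = g (a, t) := by
  refine rightLim_eq_of_tendsto ?_
  have h1 : Tendsto (fun x => g (x, t)) (𝓝[>] a) (𝓝 (g (a, t))) :=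
    ((by fun_prop : Continuous fun x => g (x, t)).tendsto a).mono_left nhdsWithin_le_nhds
  refine h1.congr' ?_
  filter_upwards [Ioo_mem_nhdsGT hab] with x hx using (hf x hx).symm

lemma translate_eq (hu : P.IsBlochWave G α ω u) (m : ℤ)
    (hug : ∀ x ∈ Ioo (a + m * G.L) (b + m * G.L), ∀ t, u x t = g (x, t)) :
    ∀ x ∈ Ioo a b, ∀ t, u x t =
      (fun p : ℝ × ℝ => Complex.exp (-(Complex.I * α * m * G.L)) * g (p.1 + m * G.L, p.2))
        (x, t) := by
  intro x hx t
  simp only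
  rw [← hug (x + m * G.L) ⟨by linarith [hx.1], by linarith [hx.2]⟩, hu.quasiperiodic_int,
    ← mul_assoc, ← Complex.exp_add]
  simp

/-- A Bloch wave has harmonics in the resonators which satisfy the mode system. -/
theorem exists_isModeSystem (hu : P.IsBlochWave G α ω u) :
    ∃ v dv ddv : Fin N → ℤ → ℝ → ℂ, IsModeSystem P G α ω v dv ddv ∧
      ∀ n, G.normD (P.harmonic ω u n) =
        √(∑ i, ∫ x in G.xm i..G.xp i, ‖v i n x‖ ^ 2) := by
  have hres : ∀ i, Ioo (G.xm i) (G.xp i) ⊆ G.resonators ∪ G.background := fun i x hx =>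
    Or.inl (mem_iUnion₂.2 ⟨0, i, by simpa using hx⟩)
  choose g hgC hug using fun i => hu.regular _ _ (hres i)
  have hg1 : ∀ i, ContDiff ℝ 1 (g i) := fun i => (hgC i).of_le (by norm_num)
  have hgX : ∀ i, ContDiff ℝ 1 (partialX (g i)) := fun i => contDiff_partialX (n := 1) (hgC i)
  have hgXX : ∀ i, Continuous (partialX (partialX (g i))) :=
    fun i => (contDiff_partialX (n := 0) (hgX i)).continuous
  have hs : ∀ i t, (1 / (P.s i t : ℂ)) = trigSum P.Ω (band P.M) (P.sHat i) t :=
    fun i t => (P.hasSymbol_s i t).symm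
  refine ⟨fun i n x => P.coeff ω (fun t => g i (x, t)) n,
    fun i n x => P.coeff ω (fun t => partialX (g i) (x, t)) n,
    fun i n x => P.coeff ω (fun t => partialX (partialX (g i)) (x, t)) n,
    ⟨?_, ?_, ?_, ?_, ?_, ?_⟩, ?_⟩
  · exact fun i n x => P.hasDerivAt_coeff ω (hgC i).continuous (hgX i).continuous
      (fun x t => hasDerivAt_partialX (hg1 i) x t) n x
  · exact fun i n x => P.hasDerivAt_coeff ω (hgX i).continuous (hgXX i)
      (fun x t => hasDerivAt_partialX (hgX i) x t) n x
  · exact fun i n => P.continuous_coeff ω (hgXX i) n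
  · exact fun i n => hu.coeff_resonator (hgC i) i (hug i) n
  · intro i k m hlt hsub n
    obtain ⟨h, hC, huh⟩ := hu.regular _ _ (hsub.trans subset_union_right)
    have hX : ContDiff ℝ 1 (partialX h) := contDiff_partialX (n := 1) hC
    have hXX := (contDiff_partialX (n := 0) hX).continuous
    have hcX := hX.continuous
    have hc := hC.continuous
    refine ⟨fun x => P.coeff ω (fun t => h (x, t)) n,
      fun x => P.coeff ω (fun t => partialX h (x, t)) n,
      fun x => P.coeff ω (fun t => partialX (partialX h) (x, t)) n,
      fun x => P.hasDerivAt_coeff ω hc hcX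
        (fun x t => hasDerivAt_partialX (hC.of_le (by norm_num)) x t) n x,
      fun x => P.hasDerivAt_coeff ω hcX hXX (fun x t => hasDerivAt_partialX hX x t) n x,
      hu.coeff_background hC hlt hsub huh n, ?_, ?_, ?_⟩
    · have e : (fun t => h (G.xp k + m * G.L, t)) = fun t =>
          Complex.exp (Complex.I * α * m * G.L) * (1 / (P.s k t : ℂ) * g k (G.xp k, t)) := by
        funext t
        have h1 := hu.value_right k t
        rw [tendsto_left (hgC k).continuous (G.xm_lt_xp k) (fun x hx => hug k x hx t)] at h1
        have h2 := hu.translate_eq (a := G.xp k) (b := G.xm i - m * G.L) m (g := h)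
          (by rw [sub_add_cancel]; exact huh)
        rw [tendsto_right (g := fun p : ℝ × ℝ => Complex.exp (-(Complex.I * α * m * G.L)) *
          h (p.1 + m * G.L, p.2)) (by fun_prop) (by linarith) (fun x hx => h2 x hx t)] at h1
        rw [← h1, ← mul_assoc, ← Complex.exp_add]
        simp
      simp only
      rw [e, P.coeff_const_mul, P.coeff_mul (f := fun t => g k (G.xp k, t))
        (by have := (hgC k).continuous; fun_prop) (hs k)]
    · have e : (fun t => h (G.xm i, t)) = fun t => 1 / (P.s i t : ℂ) * g i (G.xm i, t) := by
        funext t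
        have h1 := hu.value_left i t
        rwa [tendsto_left hc hlt (fun x hx => huh x hx t),
          tendsto_right (hgC i).continuous (G.xm_lt_xp i) (fun x hx => hug i x hx t)] at h1
      simp only
      rw [e, P.coeff_mul (f := fun t => g i (G.xm i, t))
        (by have := (hgC i).continuous; fun_prop) (hs i)]
    · have e : (fun t => (P.δ : ℂ) * partialX h (G.xm i, t)) =
          fun t => 1 / (P.s i t : ℂ) * partialX (g i) (G.xm i, t) := by
        funext t
        have h1 := hu.flux_left i t
        rwa [tendsto_left hcX hlt (fun x hx => deriv_eq hC huh hx t),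
          tendsto_right (hgX i).continuous (G.xm_lt_xp i)
            (fun x hx => deriv_eq (hgC i) (hug i) hx t)] at h1
      simp only
      rw [← P.coeff_const_mul, e, P.coeff_mul (f := fun t => partialX (g i) (G.xm i, t))
        (by have := (hgX i).continuous; fun_prop) (hs i)]
  · intro i k m hlt hsub n
    obtain ⟨h, hC, huh⟩ := hu.regular _ _ (hsub.trans subset_union_right)
    have hX : ContDiff ℝ 1 (partialX h) := contDiff_partialX (n := 1) hC
    have hXX := (contDiff_partialX (n := 0) hX).continuous
    have hcX := hX.continuous
    have hc := hC.continuous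
    refine ⟨fun x => P.coeff ω (fun t => h (x, t)) n,
      fun x => P.coeff ω (fun t => partialX h (x, t)) n,
      fun x => P.coeff ω (fun t => partialX (partialX h) (x, t)) n,
      fun x => P.hasDerivAt_coeff ω hc hcX
        (fun x t => hasDerivAt_partialX (hC.of_le (by norm_num)) x t) n x,
      fun x => P.hasDerivAt_coeff ω hcX hXX (fun x t => hasDerivAt_partialX hX x t) n x,
      hu.coeff_background hC hlt hsub huh n, ?_, ?_, ?_⟩
    · have e : (fun t => h (G.xm k + m * G.L, t)) = fun t =>
          Complex.exp (Complex.I * α * m * G.L) * (1 / (P.s k t : ℂ) * g k (G.xm k, t)) := by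
        funext t
        have h1 := hu.value_left k t
        rw [tendsto_right (hgC k).continuous (G.xm_lt_xp k) (fun x hx => hug k x hx t)] at h1
        have h2 := hu.translate_eq (a := G.xp i - m * G.L) (b := G.xm k) m (g := h)
          (by rw [sub_add_cancel]; exact huh)
        rw [tendsto_left (g := fun p : ℝ × ℝ => Complex.exp (-(Complex.I * α * m * G.L)) *
          h (p.1 + m * G.L, p.2)) (by fun_prop) (by linarith) (fun x hx => h2 x hx t)] at h1
        rw [← h1, ← mul_assoc, ← Complex.exp_add]
        simp
      simp only
      rw [e, P.coeff_const_mul, P.coeff_mul (f := fun t => g k (G.xm k, t))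
        (by have := (hgC k).continuous; fun_prop) (hs k)]
    · have e : (fun t => h (G.xp i, t)) = fun t => 1 / (P.s i t : ℂ) * g i (G.xp i, t) := by
        funext t
        have h1 := hu.value_right i t
        rwa [tendsto_right hc hlt (fun x hx => huh x hx t),
          tendsto_left (hgC i).continuous (G.xm_lt_xp i) (fun x hx => hug i x hx t)] at h1
      simp only
      rw [e, P.coeff_mul (f := fun t => g i (G.xp i, t))
        (by have := (hgC i).continuous; fun_prop) (hs i)]
    · have e : (fun t => (P.δ : ℂ) * partialX h (G.xp i, t)) =
          fun t => 1 / (P.s i t : ℂ) * partialX (g i) (G.xp i, t) := by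
        funext t
        have h1 := hu.flux_right i t
        rwa [tendsto_right hcX hlt (fun x hx => deriv_eq hC huh hx t),
          tendsto_left (hgX i).continuous (G.xm_lt_xp i)
            (fun x hx => deriv_eq (hgC i) (hug i) hx t)] at h1
      simp only
      rw [← P.coeff_const_mul, e, P.coeff_mul (f := fun t => partialX (g i) (G.xp i, t))
        (by have := (hgX i).continuous; fun_prop) (hs i)]
  · intro n
    unfold Geometry.normD
    congr 1
    refine Finset.sum_congr rfl fun i _ => ?_
    refine intervalIntegral.integral_congr_Ioo_of_le (G.xm_lt_xp i).le fun x hx => ?_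
    simp only [Medium.harmonic, Medium.coeff, hug i x hx]

end Medium.IsBlochWave

end Bloch

/-! ### The gaps adjacent to a resonator -/

namespace Geometry

variable {N : ℕ} (G : Geometry N)

/-- The resonator whose translate by `leftShift` periods is the left neighbour of the `i`-th one. -/
def leftNbr (i : Fin N) : Fin N := (G.exists_left_gap i).choose

/-- The number of periods by which `leftNbr` has to be translated. -/
def leftShift (i : Fin N) : ℤ := (G.exists_left_gap i).choose_spec.choose

/-- The resonator whose translate by `rightShift` periods is the right neighbour of the `i`-th
one. -/
def rightNbr (i : Fin N) : Fin N := (G.exists_right_gap i).choose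

/-- The number of periods by which `rightNbr` has to be translated. -/
def rightShift (i : Fin N) : ℤ := (G.exists_right_gap i).choose_spec.choose

lemma left_gap_spec (i : Fin N) :
    G.xp (G.leftNbr i) + G.leftShift i * G.L < G.xm i ∧
      Ioo (G.xp (G.leftNbr i) + G.leftShift i * G.L) (G.xm i) ⊆ G.background :=
  (G.exists_left_gap i).choose_spec.choose_spec

lemma right_gap_spec (i : Fin N) :
    G.xp i < G.xm (G.rightNbr i) + G.rightShift i * G.L ∧
      Ioo (G.xp i) (G.xm (G.rightNbr i) + G.rightShift i * G.L) ⊆ G.background :=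
  (G.exists_right_gap i).choose_spec.choose_spec

/-- The length of the gap to the left of the `i`-th resonator. -/
def leftGap (i : Fin N) : ℝ := G.xm i - (G.xp (G.leftNbr i) + G.leftShift i * G.L)

/-- The length of the gap to the right of the `i`-th resonator. -/
def rightGap (i : Fin N) : ℝ := G.xm (G.rightNbr i) + G.rightShift i * G.L - G.xp i

/-- The phase factor between the left neighbour of a resonator and its translate in the cell. -/
def leftPhase (α : ℝ) (i : Fin N) : ℂ := Complex.exp (Complex.I * α * G.leftShift i * G.L)

/-- The phase factor between the right neighbour of a resonator and its translate in the cell. -/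
def rightPhase (α : ℝ) (i : Fin N) : ℂ := Complex.exp (Complex.I * α * G.rightShift i * G.L)

lemma leftGap_pos (i : Fin N) : 0 < G.leftGap i := sub_pos.2 (G.left_gap_spec i).1

lemma rightGap_pos (i : Fin N) : 0 < G.rightGap i := sub_pos.2 (G.right_gap_spec i).1

lemma ell_pos (i : Fin N) : 0 < G.ell i := sub_pos.2 (G.xm_lt_xp i)

lemma norm_leftPhase (α : ℝ) (i : Fin N) : ‖G.leftPhase α i‖ = 1 := by
  have : Complex.I * α * G.leftShift i * G.L =
      ((α * G.leftShift i * G.L : ℝ) : ℂ) * Complex.I := by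
    push_cast
    ring
  rw [leftPhase, this, Complex.norm_exp_ofReal_mul_I]

lemma norm_rightPhase (α : ℝ) (i : Fin N) : ‖G.rightPhase α i‖ = 1 := by
  have : Complex.I * α * G.rightShift i * G.L =
      ((α * G.rightShift i * G.L : ℝ) : ℂ) * Complex.I := by
    push_cast
    ring
  rw [rightPhase, this, Complex.norm_exp_ofReal_mul_I]

/-- The capacitance matrix is the difference of the slopes in the two adjacent gaps of the
piecewise affine quasiperiodic function with given values on the resonators. -/
lemma sum_capacitance_mul (α : ℝ) (i : Fin N) (b : Fin N → ℂ) :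
    ∑ j, G.capacitance α i j * b j =
      (b i - G.leftPhase α i * b (G.leftNbr i)) / G.leftGap i -
      (G.rightPhase α i * b (G.rightNbr i) - b i) / G.rightGap i := by
  have h := G.capacitance_apply α (G.left_gap_spec i).1 (G.left_gap_spec i).2
    (G.right_gap_spec i).1 (G.right_gap_spec i).2
  simp only [h]
  have e : ∀ k : Fin N, ∑ j, (if k = j then (1 : ℂ) else 0) * b j = b k := fun k => by simp
  have e' : ∀ j, ((((if i = j then (1 : ℂ) else 0) - Complex.exp (Complex.I * α * G.leftShift i *
      G.L) * (if G.leftNbr i = j then 1 else 0)) /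
      (G.xm i - (G.xp (G.leftNbr i) + G.leftShift i * G.L) : ℝ) -
      (Complex.exp (Complex.I * α * G.rightShift i * G.L) *
      (if G.rightNbr i = j then 1 else 0) - (if i = j then 1 else 0)) /
      (G.xm (G.rightNbr i) + G.rightShift i * G.L - G.xp i : ℝ)) * b j) =
      (1 / (G.leftGap i : ℂ) + 1 / (G.rightGap i : ℂ)) * ((if i = j then (1 : ℂ) else 0) * b j) -
      G.leftPhase α i / G.leftGap i * ((if G.leftNbr i = j then (1 : ℂ) else 0) * b j) -
      G.rightPhase α i / G.rightGap i * ((if G.rightNbr i = j then (1 : ℂ) else 0) * b j) := by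
    intro j
    rw [leftPhase, rightPhase, leftGap, rightGap]
    ring
  rw [Finset.sum_congr rfl fun j _ => e' j, Finset.sum_sub_distrib, Finset.sum_sub_distrib,
    ← Finset.mul_sum, ← Finset.mul_sum, ← Finset.mul_sum, e, e, e]
  ring

end Geometry

/-! ### A priori estimates for the harmonics -/

/-- All the quantities of order one are between `Λ⁻¹` and `Λ`. -/
structure InRegime {N : ℕ} (P : Medium N) (G : Geometry N) (Λ : ℝ) : Prop where
  one_le : 1 ≤ Λ
  v₀_mem : P.v₀ ∈ Icc Λ⁻¹ Λ
  vr_mem : P.vr ∈ Icc Λ⁻¹ Λ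
  Ω_mem : P.Ω ∈ Icc (Λ⁻¹ * √P.δ) (Λ * √P.δ)
  κ_mem : ∀ i t, P.κ i t ∈ Icc Λ⁻¹ Λ
  s_mem : ∀ i t, |P.s i t| ∈ Icc Λ⁻¹ Λ
  ell_mem : ∀ i, G.ell i ∈ Icc Λ⁻¹ Λ
  leftGap_mem : ∀ i, G.leftGap i ∈ Icc Λ⁻¹ Λ
  rightGap_mem : ∀ i, G.rightGap i ∈ Icc Λ⁻¹ Λ

namespace InRegime

variable {N : ℕ} {P : Medium N} {G : Geometry N} {Λ : ℝ}

lemma pos (h : InRegime P G Λ) : 0 < Λ := by linarith [h.one_le]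

lemma inv_mem {x : ℝ} (h : InRegime P G Λ) (hx : x ∈ Icc Λ⁻¹ Λ) : 0 < x ∧ x⁻¹ ∈ Icc Λ⁻¹ Λ := by
  have h0 := h.pos
  have hx0 : 0 < x := lt_of_lt_of_le (by positivity) hx.1
  exact ⟨hx0, inv_anti₀ hx0 hx.2, inv_le_of_inv_le₀ h0 hx.1⟩

lemma symbol_κ (h : InRegime P G Λ) (i : Fin N) (t : ℝ) :
    trigSum P.Ω (band P.M) (P.kHat i) t = ((P.κ i t)⁻¹ : ℝ) ∧ Λ⁻¹ ≤ (P.κ i t)⁻¹ ∧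
      ‖trigSum P.Ω (band P.M) (P.kHat i) t‖ ≤ Λ := by
  have h1 := h.inv_mem (h.κ_mem i t)
  have e : trigSum P.Ω (band P.M) (P.kHat i) t = ((P.κ i t)⁻¹ : ℝ) := by
    rw [P.hasSymbol_κ]
    simp
  refine ⟨e, h1.2.1, ?_⟩
  rw [e, Complex.norm_real, Real.norm_of_nonneg (inv_nonneg.2 h1.1.le)]
  exact h1.2.2

lemma symbol_s (h : InRegime P G Λ) (i : Fin N) (t : ℝ) :
    Λ⁻¹ ≤ ‖trigSum P.Ω (band P.M) (P.sHat i) t‖ ∧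
      ‖trigSum P.Ω (band P.M) (P.sHat i) t‖ ≤ Λ := by
  have h1 := h.inv_mem (h.s_mem i t)
  have e : ‖trigSum P.Ω (band P.M) (P.sHat i) t‖ = |P.s i t|⁻¹ := by
    rw [P.hasSymbol_s]
    simp
  rw [e]
  exact h1.2

end InRegime

section Estimates

variable {N : ℕ}

/-- The squared `L²` norm of a harmonic on the `i`-th resonator. -/
def mass (G : Geometry N) (v : Fin N → ℤ → ℝ → ℂ) (i : Fin N) (n : ℤ) : ℝ :=
  ∫ x in G.xm i..G.xp i, ‖v i n x‖ ^ 2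

/-- The sum of the squared `L²` norms on the `i`-th resonator over the harmonics `|n| ≤ J`. -/
def massSum (G : Geometry N) (v : Fin N → ℤ → ℝ → ℂ) (i : Fin N) (J : ℕ) : ℝ :=
  ∑ n ∈ band J, mass G v i n

lemma mass_nonneg (G : Geometry N) (v : Fin N → ℤ → ℝ → ℂ) (i : Fin N) (n : ℤ) :
    0 ≤ mass G v i n :=
  intervalIntegral.integral_nonneg (G.xm_lt_xp i).le fun _ _ => by positivity

lemma massSum_mono (G : Geometry N) (v : Fin N → ℤ → ℝ → ℂ) (i : Fin N) {I J : ℕ} (h : I ≤ J) :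
    massSum G v i I ≤ massSum G v i J :=
  Finset.sum_le_sum_of_subset_of_nonneg (band_mono h) fun _ _ _ => mass_nonneg G v i _

lemma massSum_nonneg (G : Geometry N) (v : Fin N → ℤ → ℝ → ℂ) (i : Fin N) (J : ℕ) :
    0 ≤ massSum G v i J := Finset.sum_nonneg fun _ _ => mass_nonneg G v i _

lemma massSum_eq_integral (G : Geometry N) {v : Fin N → ℤ → ℝ → ℂ} (i : Fin N)
    (hv : ∀ n, Continuous (v i n)) (J : ℕ) :
    massSum G v i J = ∫ x in G.xm i..G.xp i, energy J (fun n => v i n x) := by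
  unfold massSum mass energy
  rw [intervalIntegral.integral_finsetSum
    fun n _ => Continuous.intervalIntegrable (by have := hv n; fun_prop) _ _]

/-- The time derivatives of the harmonics, up to the factor `i`. -/
def timeDeriv (P : Medium N) (ω : ℂ) (v : Fin N → ℤ → ℝ → ℂ) (i : Fin N) (n : ℤ) (x : ℝ) : ℂ :=
  P.freq ω n * v i n x

lemma mass_timeDeriv (P : Medium N) (G : Geometry N) (ω : ℂ) (v : Fin N → ℤ → ℝ → ℂ)
    (i : Fin N) (n : ℤ) :
    mass G (timeDeriv P ω v) i n = ‖P.freq ω n‖ ^ 2 * mass G v i n := by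
  simp only [mass, timeDeriv, norm_mul, mul_pow]
  rw [intervalIntegral.integral_const_mul]

/-- The largest of the contraction factors by which the estimates for truncations improve when the
truncation is moved by twice the bandwidth. -/
def decayRate (Λ : ℝ) : ℝ := 4 * Λ ^ 4 / (1 + 4 * Λ ^ 4)

/-- The standing assumptions for the estimates: the harmonics `|n| ≤ J` have frequencies at most
`ρ`, which is small, and `r` improvements by the factor `decayRate Λ` gain `δ²`. -/
structure IsControlled (P : Medium N) (G : Geometry N) (α : ℝ) (ω : ℂ)
    (v dv ddv : Fin N → ℤ → ℝ → ℂ) (Λ ρ : ℝ) (J r : ℕ) : Prop where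
  modes : IsModeSystem P G α ω v dv ddv
  regime : InRegime P G Λ
  freq_le : ∀ n ∈ band J, ‖P.freq ω n‖ ≤ ρ
  ρ_small : 8 * Λ ^ 13 * ρ ^ 2 ≤ 1
  δ_le : P.δ ≤ 1
  total : ∀ i I, massSum G v i I ≤ 1
  decay : decayRate Λ ^ r ≤ P.δ ^ 2

lemma Medium.δ_pos (P : Medium N) : 0 < P.δ := div_pos P.ρr_pos P.ρ₀_pos

namespace IsControlled

variable {P : Medium N} {G : Geometry N} {α : ℝ} {ω : ℂ} {v dv ddv : Fin N → ℤ → ℝ → ℂ}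
  {Λ ρ : ℝ} {J r : ℕ}

lemma continuous_v (h : IsControlled P G α ω v dv ddv Λ ρ J r) (i : Fin N) (n : ℤ) :
    Continuous (v i n) :=
  continuous_iff_continuousAt.2 fun x => (h.modes.hasDerivAt i n x).continuousAt

lemma one_le_pow (h : IsControlled P G α ω v dv ddv Λ ρ J r) {a b : ℕ} (hab : a ≤ b) :
    Λ ^ a ≤ Λ ^ b := pow_le_pow_right₀ h.regime.one_le hab

lemma one_le_pow' (h : IsControlled P G α ω v dv ddv Λ ρ J r) (a : ℕ) : 1 ≤ Λ ^ a :=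
  one_le_pow₀ h.regime.one_le

lemma ρ_sq_le (h : IsControlled P G α ω v dv ddv Λ ρ J r) {a : ℕ} (ha : a ≤ 13) :
    8 * Λ ^ a * ρ ^ 2 ≤ 1 := by
  refine le_trans ?_ h.ρ_small
  gcongr
  exact h.regime.one_le

lemma timeMass_le (h : IsControlled P G α ω v dv ddv Λ ρ J r) (i : Fin N) {I : ℕ} (hI : I ≤ J) :
    massSum G (timeDeriv P ω v) i I ≤ ρ ^ 2 := by
  have h1 : massSum G (timeDeriv P ω v) i I ≤ ρ ^ 2 * massSum G v i I := by
    unfold massSum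
    rw [Finset.mul_sum]
    refine Finset.sum_le_sum fun n hn => ?_
    rw [mass_timeDeriv]
    have := mass_nonneg G v i n
    gcongr
    exact h.freq_le n (band_mono hI hn)
  have := h.total i I
  nlinarith [sq_nonneg ρ]

lemma ddv_eq (h : IsControlled P G α ω v dv ddv Λ ρ J r) (i : Fin N) (n : ℤ) {x : ℝ}
    (hx : x ∈ Icc (G.xm i) (G.xp i)) :
    ‖ddv i n x‖ ^ 2 ≤ Λ ^ 4 * (‖P.freq ω n‖ ^ 2 *
      ‖conv P.M (P.kHat i) (fun m => timeDeriv P ω v i m x) n‖ ^ 2) := by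
  have e := congrArg norm (h.modes.resonator i n x hx)
  rw [norm_mul, norm_neg, norm_mul, norm_pow, Complex.norm_real] at e
  have hv := h.regime.inv_mem h.regime.vr_mem
  rw [Real.norm_of_nonneg hv.1.le] at e
  have e2 : ‖ddv i n x‖ = (P.vr⁻¹) ^ 2 * (‖P.freq ω n‖ *
      ‖conv P.M (P.kHat i) (fun m => timeDeriv P ω v i m x) n‖) := by
    simp only [timeDeriv]
    rw [← e]
    have := hv.1.ne'
    field_simp
  rw [e2, mul_pow, mul_pow, ← pow_mul]
  have : P.vr⁻¹ ^ (2 * 2) ≤ Λ ^ 4 := by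
    gcongr
    exacts [inv_nonneg.2 hv.1.le, hv.2.2]
  gcongr

/-- The second derivatives in space are small, because the frequencies are. -/
lemma ddvMass_le (h : IsControlled P G α ω v dv ddv Λ ρ J r) (i : Fin N) {I : ℕ} (hI : I ≤ J) :
    massSum G ddv i I ≤ Λ ^ 6 * ρ ^ 2 * massSum G (timeDeriv P ω v) i (I + P.M) := by
  have hq : ∀ n, Continuous (timeDeriv P ω v i n) := fun n => by
    have := h.continuous_v i n
    unfold timeDeriv
    fun_prop
  rw [massSum_eq_integral G i (h.modes.continuous i), massSum_eq_integral G i hq,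
    ← intervalIntegral.integral_const_mul]
  have hd := h.modes.continuous i
  refine intervalIntegral.integral_mono_on (G.xm_lt_xp i).le
    (Continuous.intervalIntegrable (by unfold energy; fun_prop) _ _)
    (Continuous.intervalIntegrable (by unfold energy; fun_prop) _ _) fun x hx => ?_
  have h1 : energy I (fun n => ddv i n x) ≤
      Λ ^ 4 * ρ ^ 2 * energy I (conv P.M (P.kHat i) (fun m => timeDeriv P ω v i m x)) := by
    unfold energy
    rw [Finset.mul_sum]
    refine Finset.sum_le_sum fun n hn => (h.ddv_eq i n hx).trans ?_
    rw [mul_assoc]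
    have := h.regime.pos
    gcongr
    exact h.freq_le n (band_mono hI hn)
  have h2 := energy_conv_le P.Ω_pos (fun t => (h.regime.symbol_κ i t).2.2) I
    (fun m => timeDeriv P ω v i m x)
  have := h.regime.pos
  calc _ ≤ _ := h1
    _ ≤ Λ ^ 4 * ρ ^ 2 * (Λ ^ 2 * energy (I + P.M) (fun m => timeDeriv P ω v i m x)) := by gcongr
    _ = _ := by ring

lemma massSum_ddv_le_one (h : IsControlled P G α ω v dv ddv Λ ρ J r) (i : Fin N) {I : ℕ}
    (hI : I + P.M ≤ J) : massSum G ddv i I ≤ 1 := by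
  have h1 := h.ddvMass_le i (show I ≤ J by omega)
  have h2 := h.timeMass_le i hI
  have h3 := h.ρ_sq_le (a := 6) (by norm_num)
  have h4 := h.ρ_sq_le (a := 0) (by norm_num)
  have h0 := massSum_nonneg G (timeDeriv P ω v) i (I + P.M)
  nlinarith [sq_nonneg ρ]

/-- Boundary values and boundary derivatives of the harmonics are bounded. -/
lemma energy_trace_le (h : IsControlled P G α ω v dv ddv Λ ρ J r) (i : Fin N) {I : ℕ}
    (hI : I + P.M ≤ J) {x : ℝ} (hx : x ∈ Icc (G.xm i) (G.xp i)) :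
    energy I (fun n => v i n x) ≤ 1000 * Λ ^ 3 ∧ energy I (fun n => dv i n x) ≤ 1000 * Λ ^ 3 := by
  have h1 := h.massSum_ddv_le_one i hI
  have h2 := h.total i I
  have h0 := h.regime.pos
  have key := fun n => norm_sq_le_of_integral (h.modes.hasDerivAt i n) (h.modes.hasDerivAt_dv i n)
    (h.modes.continuous i n) h.regime.one_le (h.regime.ell_mem i).1 (h.regime.ell_mem i).2 hx
  have hsum : ∑ n ∈ band I, 500 * Λ ^ 3 * (mass G v i n + mass G ddv i n) ≤ 1000 * Λ ^ 3 := by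
    rw [← Finset.mul_sum, Finset.sum_add_distrib]
    have : massSum G v i I + massSum G ddv i I ≤ 2 := by linarith
    calc _ ≤ 500 * Λ ^ 3 * 2 := by
          gcongr
          exact this
      _ = _ := by ring
  exact ⟨(Finset.sum_le_sum fun n _ => (key n).1).trans hsum,
    (Finset.sum_le_sum fun n _ => (key n).2).trans hsum⟩

lemma energy_outer_le (h : IsControlled P G α ω v dv ddv Λ ρ J r) (i : Fin N) {I : ℕ}
    (hI : I + 2 * P.M ≤ J) {x : ℝ} (hx : x ∈ Icc (G.xm i) (G.xp i)) :
    energy I (conv P.M (P.sHat i) (fun n => v i n x)) ≤ 1000 * Λ ^ 5 := by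
  have h1 := energy_conv_le P.Ω_pos (fun t => (h.regime.symbol_s i t).2) I (fun n => v i n x)
  have h2 := (h.energy_trace_le i (I := I + P.M) (by omega) hx).1
  have h0 := h.regime.pos
  calc _ ≤ _ := h1
    _ ≤ Λ ^ 2 * (1000 * Λ ^ 3) := by gcongr
    _ = _ := by ring

lemma helmholtz_small (h : IsControlled P G α ω v dv ddv Λ ρ J r) {n : ℤ} (hn : n ∈ band J)
    {d : ℝ} (hd : d ∈ Icc Λ⁻¹ Λ) :
    ‖P.freq ω n / P.v₀‖ ^ 2 * d ^ 2 ≤ 1 / 2 ∧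
      4 * d * ‖P.freq ω n / P.v₀‖ ^ 2 ≤ 4 * Λ ^ 3 * ρ ^ 2 := by
  have h0 := h.regime.pos
  have hv := h.regime.inv_mem h.regime.v₀_mem
  have hd0 := (h.regime.inv_mem hd).1
  have h1 : ‖P.freq ω n / P.v₀‖ ^ 2 ≤ Λ ^ 2 * ρ ^ 2 := by
    rw [div_eq_mul_inv, norm_mul, norm_inv, Complex.norm_real, Real.norm_of_nonneg hv.1.le,
      mul_pow, mul_comm]
    gcongr
    · exact inv_nonneg.2 hv.1.le
    · exact hv.2.2
    · exact h.freq_le n hn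
  have h2 := h.ρ_sq_le (a := 4) (by norm_num)
  have hd1 := hd.2
  constructor
  · calc _ ≤ (Λ ^ 2 * ρ ^ 2) * Λ ^ 2 := by gcongr
      _ = Λ ^ 4 * ρ ^ 2 := by ring
      _ ≤ 1 / 2 := by nlinarith
  · calc _ ≤ 4 * Λ * (Λ ^ 2 * ρ ^ 2) := by gcongr
      _ = _ := by ring

/-- The outer flux at a left boundary point is close to the slope of the outer boundary values. -/
lemma left_flux (h : IsControlled P G α ω v dv ddv Λ ρ J r) (i : Fin N) {n : ℤ}
    (hn : n ∈ band J) :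
    ‖(P.δ : ℂ)⁻¹ * conv P.M (P.sHat i) (fun l => dv i l (G.xm i)) n -
      (conv P.M (P.sHat i) (fun l => v i l (G.xm i)) n - G.leftPhase α i *
        conv P.M (P.sHat (G.leftNbr i)) (fun l => v (G.leftNbr i) l (G.xp (G.leftNbr i))) n) /
        G.leftGap i‖ ≤ 4 * Λ ^ 3 * ρ ^ 2 *
      (‖conv P.M (P.sHat i) (fun l => v i l (G.xm i)) n‖ +
        ‖conv P.M (P.sHat (G.leftNbr i))
          (fun l => v (G.leftNbr i) l (G.xp (G.leftNbr i))) n‖) := by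
  obtain ⟨y, y', y'', hy, hy', heq, e1, e2, e3⟩ := h.modes.left_gap i (G.leftNbr i) (G.leftShift i)
    (G.left_gap_spec i).1 (G.left_gap_spec i).2 n
  have hs := h.helmholtz_small hn (h.regime.leftGap_mem i)
  have key := helmholtz_slope hy hy' (G.left_gap_spec i).1 heq hs.1
    (right_mem_Icc.2 (G.left_gap_spec i).1.le)
  have hδ : (P.δ : ℂ) ≠ 0 := by exact_mod_cast P.δ_pos.ne'
  rw [← e3, inv_mul_cancel_left₀ hδ, ← e2]
  rw [e1, ← Complex.ofReal_sub, norm_mul] at key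
  change ‖y' (G.xm i) - (y (G.xm i) - G.leftPhase α i * _) / (G.leftGap i : ℂ)‖ ≤
    4 * G.leftGap i * ‖P.freq ω n / P.v₀‖ ^ 2 * (‖G.leftPhase α i‖ * _ + _) at key
  rw [G.norm_leftPhase, one_mul] at key
  refine key.trans ?_
  rw [add_comm ‖y (G.xm i)‖]
  exact mul_le_mul_of_nonneg_right hs.2 (by positivity)

/-- The outer flux at a right boundary point is close to the slope of the outer boundary values. -/
lemma right_flux (h : IsControlled P G α ω v dv ddv Λ ρ J r) (i : Fin N) {n : ℤ}
    (hn : n ∈ band J) :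
    ‖(P.δ : ℂ)⁻¹ * conv P.M (P.sHat i) (fun l => dv i l (G.xp i)) n -
      (G.rightPhase α i * conv P.M (P.sHat (G.rightNbr i))
          (fun l => v (G.rightNbr i) l (G.xm (G.rightNbr i))) n -
        conv P.M (P.sHat i) (fun l => v i l (G.xp i)) n) /
        G.rightGap i‖ ≤ 4 * Λ ^ 3 * ρ ^ 2 *
      (‖conv P.M (P.sHat i) (fun l => v i l (G.xp i)) n‖ +
        ‖conv P.M (P.sHat (G.rightNbr i))
          (fun l => v (G.rightNbr i) l (G.xm (G.rightNbr i))) n‖) := by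
  obtain ⟨y, y', y'', hy, hy', heq, e1, e2, e3⟩ := h.modes.right_gap i (G.rightNbr i)
    (G.rightShift i) (G.right_gap_spec i).1 (G.right_gap_spec i).2 n
  have hs := h.helmholtz_small hn (h.regime.rightGap_mem i)
  have key := helmholtz_slope hy hy' (G.right_gap_spec i).1 heq hs.1
    (left_mem_Icc.2 (G.right_gap_spec i).1.le)
  have hδ : (P.δ : ℂ) ≠ 0 := by exact_mod_cast P.δ_pos.ne'
  rw [← e3, inv_mul_cancel_left₀ hδ, ← e2]
  rw [e1, ← Complex.ofReal_sub, norm_mul] at key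
  change ‖y' (G.xp i) - (G.rightPhase α i * _ - y (G.xp i)) / (G.rightGap i : ℂ)‖ ≤
    4 * G.rightGap i * ‖P.freq ω n / P.v₀‖ ^ 2 * (_ + ‖G.rightPhase α i‖ * _) at key
  rw [G.norm_rightPhase, one_mul] at key
  exact key.trans (mul_le_mul_of_nonneg_right hs.2 (by positivity))

end IsControlled

end Estimates

/-! ### Truncations of the harmonics: flux and time derivative -/

section Estimates

variable {N : ℕ}

lemma sq_add_le (a b : ℝ) : (a + b) ^ 2 ≤ 2 * (a ^ 2 + b ^ 2) := by
  nlinarith [sq_nonneg (a - b)]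

lemma norm_integral_mul_conj_le {f g : ℝ → ℂ} (hf : Continuous f) (hg : Continuous g) {p q : ℝ}
    (hpq : p ≤ q) : ‖∫ x in p..q, f x * (starRingEnd ℂ) (g x)‖ ≤
      ((∫ x in p..q, ‖f x‖ ^ 2) + ∫ x in p..q, ‖g x‖ ^ 2) / 2 := by
  refine (intervalIntegral.norm_integral_le_integral_norm hpq).trans ?_
  rw [← intervalIntegral.integral_add (Continuous.intervalIntegrable (by fun_prop) _ _)
    (Continuous.intervalIntegrable (by fun_prop) _ _), ← intervalIntegral.integral_div]
  have hcc : Continuous fun x => (starRingEnd ℂ) (g x) := Complex.continuous_conj.comp hg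
  refine intervalIntegral.integral_mono_on hpq (Continuous.intervalIntegrable (by fun_prop) _ _)
    (Continuous.intervalIntegrable (by fun_prop) _ _) fun x _ => ?_
  rw [norm_mul, RCLike.norm_conj]
  nlinarith [sq_nonneg (‖f x‖ - ‖g x‖)]

lemma decayRate_pos {Λ : ℝ} (h : 1 ≤ Λ) : 0 < decayRate Λ := by
  have : 0 < Λ := by linarith
  unfold decayRate
  positivity

namespace IsControlled

variable {P : Medium N} {G : Geometry N} {α : ℝ} {ω : ℂ} {v dv ddv : Fin N → ℤ → ℝ → ℂ}
  {Λ ρ : ℝ} {J r : ℕ}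

lemma xm_mem (G : Geometry N) (i : Fin N) : G.xm i ∈ Icc (G.xm i) (G.xp i) :=
  left_mem_Icc.2 (G.xm_lt_xp i).le

lemma xp_mem (G : Geometry N) (i : Fin N) : G.xp i ∈ Icc (G.xm i) (G.xp i) :=
  right_mem_Icc.2 (G.xm_lt_xp i).le

lemma norm_flux_sq_le (h : IsControlled P G α ω v dv ddv Λ ρ J r) {f b b' w : ℂ} {d : ℝ}
    (hd : d ∈ Icc Λ⁻¹ Λ) (hw : ‖w‖ ≤ ‖b‖ + ‖b'‖)
    (hf : ‖(P.δ : ℂ)⁻¹ * f - w / d‖ ≤ 4 * Λ ^ 3 * ρ ^ 2 * (‖b‖ + ‖b'‖)) :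
    ‖f‖ ^ 2 ≤ P.δ ^ 2 * (8 * Λ ^ 2 * (‖b‖ ^ 2 + ‖b'‖ ^ 2)) := by
  have h0 := h.regime.pos
  have h1 := h.ρ_sq_le (a := 3) (by norm_num)
  have hd' := h.regime.inv_mem hd
  have hδ := P.δ_pos
  have hs : ‖w / d‖ ≤ Λ * (‖b‖ + ‖b'‖) := by
    rw [norm_div, Complex.norm_real, Real.norm_of_nonneg hd'.1.le, div_eq_mul_inv, mul_comm]
    gcongr
    exact hd'.2.2
  have hsum : ‖(P.δ : ℂ)⁻¹ * f‖ ≤ 2 * Λ * (‖b‖ + ‖b'‖) := by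
    have e : (P.δ : ℂ)⁻¹ * f = ((P.δ : ℂ)⁻¹ * f - w / d) + w / d := by ring
    rw [e]
    refine (norm_add_le _ _).trans ?_
    have hle : 4 * Λ ^ 3 * ρ ^ 2 * (‖b‖ + ‖b'‖) ≤ Λ * (‖b‖ + ‖b'‖) := by
      gcongr
      linarith [h.regime.one_le]
    linarith
  rw [norm_mul, norm_inv, Complex.norm_real, Real.norm_of_nonneg hδ.le, inv_mul_le_iff₀ hδ] at hsum
  calc ‖f‖ ^ 2 ≤ (P.δ * (2 * Λ * (‖b‖ + ‖b'‖))) ^ 2 := by gcongr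
    _ = P.δ ^ 2 * (4 * Λ ^ 2 * (‖b‖ + ‖b'‖) ^ 2) := by ring
    _ ≤ P.δ ^ 2 * (4 * Λ ^ 2 * (2 * (‖b‖ ^ 2 + ‖b'‖ ^ 2))) := by
      gcongr
      exact sq_add_le _ _
    _ = _ := by ring

lemma energy_left_flux_le (h : IsControlled P G α ω v dv ddv Λ ρ J r) (i : Fin N) {I : ℕ}
    (hI : I + 2 * P.M ≤ J) :
    energy I (conv P.M (P.sHat i) (fun n => dv i n (G.xm i))) ≤ 16000 * Λ ^ 7 * P.δ ^ 2 := by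
  have h0 := h.regime.pos
  have e1 := h.energy_outer_le i hI (xm_mem G i)
  have e2 := h.energy_outer_le (G.leftNbr i) hI (xp_mem G (G.leftNbr i))
  calc _ ≤ P.δ ^ 2 * (8 * Λ ^ 2 *
        (energy I (conv P.M (P.sHat i) (fun n => v i n (G.xm i))) +
        energy I (conv P.M (P.sHat (G.leftNbr i))
          (fun n => v (G.leftNbr i) n (G.xp (G.leftNbr i)))))) := by
        unfold energy
        rw [← Finset.sum_add_distrib, Finset.mul_sum, Finset.mul_sum]
        refine Finset.sum_le_sum fun n hn => ?_
        refine h.norm_flux_sq_le (h.regime.leftGap_mem i) ?_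
          (h.left_flux i (band_mono (by omega) hn))
        refine (norm_sub_le _ _).trans ?_
        rw [norm_mul, G.norm_leftPhase, one_mul]
    _ ≤ P.δ ^ 2 * (8 * Λ ^ 2 * (1000 * Λ ^ 5 + 1000 * Λ ^ 5)) := by gcongr
    _ = _ := by ring

lemma energy_right_flux_le (h : IsControlled P G α ω v dv ddv Λ ρ J r) (i : Fin N) {I : ℕ}
    (hI : I + 2 * P.M ≤ J) :
    energy I (conv P.M (P.sHat i) (fun n => dv i n (G.xp i))) ≤ 16000 * Λ ^ 7 * P.δ ^ 2 := by
  have h0 := h.regime.pos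
  have e1 := h.energy_outer_le i hI (xp_mem G i)
  have e2 := h.energy_outer_le (G.rightNbr i) hI (xm_mem G (G.rightNbr i))
  calc _ ≤ P.δ ^ 2 * (8 * Λ ^ 2 *
        (energy I (conv P.M (P.sHat i) (fun n => v i n (G.xp i))) +
        energy I (conv P.M (P.sHat (G.rightNbr i))
          (fun n => v (G.rightNbr i) n (G.xm (G.rightNbr i)))))) := by
        unfold energy
        rw [← Finset.sum_add_distrib, Finset.mul_sum, Finset.mul_sum]
        refine Finset.sum_le_sum fun n hn => ?_
        refine h.norm_flux_sq_le (h.regime.rightGap_mem i) ?_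
          (h.right_flux i (band_mono (by omega) hn))
        refine (norm_sub_le _ _).trans ?_
        rw [norm_mul, G.norm_rightPhase, one_mul, add_comm]
    _ ≤ P.δ ^ 2 * (8 * Λ ^ 2 * (1000 * Λ ^ 5 + 1000 * Λ ^ 5)) := by gcongr
    _ = _ := by ring

/-- The flux out of the resonators is of order `δ`: multiplication by `1 / s` can be inverted up to
a window of harmonics near the truncation, and moving the truncation gains a fixed factor. -/
lemma energy_dv_le_of_flux (h : IsControlled P G α ω v dv ddv Λ ρ J r) (i : Fin N) {x : ℝ}
    (hx : x ∈ Icc (G.xm i) (G.xp i))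
    (hflux : ∀ I, I + 2 * P.M ≤ J →
      energy I (conv P.M (P.sHat i) (fun n => dv i n x)) ≤ 16000 * Λ ^ 7 * P.δ ^ 2)
    {I : ℕ} (hI : I + 2 * P.M * r + 3 * P.M ≤ J) :
    energy I (fun n => dv i n x) ≤ 33000 * Λ ^ 9 * P.δ ^ 2 := by
  have h0 := h.regime.pos
  have hΛ := h.regime.one_le
  have hstep : ∀ j < r, (Λ⁻¹) ^ 2 * energy (I + 2 * P.M * j) (fun n => dv i n x) ≤
      32000 * Λ ^ 7 * P.δ ^ 2 + 2 * Λ ^ 2 *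
      (energy (I + 2 * P.M * (j + 1)) (fun n => dv i n x) -
        energy (I + 2 * P.M * j) (fun n => dv i n x)) := by
    intro j hj
    have hjr : P.M * (j + 1) ≤ P.M * r := Nat.mul_le_mul_left _ hj
    have hle : I + 2 * P.M * j + P.M + 2 * P.M ≤ J := by nlinarith
    have h1 := energy_le_energy_conv P.Ω_pos (fun t => (h.regime.symbol_s i t).2)
      (by positivity) (fun t => (h.regime.symbol_s i t).1) (I + 2 * P.M * j) (fun n => dv i n x)
    have h2 := hflux _ hle
    have e : I + 2 * P.M * j + 2 * P.M = I + 2 * P.M * (j + 1) := by ring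
    rw [e] at h1
    linarith
  have key := le_of_increment_bound (E := fun I => energy I (fun n => dv i n x))
    (by positivity) (by positivity) (by positivity) (2 * P.M) r I hstep
  have hlast := (h.energy_trace_le i (I := I + 2 * P.M * r) (by omega) hx).2
  have hrate : (2 * Λ ^ 2 / ((Λ⁻¹) ^ 2 + 2 * Λ ^ 2)) ≤ decayRate Λ := by
    unfold decayRate
    rw [div_le_div_iff₀ (by positivity) (by positivity)]
    field_simp
    nlinarith [pow_pos h0 4]
  have hpow : (2 * Λ ^ 2 / ((Λ⁻¹) ^ 2 + 2 * Λ ^ 2)) ^ r ≤ P.δ ^ 2 :=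
    (pow_le_pow_left₀ (by positivity) hrate r).trans h.decay
  have h9 := h.one_le_pow (show 3 ≤ 9 by norm_num)
  calc _ ≤ _ := key
    _ ≤ 32000 * Λ ^ 7 * P.δ ^ 2 / (Λ⁻¹) ^ 2 + P.δ ^ 2 * (1000 * Λ ^ 3) := by
      gcongr
      exact energy_nonneg _ _
    _ ≤ 32000 * Λ ^ 9 * P.δ ^ 2 + P.δ ^ 2 * (1000 * Λ ^ 9) := by
      gcongr
      rw [div_le_iff₀ (by positivity)]
      apply le_of_eq
      field_simp
    _ = _ := by ring

lemma energy_dv_left_le (h : IsControlled P G α ω v dv ddv Λ ρ J r) (i : Fin N) {I : ℕ}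
    (hI : I + 2 * P.M * r + 3 * P.M ≤ J) :
    energy I (fun n => dv i n (G.xm i)) ≤ 33000 * Λ ^ 9 * P.δ ^ 2 :=
  h.energy_dv_le_of_flux i (xm_mem G i) (fun _ h' => h.energy_left_flux_le i h') hI

lemma energy_dv_right_le (h : IsControlled P G α ω v dv ddv Λ ρ J r) (i : Fin N) {I : ℕ}
    (hI : I + 2 * P.M * r + 3 * P.M ≤ J) :
    energy I (fun n => dv i n (G.xp i)) ≤ 33000 * Λ ^ 9 * P.δ ^ 2 :=
  h.energy_dv_le_of_flux i (xp_mem G i) (fun _ h' => h.energy_right_flux_le i h') hI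

/-- The squared oscillation bound of the `n`-th harmonic on the `i`-th resonator. -/
def _root_.SpaceTimeResonators.oscBound (G : Geometry N) (Λ : ℝ) (dv ddv : Fin N → ℤ → ℝ → ℂ)
    (i : Fin N) (n : ℤ) : ℝ :=
  2 * Λ ^ 2 * (‖dv i n (G.xm i)‖ ^ 2 + Λ * mass G ddv i n)

lemma norm_sub_left_sq_le (h : IsControlled P G α ω v dv ddv Λ ρ J r) (i : Fin N) (n : ℤ) {x : ℝ}
    (hx : x ∈ Icc (G.xm i) (G.xp i)) :
    ‖v i n x - v i n (G.xm i)‖ ^ 2 ≤ oscBound G Λ dv ddv i n := by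
  refine (SpaceTimeResonators.norm_sub_left_sq_le (h.modes.hasDerivAt i n)
    (h.modes.hasDerivAt_dv i n) (h.modes.continuous i n) (G.xm_lt_xp i) hx).trans ?_
  have h1 := (h.regime.ell_mem i).2
  have h2 : 0 ≤ G.xp i - G.xm i := (G.ell_pos i).le
  have h3 := mass_nonneg G ddv i n
  have h0 := h.regime.pos
  change G.xp i - G.xm i ≤ Λ at h1
  unfold oscBound
  change (G.xp i - G.xm i) ^ 2 * (2 * ‖dv i n (G.xm i)‖ ^ 2 +
    2 * ((G.xp i - G.xm i) * mass G ddv i n)) ≤ _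
  calc _ ≤ Λ ^ 2 * (2 * ‖dv i n (G.xm i)‖ ^ 2 + 2 * (Λ * mass G ddv i n)) := by gcongr
    _ = _ := by ring

lemma norm_integral_ddv_mul_conj_le (h : IsControlled P G α ω v dv ddv Λ ρ J r) (i : Fin N)
    (n : ℤ) : ‖∫ x in G.xm i..G.xp i, ddv i n x * (starRingEnd ℂ) (v i n x)‖ ≤
      P.δ⁻¹ * (‖dv i n (G.xp i)‖ ^ 2 + ‖dv i n (G.xm i)‖ ^ 2) + P.δ * ‖v i n (G.xm i)‖ ^ 2 +
      (mass G ddv i n + Λ * oscBound G Λ dv ddv i n) / 2 := by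
  have hv := h.continuous_v i n
  have hd := h.modes.continuous i n
  have hpq := G.xm_lt_xp i
  have hδ := P.δ_pos
  set a := v i n (G.xm i) with ha
  have hvc : Continuous fun x => (starRingEnd ℂ) (v i n x - a) :=
    Complex.continuous_conj.comp (hv.sub continuous_const)
  have hsplit : ∫ x in G.xm i..G.xp i, ddv i n x * (starRingEnd ℂ) (v i n x) =
      (∫ x in G.xm i..G.xp i, ddv i n x) * (starRingEnd ℂ) a +
      ∫ x in G.xm i..G.xp i, ddv i n x * (starRingEnd ℂ) (v i n x - a) := by
    rw [← intervalIntegral.integral_mul_const, ← intervalIntegral.integral_add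
      (Continuous.intervalIntegrable (by fun_prop) _ _)
      (Continuous.intervalIntegrable (by fun_prop) _ _)]
    congr 1
    funext x
    rw [map_sub]
    ring
  have hint : ∫ x in G.xm i..G.xp i, ddv i n x = dv i n (G.xp i) - dv i n (G.xm i) :=
    intervalIntegral.integral_eq_sub_of_hasDerivAt (fun x _ => h.modes.hasDerivAt_dv i n x)
      (hd.intervalIntegrable _ _)
  rw [hsplit, hint]
  refine (norm_add_le _ _).trans (add_le_add ?_ ?_)
  · rw [norm_mul, RCLike.norm_conj]
    have h1 := norm_sub_le (dv i n (G.xp i)) (dv i n (G.xm i))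
    set A := ‖dv i n (G.xp i)‖
    set B := ‖dv i n (G.xm i)‖
    have h2 : ‖dv i n (G.xp i) - dv i n (G.xm i)‖ * ‖a‖ ≤ (A + B) * ‖a‖ := by gcongr
    have h3 : (A + B) * ‖a‖ ≤ P.δ⁻¹ * ((A + B) ^ 2 / 2) + P.δ * ‖a‖ ^ 2 / 2 := by
      have : P.δ⁻¹ * ((A + B) ^ 2 / 2) + P.δ * ‖a‖ ^ 2 / 2 - (A + B) * ‖a‖ =
          P.δ⁻¹ * ((A + B - P.δ * ‖a‖) ^ 2) / 2 := by
        field_simp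
        ring
      have h4 : 0 ≤ P.δ⁻¹ * ((A + B - P.δ * ‖a‖) ^ 2) / 2 := by positivity
      linarith
    have h5 : P.δ⁻¹ * ((A + B) ^ 2 / 2) ≤ P.δ⁻¹ * (A ^ 2 + B ^ 2) := by
      gcongr
      linarith [sq_add_le A B]
    have h6 : 0 ≤ P.δ * ‖a‖ ^ 2 := by positivity
    linarith
  · refine (norm_integral_mul_conj_le hd (hv.sub continuous_const) hpq.le).trans ?_
    have h1 : ∫ x in G.xm i..G.xp i, ‖v i n x - a‖ ^ 2 ≤ Λ * oscBound G Λ dv ddv i n := by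
      have h2 : ∫ x in G.xm i..G.xp i, ‖v i n x - a‖ ^ 2 ≤
          ∫ _ in G.xm i..G.xp i, oscBound G Λ dv ddv i n :=
        intervalIntegral.integral_mono_on hpq.le
          (Continuous.intervalIntegrable (by fun_prop) _ _) (by simp)
          fun x hx => h.norm_sub_left_sq_le i n hx
      rw [intervalIntegral.integral_const, smul_eq_mul] at h2
      refine h2.trans ?_
      have h3 : 0 ≤ oscBound G Λ dv ddv i n :=
        (sq_nonneg _).trans (h.norm_sub_left_sq_le i n (xm_mem G i))
      exact mul_le_mul_of_nonneg_right (h.regime.ell_mem i).2 h3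
    have : mass G ddv i n = ∫ x in G.xm i..G.xp i, ‖ddv i n x‖ ^ 2 := rfl
    simp only [Pi.sub_apply, ← ha]
    linarith

lemma sum_oscBound_le (h : IsControlled P G α ω v dv ddv Λ ρ J r) (i : Fin N) {I : ℕ}
    (hI : I + 2 * P.M * r + 3 * P.M ≤ J) :
    ∑ n ∈ band I, oscBound G Λ dv ddv i n ≤
      66000 * Λ ^ 11 * P.δ ^ 2 + 2 * Λ ^ 3 * massSum G ddv i I := by
  have h1 := h.energy_dv_left_le i hI
  have h0 := h.regime.pos
  have e : ∑ n ∈ band I, oscBound G Λ dv ddv i n =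
      2 * Λ ^ 2 * (energy I (fun n => dv i n (G.xm i)) + Λ * massSum G ddv i I) := by
    unfold oscBound energy massSum
    rw [← Finset.mul_sum, Finset.sum_add_distrib, ← Finset.mul_sum]
  rw [e]
  calc _ ≤ 2 * Λ ^ 2 * (33000 * Λ ^ 9 * P.δ ^ 2 + Λ * massSum G ddv i I) := by gcongr
    _ = _ := by ring

/-- The energy identity for a truncation of the harmonics. -/
lemma timeMass_step (h : IsControlled P G α ω v dv ddv Λ ρ J r) (i : Fin N) {I : ℕ}
    (hI : I + 2 * P.M * r + 3 * P.M ≤ J) :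
    Λ⁻¹ / 4 * massSum G (timeDeriv P ω v) i I ≤ 200000 * Λ ^ 14 * P.δ + Λ ^ 3 *
      (massSum G (timeDeriv P ω v) i (I + 2 * P.M) - massSum G (timeDeriv P ω v) i I) := by
  have h0 := h.regime.pos
  have hδ := P.δ_pos
  have hpq := G.xm_lt_xp i
  set q := timeDeriv P ω v with hq
  have hqc : ∀ n, Continuous (q i n) := fun n => by
    have := h.continuous_v i n
    simp only [hq]
    unfold timeDeriv
    fun_prop
  have hqc' : ∀ n, Continuous fun x => (starRingEnd ℂ) (q i n x) :=
    fun n => Complex.continuous_conj.comp (hqc n)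
  have hcc : ∀ n, Continuous fun x => conv P.M (P.kHat i) (fun m => q i m x) n := fun n => by
    unfold conv
    fun_prop
  -- coercivity, integrated over the resonator
  have hco : Λ⁻¹ / 2 * massSum G q i I ≤
      ∑ n ∈ band I, (∫ x in G.xm i..G.xp i,
        conv P.M (P.kHat i) (fun m => q i m x) n * (starRingEnd ℂ) (q i n x)).re +
      Λ ^ 2 / (2 * Λ⁻¹) * (massSum G q i (I + 2 * P.M) - massSum G q i I) := by
    have hint : ∑ n ∈ band I, (∫ x in G.xm i..G.xp i,
        conv P.M (P.kHat i) (fun m => q i m x) n * (starRingEnd ℂ) (q i n x)).re =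
        ∫ x in G.xm i..G.xp i, (∑ n ∈ band I,
          conv P.M (P.kHat i) (fun m => q i m x) n * (starRingEnd ℂ) (q i n x)).re := by
      have e1 : ∀ x, (∑ n ∈ band I,
          conv P.M (P.kHat i) (fun m => q i m x) n * (starRingEnd ℂ) (q i n x)).re =
          ∑ n ∈ band I,
          (conv P.M (P.kHat i) (fun m => q i m x) n * (starRingEnd ℂ) (q i n x)).re :=
        fun x => Complex.re_sum _ _
      simp_rw [e1]
      rw [intervalIntegral.integral_finsetSum
        (f := fun n x => (conv P.M (P.kHat i) (fun m => q i m x) n *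
          (starRingEnd ℂ) (q i n x)).re) fun n _ =>
        (Complex.continuous_re.comp ((hcc n).mul (hqc' n))).intervalIntegrable _ _]
      refine Finset.sum_congr rfl fun n _ => ?_
      exact (intervalIntegral.intervalIntegral_re
        (((hcc n).mul (hqc' n)).intervalIntegrable _ _)).symm
    rw [massSum_eq_integral G i hqc, massSum_eq_integral G i hqc, hint,
      ← intervalIntegral.integral_sub (Continuous.intervalIntegrable (by unfold energy; fun_prop) _ _)
        (Continuous.intervalIntegrable (by unfold energy; fun_prop) _ _),
      ← intervalIntegral.integral_const_mul, ← intervalIntegral.integral_const_mul,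
      ← intervalIntegral.integral_add]
    · refine intervalIntegral.integral_mono_on hpq.le
        (Continuous.intervalIntegrable (by unfold energy; fun_prop) _ _)
        (Continuous.intervalIntegrable ?_ _ _) fun x _ => ?_
      · have : Continuous fun x => (∑ n ∈ band I,
          conv P.M (P.kHat i) (fun m => q i m x) n * (starRingEnd ℂ) (q i n x)).re :=
          Complex.continuous_re.comp (continuous_finsetSum _ fun n _ => (hcc n).mul (hqc' n))
        unfold energy
        fun_prop
      · exact energy_le_re_inner P.Ω_pos (fun t => (h.regime.symbol_κ i t).2.2) (by positivity)
          (fun t => (h.regime.symbol_κ i t).1) (fun t => (h.regime.symbol_κ i t).2.1) I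
          (fun n => q i n x)
    · exact (Complex.continuous_re.comp
        (continuous_finsetSum _ fun n _ => (hcc n).mul (hqc' n))).intervalIntegrable _ _
    · exact Continuous.intervalIntegrable (by unfold energy; fun_prop) _ _
  -- the bilinear form is a boundary term plus small terms, by the equation in the resonator
  have hform : ∀ n, (∫ x in G.xm i..G.xp i,
      conv P.M (P.kHat i) (fun m => q i m x) n * (starRingEnd ℂ) (q i n x)).re ≤
      Λ ^ 2 * ‖∫ x in G.xm i..G.xp i, ddv i n x * (starRingEnd ℂ) (v i n x)‖ := by
    intro n
    refine (Complex.re_le_norm _).trans ?_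
    by_cases hw : P.freq ω n = 0
    · have : ∀ x, q i n x = 0 := fun x => by simp [hq, timeDeriv, hw]
      simp only [this, map_zero, mul_zero, intervalIntegral.integral_zero, norm_zero]
      positivity
    · have e : ∫ x in G.xm i..G.xp i,
          conv P.M (P.kHat i) (fun m => q i m x) n * (starRingEnd ℂ) (q i n x) =
          (-(P.vr : ℂ) ^ 2 * (starRingEnd ℂ) (P.freq ω n) / P.freq ω n) *
          ∫ x in G.xm i..G.xp i, ddv i n x * (starRingEnd ℂ) (v i n x) := by
        rw [← intervalIntegral.integral_const_mul]
        refine intervalIntegral.integral_congr fun x hx => ?_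
        rw [uIcc_of_le hpq.le] at hx
        have h1 := h.modes.resonator i n x hx
        have h2 : conv P.M (P.kHat i) (fun m => q i m x) n =
            -(P.vr : ℂ) ^ 2 * ddv i n x / P.freq ω n := by
          rw [eq_div_iff hw, neg_mul, h1]
          simp only [hq, timeDeriv]
          ring
        rw [h2]
        simp only [hq, timeDeriv, map_mul]
        ring
      rw [e, norm_mul, norm_div, norm_mul, norm_neg, norm_pow, RCLike.norm_conj,
        Complex.norm_real, mul_div_assoc, div_self (norm_ne_zero_iff.2 hw), mul_one,
        Real.norm_of_nonneg (h.regime.inv_mem h.regime.vr_mem).1.le]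
      have hv1 := (h.regime.inv_mem h.regime.vr_mem).1
      have hv2 := h.regime.vr_mem.2
      gcongr
  have hY := h.ddvMass_le i (I := I) (by omega)
  have hY' : massSum G ddv i I ≤ Λ ^ 6 * ρ ^ 2 * massSum G q i (I + 2 * P.M) :=
    hY.trans (mul_le_mul_of_nonneg_left (massSum_mono G _ i (by omega)) (by positivity))
  have hsum : ∑ n ∈ band I, (∫ x in G.xm i..G.xp i,
        conv P.M (P.kHat i) (fun m => q i m x) n * (starRingEnd ℂ) (q i n x)).re ≤
      Λ ^ 2 * (P.δ⁻¹ * (33000 * Λ ^ 9 * P.δ ^ 2 + 33000 * Λ ^ 9 * P.δ ^ 2) +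
        P.δ * (1000 * Λ ^ 3) + (massSum G ddv i I +
        Λ * (66000 * Λ ^ 11 * P.δ ^ 2 + 2 * Λ ^ 3 * massSum G ddv i I)) / 2) := by
    have h1 := h.energy_dv_left_le i hI
    have h2 := h.energy_dv_right_le i hI
    have h3 := (h.energy_trace_le i (I := I) (by omega) (xm_mem G i)).1
    have h4 := h.sum_oscBound_le i hI
    calc _ ≤ ∑ n ∈ band I, Λ ^ 2 * (P.δ⁻¹ * (‖dv i n (G.xp i)‖ ^ 2 + ‖dv i n (G.xm i)‖ ^ 2) +
          P.δ * ‖v i n (G.xm i)‖ ^ 2 + (mass G ddv i n + Λ * oscBound G Λ dv ddv i n) / 2) :=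
          Finset.sum_le_sum fun n _ => (hform n).trans
            (mul_le_mul_of_nonneg_left (h.norm_integral_ddv_mul_conj_le i n) (by positivity))
      _ = Λ ^ 2 * (P.δ⁻¹ * (energy I (fun n => dv i n (G.xp i)) +
          energy I (fun n => dv i n (G.xm i))) + P.δ * energy I (fun n => v i n (G.xm i)) +
          (massSum G ddv i I + Λ * ∑ n ∈ band I, oscBound G Λ dv ddv i n) / 2) := by
          unfold energy massSum
          simp only [← Finset.mul_sum, Finset.sum_add_distrib, ← Finset.sum_div]
      _ ≤ _ := by gcongr
  set Z := massSum G q i I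
  set Z' := massSum G q i (I + 2 * P.M) with hZ'
  set Y := massSum G ddv i I
  have hZ0 : 0 ≤ Z := massSum_nonneg G q i I
  have hZZ : Z ≤ Z' := massSum_mono G q i (by omega)
  have hY0 : 0 ≤ Y := massSum_nonneg G ddv i I
  have hδ1 := h.δ_le
  have hbound : Λ ^ 2 * (P.δ⁻¹ * (33000 * Λ ^ 9 * P.δ ^ 2 + 33000 * Λ ^ 9 * P.δ ^ 2) +
        P.δ * (1000 * Λ ^ 3) + (Y + Λ * (66000 * Λ ^ 11 * P.δ ^ 2 + 2 * Λ ^ 3 * Y)) / 2) ≤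
      200000 * Λ ^ 14 * P.δ + 2 * Λ ^ 12 * ρ ^ 2 * Z' := by
    have e : Λ ^ 2 * (P.δ⁻¹ * (33000 * Λ ^ 9 * P.δ ^ 2 + 33000 * Λ ^ 9 * P.δ ^ 2) +
        P.δ * (1000 * Λ ^ 3) + (Y + Λ * (66000 * Λ ^ 11 * P.δ ^ 2 + 2 * Λ ^ 3 * Y)) / 2) =
        66000 * Λ ^ 11 * P.δ + 1000 * Λ ^ 5 * P.δ + 33000 * Λ ^ 14 * P.δ * P.δ +
        (Λ ^ 2 / 2 + Λ ^ 6) * Y := by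
      field_simp
      ring
    rw [e]
    have p1 : 66000 * Λ ^ 11 * P.δ ≤ 66000 * Λ ^ 14 * P.δ := by
      gcongr
      exacts [h.regime.one_le, by norm_num]
    have p2 : 1000 * Λ ^ 5 * P.δ ≤ 1000 * Λ ^ 14 * P.δ := by
      gcongr
      exacts [h.regime.one_le, by norm_num]
    have p3 : 33000 * Λ ^ 14 * P.δ * P.δ ≤ 33000 * Λ ^ 14 * P.δ * 1 := by gcongr
    have p4 : Λ ^ 2 ≤ Λ ^ 6 := h.one_le_pow (by norm_num)
    have p5 : (Λ ^ 2 / 2 + Λ ^ 6) * Y ≤ (2 * Λ ^ 6) * (Λ ^ 6 * ρ ^ 2 * Z') := by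
      gcongr
      have : 0 ≤ Λ ^ 6 := by positivity
      linarith
    have p6 : 0 ≤ Λ ^ 14 * P.δ := by positivity
    nlinarith
  have hsmall : 2 * Λ ^ 12 * ρ ^ 2 ≤ Λ⁻¹ / 4 := by
    have := h.ρ_small
    rw [le_div_iff₀ (by norm_num), ← one_div, le_div_iff₀ h0]
    calc _ = 8 * Λ ^ 13 * ρ ^ 2 := by ring
      _ ≤ 1 := this
  have hΛ3 : Λ ^ 2 / (2 * Λ⁻¹) = Λ ^ 3 / 2 := by
    field_simp
  rw [hΛ3] at hco
  have h13 : Λ⁻¹ / 4 ≤ Λ ^ 3 / 2 := by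
    have : Λ⁻¹ ≤ 1 := inv_le_one_of_one_le₀ h.regime.one_le
    have := h.one_le_pow' 3
    linarith
  have hfin : 2 * Λ ^ 12 * ρ ^ 2 * Z' ≤ Λ⁻¹ / 4 * Z + Λ ^ 3 / 2 * (Z' - Z) := by
    have e : Z' = Z + (Z' - Z) := by ring
    calc 2 * Λ ^ 12 * ρ ^ 2 * Z' ≤ Λ⁻¹ / 4 * Z' := by gcongr; linarith
      _ = Λ⁻¹ / 4 * Z + Λ⁻¹ / 4 * (Z' - Z) := by ring
      _ ≤ _ := by
        have : 0 ≤ Z' - Z := by linarith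
        gcongr
  linarith

/-- The time derivatives of the truncated harmonics are of order `√δ`. -/
lemma timeMass_le_δ (h : IsControlled P G α ω v dv ddv Λ ρ J r) (i : Fin N) {I : ℕ}
    (hI : I + 4 * P.M * r + 5 * P.M ≤ J) :
    massSum G (timeDeriv P ω v) i I ≤ 1000000 * Λ ^ 15 * P.δ := by
  have h0 := h.regime.pos
  have hδ := P.δ_pos
  have key := le_of_increment_bound (E := fun I => massSum G (timeDeriv P ω v) i I)
    (c := Λ⁻¹ / 4) (C := Λ ^ 3) (B := 200000 * Λ ^ 14 * P.δ)
    (by positivity) (by positivity) (by positivity) (2 * P.M) r I fun j hj => by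
      have hjr : P.M * (j + 1) ≤ P.M * r := Nat.mul_le_mul_left _ hj
      have := h.timeMass_step i (I := I + 2 * P.M * j) (by nlinarith)
      have e : I + 2 * P.M * j + 2 * P.M = I + 2 * P.M * (j + 1) := by ring
      rwa [e] at this
  have hlast := h.timeMass_le i (I := I + 2 * P.M * r) (by nlinarith)
  have hρ1 : ρ ^ 2 ≤ 1 := by
    have := h.ρ_sq_le (a := 0) (by norm_num)
    nlinarith [sq_nonneg ρ]
  have hrate : Λ ^ 3 / (Λ⁻¹ / 4 + Λ ^ 3) = decayRate Λ := by
    unfold decayRate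
    field_simp
  rw [hrate] at key
  have hd := h.decay
  have h15 := h.one_le_pow' 15
  have hδ1 := h.δ_le
  calc _ ≤ _ := key
    _ ≤ 200000 * Λ ^ 14 * P.δ / (Λ⁻¹ / 4) + P.δ ^ 2 * 1 := by
      gcongr
      · exact massSum_nonneg G _ i _
      · exact hlast.trans hρ1
    _ = 800000 * Λ ^ 15 * P.δ + P.δ * P.δ := by
      field_simp
      ring
    _ ≤ 800000 * Λ ^ 15 * P.δ + Λ ^ 15 * P.δ := by
      gcongr
      linarith
    _ ≤ _ := by
      have : 0 ≤ Λ ^ 15 * P.δ := by positivity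
      linarith

end IsControlled

end Estimates

/-! ### The spatial means of the harmonics solve the limiting equation approximately -/

section Means

variable {N : ℕ}

/-- The mean of a harmonic over the `i`-th resonator. -/
def meanValue (G : Geometry N) (v : Fin N → ℤ → ℝ → ℂ) (i : Fin N) (n : ℤ) : ℂ :=
  (G.ell i : ℂ)⁻¹ * ∫ x in G.xm i..G.xp i, v i n x

lemma norm_meanValue_sq_le (G : Geometry N) {v : Fin N → ℤ → ℝ → ℂ} (i : Fin N) (n : ℤ)
    (hv : Continuous (v i n)) : ‖meanValue G v i n‖ ^ 2 ≤ (G.ell i)⁻¹ * mass G v i n := by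
  have h1 := norm_sq_integral_le hv (G.xm_lt_xp i)
  have h0 := G.ell_pos i
  rw [meanValue, norm_mul, norm_inv, Complex.norm_real, Real.norm_of_nonneg h0.le, mul_pow]
  change ‖∫ x in G.xm i..G.xp i, v i n x‖ ^ 2 ≤ G.ell i * mass G v i n at h1
  calc _ ≤ (G.ell i)⁻¹ ^ 2 * (G.ell i * mass G v i n) := by gcongr
    _ = _ := by field_simp

lemma conv_sub (M : ℕ) (h f g : ℤ → ℂ) (n : ℤ) :
    conv M h (fun m => f m - g m) n = conv M h f n - conv M h g n := by
  simp [conv, mul_sub]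

lemma conv_const_mul (M : ℕ) (h : ℤ → ℂ) (c : ℂ) (f : ℤ → ℂ) (n : ℤ) :
    conv M h (fun m => c * f m) n = c * conv M h f n := by
  unfold conv
  rw [Finset.mul_sum]
  exact Finset.sum_congr rfl fun m _ => by ring

/-- The values of the outer fields at the resonators which correspond to the mean values. -/
def outerMean (P : Medium N) (G : Geometry N) (v : Fin N → ℤ → ℝ → ℂ) (j : Fin N) (n : ℤ) : ℂ :=
  conv P.M (P.sHat j) (meanValue G v j) n

/-- The rescaled jump of the inner flux across the `i`-th resonator. -/
def fluxJump (P : Medium N) (G : Geometry N) (dv : Fin N → ℤ → ℝ → ℂ) (i : Fin N) (n : ℤ) : ℂ :=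
  (P.δ : ℂ)⁻¹ * (dv i n (G.xp i) - dv i n (G.xm i))

/-- The error made when the outer flux is computed from the capacitance matrix. -/
def fluxError (P : Medium N) (G : Geometry N) (α : ℝ) (v dv : Fin N → ℤ → ℝ → ℂ) (i : Fin N)
    (n : ℤ) : ℂ :=
  conv P.M (P.sHat i) (fluxJump P G dv i) n + ∑ j, G.capacitance α i j * outerMean P G v j n

lemma sq_sum_eight_le (a b c d e f g h : ℝ) :
    (a + b + c + d + e + f + g + h) ^ 2 ≤
      8 * (a ^ 2 + b ^ 2 + c ^ 2 + d ^ 2 + e ^ 2 + f ^ 2 + g ^ 2 + h ^ 2) := by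
  have h1 := sq_add_le (a + b + c + d) (e + f + g + h)
  have h2 := sq_add_le (a + b) (c + d)
  have h3 := sq_add_le (e + f) (g + h)
  have h4 := sq_add_le a b
  have h5 := sq_add_le c d
  have h6 := sq_add_le e f
  have h7 := sq_add_le g h
  have e1 : a + b + c + d + e + f + g + h = (a + b + c + d) + (e + f + g + h) := by ring
  have e2 : a + b + c + d = (a + b) + (c + d) := by ring
  have e3 : e + f + g + h = (e + f) + (g + h) := by ring
  rw [e1]
  rw [e2, e3] at *
  linarith

namespace IsControlled

variable {P : Medium N} {G : Geometry N} {α : ℝ} {ω : ℂ} {v dv ddv : Fin N → ℤ → ℝ → ℂ}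
  {Λ ρ : ℝ} {J r : ℕ}

lemma oscBound_nonneg (h : IsControlled P G α ω v dv ddv Λ ρ J r) (i : Fin N) (n : ℤ) :
    0 ≤ oscBound G Λ dv ddv i n :=
  (sq_nonneg _).trans (h.norm_sub_left_sq_le i n (xm_mem G i))

lemma norm_meanValue_sub_left_le (h : IsControlled P G α ω v dv ddv Λ ρ J r) (i : Fin N) (n : ℤ) :
    ‖meanValue G v i n - v i n (G.xm i)‖ ^ 2 ≤ oscBound G Λ dv ddv i n := by
  have h0 := G.ell_pos i
  have hv := h.continuous_v i n
  have hl : (G.ell i : ℂ) ≠ 0 := by exact_mod_cast h0.ne'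
  have e : meanValue G v i n - v i n (G.xm i) =
      (G.ell i : ℂ)⁻¹ * ∫ x in G.xm i..G.xp i, (v i n x - v i n (G.xm i)) := by
    rw [intervalIntegral.integral_sub (Continuous.intervalIntegrable (by fun_prop) _ _)
      (by simp), intervalIntegral.integral_const, Complex.real_smul, meanValue]
    change _ = (G.ell i : ℂ)⁻¹ * (_ - (G.ell i : ℂ) * _)
    field_simp
  have h1 : ‖∫ x in G.xm i..G.xp i, (v i n x - v i n (G.xm i))‖ ≤
      √(oscBound G Λ dv ddv i n) * |G.xp i - G.xm i| := by
    refine intervalIntegral.norm_integral_le_of_norm_le_const fun x hx => ?_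
    rw [uIoc_of_le (G.xm_lt_xp i).le] at hx
    exact Real.le_sqrt_of_sq_le (h.norm_sub_left_sq_le i n (Ioc_subset_Icc_self hx))
  rw [abs_of_pos (sub_pos.2 (G.xm_lt_xp i))] at h1
  have h2 : ‖meanValue G v i n - v i n (G.xm i)‖ ≤ √(oscBound G Λ dv ddv i n) := by
    rw [e, norm_mul, norm_inv, Complex.norm_real, Real.norm_of_nonneg h0.le, inv_mul_le_iff₀ h0,
      mul_comm]
    exact h1
  calc _ ≤ √(oscBound G Λ dv ddv i n) ^ 2 := by gcongr
    _ = _ := Real.sq_sqrt (h.oscBound_nonneg i n)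

lemma norm_sub_meanValue_le (h : IsControlled P G α ω v dv ddv Λ ρ J r) (i : Fin N) (n : ℤ)
    {x : ℝ} (hx : x ∈ Icc (G.xm i) (G.xp i)) :
    ‖v i n x - meanValue G v i n‖ ^ 2 ≤ 4 * oscBound G Λ dv ddv i n := by
  have h1 := h.norm_meanValue_sub_left_le i n
  have h2 := h.norm_sub_left_sq_le i n hx
  have h3 : ‖v i n x - meanValue G v i n‖ ≤
      ‖v i n x - v i n (G.xm i)‖ + ‖meanValue G v i n - v i n (G.xm i)‖ := by
    have e : v i n x - meanValue G v i n =
      (v i n x - v i n (G.xm i)) - (meanValue G v i n - v i n (G.xm i)) := by ring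
    rw [e]
    exact norm_sub_le _ _
  calc _ ≤ (‖v i n x - v i n (G.xm i)‖ + ‖meanValue G v i n - v i n (G.xm i)‖) ^ 2 := by gcongr
    _ ≤ 2 * (_ + _) := sq_add_le _ _
    _ ≤ _ := by linarith

lemma sum_oscBound_le_δ (h : IsControlled P G α ω v dv ddv Λ ρ J r) (i : Fin N) {I : ℕ}
    (hI : I + 4 * P.M * r + 6 * P.M ≤ J) :
    ∑ n ∈ band I, oscBound G Λ dv ddv i n ≤ 3000000 * Λ ^ 18 * P.δ := by
  have h0 := h.regime.pos
  have hδ := P.δ_pos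
  have hδ1 := h.δ_le
  have h1 := h.sum_oscBound_le i (I := I) (by nlinarith)
  have h2 := h.ddvMass_le i (I := I) (by omega)
  have h3 := h.timeMass_le_δ i (I := I + P.M) (by omega)
  have h4 := h.ρ_sq_le (a := 6) (by norm_num)
  have h5 : massSum G ddv i I ≤ 1000000 * Λ ^ 15 * P.δ := by
    refine h2.trans ?_
    calc _ ≤ 1 * massSum G (timeDeriv P ω v) i (I + P.M) := by
          gcongr
          · exact massSum_nonneg G _ i _
          · nlinarith [sq_nonneg ρ, pow_pos h0 6, mul_nonneg (pow_pos h0 6).le (sq_nonneg ρ)]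
      _ ≤ _ := by rw [one_mul]; exact h3
  have h6 : Λ ^ 11 * P.δ ^ 2 ≤ Λ ^ 18 * P.δ := by
    have : P.δ ^ 2 ≤ P.δ := by nlinarith
    have := h.one_le_pow (show 11 ≤ 18 by norm_num)
    gcongr
  have h7 : 2 * Λ ^ 3 * massSum G ddv i I ≤ 2 * Λ ^ 3 * (1000000 * Λ ^ 15 * P.δ) := by gcongr
  have h8 : 0 ≤ Λ ^ 18 * P.δ := by positivity
  nlinarith

lemma energy_outer_sub_le (h : IsControlled P G α ω v dv ddv Λ ρ J r) (i : Fin N) {I : ℕ}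
    (hI : I + 4 * P.M * r + 7 * P.M ≤ J) {x : ℝ} (hx : x ∈ Icc (G.xm i) (G.xp i)) :
    energy I (fun n => conv P.M (P.sHat i) (fun n => v i n x) n - outerMean P G v i n) ≤
      12000000 * Λ ^ 20 * P.δ := by
  have h0 := h.regime.pos
  unfold outerMean
  simp_rw [← conv_sub]
  have h1 := energy_conv_le P.Ω_pos (fun t => (h.regime.symbol_s i t).2) I
    (fun n => v i n x - meanValue G v i n)
  have h2 : energy (I + P.M) (fun n => v i n x - meanValue G v i n) ≤
      4 * (3000000 * Λ ^ 18 * P.δ) := by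
    refine le_trans ?_ (mul_le_mul_of_nonneg_left
      (h.sum_oscBound_le_δ i (I := I + P.M) (by omega)) (by norm_num))
    unfold energy
    rw [Finset.mul_sum]
    exact Finset.sum_le_sum fun n _ => h.norm_sub_meanValue_le i n hx
  calc _ ≤ _ := h1
    _ ≤ Λ ^ 2 * (4 * (3000000 * Λ ^ 18 * P.δ)) := by gcongr
    _ = _ := by ring

lemma _root_.SpaceTimeResonators.InRegime.norm_div_gap_le (h : InRegime P G Λ) {d : ℝ} (hd : d ∈ Icc Λ⁻¹ Λ)
    (z : ℂ) : ‖z / d‖ ≤ Λ * ‖z‖ := by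
  have h1 := h.inv_mem hd
  rw [norm_div, Complex.norm_real, Real.norm_of_nonneg h1.1.le, div_eq_mul_inv, mul_comm]
  exact mul_le_mul_of_nonneg_right h1.2.2 (norm_nonneg _)

/-- The outer flux of the low harmonics is given by the capacitance matrix, up to small errors. -/
lemma energy_fluxError_le (h : IsControlled P G α ω v dv ddv Λ ρ J r) (i : Fin N) {I : ℕ}
    (hI : I + 4 * P.M * r + 7 * P.M ≤ J) :
    energy I (fluxError P G α v dv i) ≤ 1000000000 * Λ ^ 22 * (ρ ^ 2 + P.δ) := by
  have h0 := h.regime.pos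
  have hδ := P.δ_pos
  set l := G.leftNbr i with hl
  set k := G.rightNbr i with hk
  set bm : Fin N → ℤ → ℂ := fun j => conv P.M (P.sHat j) (fun n => v j n (G.xm j)) with hbm
  set bp : Fin N → ℤ → ℂ := fun j => conv P.M (P.sHat j) (fun n => v j n (G.xp j)) with hbp
  set β := outerMean P G v with hβ
  set ε := 4 * Λ ^ 3 * ρ ^ 2 with hε
  have hpt : ∀ n ∈ band I, ‖fluxError P G α v dv i n‖ ^ 2 ≤
      8 * (ε ^ 2 * (‖bm i n‖ ^ 2 + ‖bp l n‖ ^ 2 + ‖bp i n‖ ^ 2 + ‖bm k n‖ ^ 2) +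
        Λ ^ 2 * (‖bm i n - β i n‖ ^ 2 + ‖bp l n - β l n‖ ^ 2 + ‖bp i n - β i n‖ ^ 2 +
          ‖bm k n - β k n‖ ^ 2)) := by
    intro n hn
    have hnJ : n ∈ band J := band_mono (by omega) hn
    have h1 := h.left_flux i hnJ
    have h2 := h.right_flux i hnJ
    change ‖_ - (bm i n - G.leftPhase α i * bp l n) / G.leftGap i‖ ≤
      ε * (‖bm i n‖ + ‖bp l n‖) at h1
    change ‖_ - (G.rightPhase α i * bm k n - bp i n) / G.rightGap i‖ ≤
      ε * (‖bp i n‖ + ‖bm k n‖) at h2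
    have e : fluxError P G α v dv i n =
        ((P.δ : ℂ)⁻¹ * conv P.M (P.sHat i) (fun l => dv i l (G.xp i)) n -
          (G.rightPhase α i * bm k n - bp i n) / G.rightGap i) -
        ((P.δ : ℂ)⁻¹ * conv P.M (P.sHat i) (fun l => dv i l (G.xm i)) n -
          (bm i n - G.leftPhase α i * bp l n) / G.leftGap i) +
        (G.rightPhase α i * (bm k n - β k n) - (bp i n - β i n)) / G.rightGap i -
        ((bm i n - β i n) - G.leftPhase α i * (bp l n - β l n)) / G.leftGap i := by
      unfold fluxError fluxJump
      rw [G.sum_capacitance_mul α i (fun j => outerMean P G v j n), conv_const_mul, conv_sub]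
      ring
    have h3 := h.regime.norm_div_gap_le (h.regime.rightGap_mem i)
      (G.rightPhase α i * (bm k n - β k n) - (bp i n - β i n))
    have h4 := h.regime.norm_div_gap_le (h.regime.leftGap_mem i)
      ((bm i n - β i n) - G.leftPhase α i * (bp l n - β l n))
    have h5 : ‖G.rightPhase α i * (bm k n - β k n) - (bp i n - β i n)‖ ≤
        ‖bm k n - β k n‖ + ‖bp i n - β i n‖ := by
      refine (norm_sub_le _ _).trans ?_
      rw [norm_mul, G.norm_rightPhase, one_mul]
    have h6 : ‖(bm i n - β i n) - G.leftPhase α i * (bp l n - β l n)‖ ≤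
        ‖bm i n - β i n‖ + ‖bp l n - β l n‖ := by
      refine (norm_sub_le _ _).trans ?_
      rw [norm_mul, G.norm_leftPhase, one_mul]
    have h7 : ‖fluxError P G α v dv i n‖ ≤ ε * ‖bm i n‖ + ε * ‖bp l n‖ + ε * ‖bp i n‖ +
        ε * ‖bm k n‖ + Λ * ‖bm i n - β i n‖ + Λ * ‖bp l n - β l n‖ + Λ * ‖bp i n - β i n‖ +
        Λ * ‖bm k n - β k n‖ := by
      rw [e]
      refine (norm_sub_le _ _).trans ?_
      refine (add_le_add_left ((norm_add_le _ _).trans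
        (add_le_add_left (norm_sub_le _ _) _)) _).trans ?_
      have h8 := mul_le_mul_of_nonneg_left h5 h0.le
      have h9 := mul_le_mul_of_nonneg_left h6 h0.le
      linarith
    calc _ ≤ (_ : ℝ) ^ 2 := by gcongr
      _ ≤ _ := sq_sum_eight_le _ _ _ _ _ _ _ _
      _ = _ := by ring
  have b1 := h.energy_outer_le i (I := I) (by nlinarith) (xm_mem G i)
  have b2 := h.energy_outer_le l (I := I) (by nlinarith) (xp_mem G l)
  have b3 := h.energy_outer_le i (I := I) (by nlinarith) (xp_mem G i)
  have b4 := h.energy_outer_le k (I := I) (by nlinarith) (xm_mem G k)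
  have d1 := h.energy_outer_sub_le i hI (xm_mem G i)
  have d2 := h.energy_outer_sub_le l hI (xp_mem G l)
  have d3 := h.energy_outer_sub_le i hI (xp_mem G i)
  have d4 := h.energy_outer_sub_le k hI (xm_mem G k)
  have hsum : energy I (fluxError P G α v dv i) ≤
      8 * (ε ^ 2 * (1000 * Λ ^ 5 + 1000 * Λ ^ 5 + 1000 * Λ ^ 5 + 1000 * Λ ^ 5) +
        Λ ^ 2 * (12000000 * Λ ^ 20 * P.δ + 12000000 * Λ ^ 20 * P.δ + 12000000 * Λ ^ 20 * P.δ +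
          12000000 * Λ ^ 20 * P.δ)) := by
    refine (Finset.sum_le_sum hpt).trans ?_
    simp only [← Finset.mul_sum, Finset.sum_add_distrib]
    unfold energy at b1 b2 b3 b4 d1 d2 d3 d4
    gcongr
  refine hsum.trans ?_
  have h13 := h.ρ_sq_le (a := 0) (by norm_num)
  have hε2 : ε ^ 2 ≤ 16 * Λ ^ 6 * ρ ^ 2 := by
    have : ε ^ 2 = 16 * Λ ^ 6 * ρ ^ 2 * ρ ^ 2 := by rw [hε]; ring
    rw [this]
    have : ρ ^ 2 ≤ 1 := by nlinarith [sq_nonneg ρ]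
    exact mul_le_of_le_one_right (by positivity) this
  have hp := h.one_le_pow (show 11 ≤ 22 by norm_num)
  calc _ ≤ 8 * (16 * Λ ^ 6 * ρ ^ 2 * (1000 * Λ ^ 5 + 1000 * Λ ^ 5 + 1000 * Λ ^ 5 + 1000 * Λ ^ 5) +
        Λ ^ 2 * (12000000 * Λ ^ 20 * P.δ + 12000000 * Λ ^ 20 * P.δ + 12000000 * Λ ^ 20 * P.δ +
          12000000 * Λ ^ 20 * P.δ)) := by gcongr
    _ = 512000 * Λ ^ 11 * ρ ^ 2 + 384000000 * Λ ^ 22 * P.δ := by ring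
    _ ≤ 512000 * Λ ^ 22 * ρ ^ 2 + 384000000 * Λ ^ 22 * P.δ := by gcongr
    _ ≤ _ := by
      have e1 : 0 ≤ Λ ^ 22 * ρ ^ 2 := by positivity
      have e2 : 0 ≤ Λ ^ 22 * P.δ := by positivity
      linarith

/-- A truncation at which the controlled quantities change little across the window of coupled
harmonics. -/
lemma exists_good_truncation (h : IsControlled P G α ω v dv ddv Λ ρ J r) (hr : 0 < r) {K : ℕ}
    (hK : K + 6 * P.M * r + 5 * P.M ≤ J) :
    ∃ I, K ≤ I ∧ I + 2 * P.M ≤ K + 2 * P.M * r ∧ ∀ i,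
      (energy (I + 2 * P.M) (fun n => dv i n (G.xm i)) - energy I (fun n => dv i n (G.xm i)) +
        (energy (I + 2 * P.M) (fun n => dv i n (G.xp i)) - energy I (fun n => dv i n (G.xp i))) ≤
        P.δ ^ 2 * (2000000 * N * Λ ^ 15 / r)) ∧
      (massSum G (timeDeriv P ω v) i (I + 2 * P.M) - massSum G (timeDeriv P ω v) i I ≤
        P.δ * (2000000 * N * Λ ^ 15 / r)) ∧
      (massSum G v i (I + 2 * P.M) - massSum G v i I ≤ 2000000 * N * Λ ^ 15 / r) := by
  have h0 := h.regime.pos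
  have hδ := P.δ_pos
  set s : Fin N → ℕ → ℝ := fun i I =>
    (P.δ ^ 2)⁻¹ * (energy I (fun n => dv i n (G.xm i)) + energy I (fun n => dv i n (G.xp i))) +
      P.δ⁻¹ * massSum G (timeDeriv P ω v) i I + massSum G v i I with hs
  have hs0 : ∀ i I, 0 ≤ s i I := fun i I => by
    have h1 := energy_nonneg I (fun n => dv i n (G.xm i))
    have h2 := energy_nonneg I (fun n => dv i n (G.xp i))
    have h3 := massSum_nonneg G (timeDeriv P ω v) i I
    have h4 := massSum_nonneg G v i I
    simp only [hs]
    positivity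
  have hsA : ∀ i, s i (K + 2 * P.M * r) ≤ 2000000 * Λ ^ 15 := fun i => by
    have h1 := h.energy_dv_left_le i (I := K + 2 * P.M * r) (by nlinarith)
    have h2 := h.energy_dv_right_le i (I := K + 2 * P.M * r) (by nlinarith)
    have h3 := h.timeMass_le_δ i (I := K + 2 * P.M * r) (by nlinarith)
    have h4 := h.total i (K + 2 * P.M * r)
    have h9 := h.one_le_pow (show 9 ≤ 15 by norm_num)
    have h15 := h.one_le_pow' 15
    calc s i (K + 2 * P.M * r) ≤ (P.δ ^ 2)⁻¹ * (33000 * Λ ^ 9 * P.δ ^ 2 + 33000 * Λ ^ 9 * P.δ ^ 2) +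
          P.δ⁻¹ * (1000000 * Λ ^ 15 * P.δ) + 1 := by
          simp only [hs]
          gcongr
      _ = 66000 * Λ ^ 9 + 1000000 * Λ ^ 15 + 1 := by
          field_simp
          ring
      _ ≤ _ := by linarith
  have hmono : ∀ i {I I' : ℕ}, I ≤ I' →
      (0 ≤ energy I' (fun n => dv i n (G.xm i)) - energy I (fun n => dv i n (G.xm i))) ∧
      (0 ≤ energy I' (fun n => dv i n (G.xp i)) - energy I (fun n => dv i n (G.xp i))) ∧
      (0 ≤ massSum G (timeDeriv P ω v) i I' - massSum G (timeDeriv P ω v) i I) ∧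
      (0 ≤ massSum G v i I' - massSum G v i I) := fun i I I' hI =>
    ⟨sub_nonneg.2 (energy_mono hI _), sub_nonneg.2 (energy_mono hI _),
      sub_nonneg.2 (massSum_mono G _ i hI), sub_nonneg.2 (massSum_mono G _ i hI)⟩
  obtain ⟨j, hj, hle⟩ := exists_small_increment (S := fun I => ∑ i, s i I)
    (A := 2000000 * N * Λ ^ 15) (2 * P.M) r K hr (Finset.sum_nonneg fun i _ => hs0 i K) (by
      calc ∑ i, s i (K + 2 * P.M * r) ≤ ∑ _i : Fin N, 2000000 * Λ ^ 15 :=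
            Finset.sum_le_sum fun i _ => hsA i
        _ = _ := by simp; ring)
  have hjr : P.M * (j + 1) ≤ P.M * r := Nat.mul_le_mul_left _ hj
  have e : K + 2 * P.M * (j + 1) = K + 2 * P.M * j + 2 * P.M := by ring
  refine ⟨K + 2 * P.M * j, by omega, by nlinarith, fun i => ?_⟩
  set I := K + 2 * P.M * j
  rw [e, ← Finset.sum_sub_distrib] at hle
  have hinc : ∀ i, s i (I + 2 * P.M) - s i I = (P.δ ^ 2)⁻¹ *
      ((energy (I + 2 * P.M) (fun n => dv i n (G.xm i)) - energy I (fun n => dv i n (G.xm i))) +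
      (energy (I + 2 * P.M) (fun n => dv i n (G.xp i)) - energy I (fun n => dv i n (G.xp i)))) +
      P.δ⁻¹ * (massSum G (timeDeriv P ω v) i (I + 2 * P.M) - massSum G (timeDeriv P ω v) i I) +
      (massSum G v i (I + 2 * P.M) - massSum G v i I) := fun i => by
    simp only [hs]
    ring
  have hinc0 : ∀ i, 0 ≤ s i (I + 2 * P.M) - s i I := fun i => by
    obtain ⟨m1, m2, m3, m4⟩ := hmono i (show I ≤ I + 2 * P.M by omega)
    rw [hinc]
    positivity
  have hi : s i (I + 2 * P.M) - s i I ≤ 2000000 * N * Λ ^ 15 / r :=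
    (Finset.single_le_sum (f := fun i => s i (I + 2 * P.M) - s i I)
      (fun i _ => hinc0 i) (Finset.mem_univ i)).trans hle
  obtain ⟨m1, m2, m3, m4⟩ := hmono i (show I ≤ I + 2 * P.M by omega)
  rw [hinc] at hi
  have m12 := add_nonneg m1 m2
  have k1 : 0 ≤ (P.δ ^ 2)⁻¹ *
      ((energy (I + 2 * P.M) (fun n => dv i n (G.xm i)) - energy I (fun n => dv i n (G.xm i))) +
      (energy (I + 2 * P.M) (fun n => dv i n (G.xp i)) - energy I (fun n => dv i n (G.xp i)))) :=
    mul_nonneg (by positivity) m12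
  have k2 : 0 ≤ P.δ⁻¹ *
      (massSum G (timeDeriv P ω v) i (I + 2 * P.M) - massSum G (timeDeriv P ω v) i I) :=
    mul_nonneg (by positivity) m3
  refine ⟨?_, ?_, by linarith⟩
  · rw [← inv_mul_le_iff₀ (by positivity)]
    linarith
  · rw [← inv_mul_le_iff₀ hδ]
    linarith

end IsControlled

end Means

/-! ### Truncated means form an approximate Floquet solution of the limiting equation -/

lemma msq_le_of_le_sum {Ω : ℝ} (hΩ : 0 < Ω) {κ : Type*} (s : Finset κ) {h : ℝ → ℂ}
    {g : κ → ℝ → ℂ} (hh : Continuous h) (hg : ∀ k, Continuous (g k)) {B : ℝ}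
    (hle : ∀ t, ‖h t‖ ≤ B * ∑ k ∈ s, ‖g k t‖) :
    msq Ω h ≤ B ^ 2 * s.card * ∑ k ∈ s, msq Ω (g k) := by
  unfold msq
  have := intervalIntegral.integral_mono_on (μ := MeasureTheory.volume) (two_pi_div_pos hΩ).le
    (f := fun t => ‖h t‖ ^ 2) (g := fun t => B ^ 2 * s.card * ∑ k ∈ s, ‖g k t‖ ^ 2)
    (Continuous.intervalIntegrable (by fun_prop) 0 _)
    (Continuous.intervalIntegrable (by fun_prop) _ _)
    (fun t _ => by
      calc ‖h t‖ ^ 2 ≤ (B * ∑ k ∈ s, ‖g k t‖) ^ 2 := by gcongr; exact hle t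
        _ = B ^ 2 * (∑ k ∈ s, ‖g k t‖) ^ 2 := by ring
        _ ≤ B ^ 2 * (s.card * ∑ k ∈ s, ‖g k t‖ ^ 2) := by
          gcongr
          exact sq_sum_le_card_mul_sum_sq
        _ = _ := by ring)
  rw [intervalIntegral.integral_const_mul, intervalIntegral.integral_finsetSum
    (fun k _ => Continuous.intervalIntegrable (by have := hg k; fun_prop) _ _)] at this
  rw [← Finset.mul_sum]
  calc _ ≤ Ω / (2 * Real.pi) * _ := mul_le_mul_of_nonneg_left this (by positivity)
    _ = _ := by ring

section Approximate

variable {N : ℕ}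

lemma hasDerivAt_exp_mul_trigSum (P : Medium N) (ω : ℂ) (S : Finset ℤ) (f : ℤ → ℂ) (t : ℝ) :
    HasDerivAt (fun t : ℝ => Complex.exp (Complex.I * ω * t) * trigSum P.Ω S f t)
      (Complex.exp (Complex.I * ω * t) *
        (Complex.I * trigSum P.Ω S (fun n => P.freq ω n * f n) t)) t := by
  have hexp : ∀ c : ℂ, HasDerivAt (fun t : ℝ => Complex.exp (c * t)) (c * Complex.exp (c * t)) t := by
    intro c
    have h1 : HasDerivAt (fun t : ℝ => c * (t : ℂ)) c t := by
      simpa using (Complex.ofRealCLM.hasDerivAt (x := t)).const_mul c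
    simpa [mul_comm] using h1.cexp
  have h1 : HasDerivAt (trigSum P.Ω S f)
      (∑ n ∈ S, f n * (Complex.I * n * P.Ω * Complex.exp (Complex.I * n * P.Ω * t))) t :=
    HasDerivAt.fun_sum fun n _ => (hexp _).const_mul _
  refine ((hexp (Complex.I * ω)).mul h1).congr_deriv ?_
  unfold trigSum Medium.freq
  simp only [Finset.mul_sum, ← Finset.sum_add_distrib]
  exact Finset.sum_congr rfl fun n _ => by ring

/-- The Fourier coefficients of the mean over the `i`-th resonator of `κ_i⁻¹ ∂ₜu`, up to the factor
`i`. -/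
def momentumCoeff (P : Medium N) (G : Geometry N) (ω : ℂ) (v : Fin N → ℤ → ℝ → ℂ) (i : Fin N)
    (n : ℤ) : ℂ :=
  conv P.M (P.kHat i) (fun m => P.freq ω m * meanValue G v i m) n

/-- The periodic part of the mean of the field over the `i`-th resonator, truncated. -/
def amplitude (P : Medium N) (G : Geometry N) (v : Fin N → ℤ → ℝ → ℂ) (I : ℕ) (i : Fin N) :
    ℝ → ℂ :=
  trigSum P.Ω (band I) (meanValue G v i)

/-- The periodic part of the mean of `δ^{-1/2} κ_i⁻¹ ∂ₜu` over the `i`-th resonator, truncated. -/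
def momentum (P : Medium N) (G : Geometry N) (ω : ℂ) (v : Fin N → ℤ → ℝ → ℂ) (I : ℕ) (i : Fin N)
    (t : ℝ) : ℂ :=
  Complex.I / √P.δ * trigSum P.Ω (band (I + P.M)) (momentumCoeff P G ω v i) t

/-- The error in the relation between `momentum` and the derivative of `amplitude`. -/
def amplitudeError (P : Medium N) (G : Geometry N) (ω : ℂ) (v : Fin N → ℤ → ℝ → ℂ) (I : ℕ)
    (i : Fin N) (t : ℝ) : ℂ :=
  Complex.I / √P.δ * trigSum P.Ω (band (I + P.M)) (conv P.M (P.kHat i)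
    (restrict (band (I + 2 * P.M) \ band I) fun m => P.freq ω m * meanValue G v i m)) t

/-- The error in the balance of momentum. -/
def momentumError (P : Medium N) (G : Geometry N) (α : ℝ) (v dv : Fin N → ℤ → ℝ → ℂ) (I : ℕ)
    (i : Fin N) (t : ℝ) : ℂ :=
  trigSum P.Ω (band (I + P.M)) (fluxJump P G dv i) t +
    P.s i t * ∑ j, G.capacitance α i j * (amplitude P G v I j t / P.s j t)

lemma continuous_κ_ofReal (P : Medium N) (i : Fin N) : Continuous fun t => (P.κ i t : ℂ) := by
  have h : ∀ t, (P.κ i t : ℂ) = (trigSum P.Ω (band P.M) (P.kHat i) t)⁻¹ := fun t => by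
    rw [P.hasSymbol_κ]
    simp
  simp_rw [h]
  refine (continuous_trigSum _ _ _).inv₀ fun t => ?_
  rw [P.hasSymbol_κ]
  have : (P.κ i t : ℂ) ≠ 0 := by exact_mod_cast (P.κ_pos i t).ne'
  simpa using this

lemma continuous_s_ofReal (P : Medium N) (i : Fin N) : Continuous fun t => (P.s i t : ℂ) := by
  have h : ∀ t, (P.s i t : ℂ) = (trigSum P.Ω (band P.M) (P.sHat i) t)⁻¹ := fun t => by
    rw [P.hasSymbol_s]
    simp
  simp_rw [h]
  refine (continuous_trigSum _ _ _).inv₀ fun t => ?_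
  rw [P.hasSymbol_s]
  have : (P.s i t : ℂ) ≠ 0 := by exact_mod_cast P.s_ne_zero i t
  simpa using this

lemma continuous_amplitude (P : Medium N) (G : Geometry N) (v : Fin N → ℤ → ℝ → ℂ) (I : ℕ)
    (i : Fin N) : Continuous (amplitude P G v I i) := continuous_trigSum _ _ _

lemma continuous_momentum (P : Medium N) (G : Geometry N) (ω : ℂ) (v : Fin N → ℤ → ℝ → ℂ) (I : ℕ)
    (i : Fin N) : Continuous (momentum P G ω v I i) :=
  continuous_const.mul (continuous_trigSum _ _ _)

lemma continuous_amplitudeError (P : Medium N) (G : Geometry N) (ω : ℂ) (v : Fin N → ℤ → ℝ → ℂ)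
    (I : ℕ) (i : Fin N) : Continuous (amplitudeError P G ω v I i) :=
  continuous_const.mul (continuous_trigSum _ _ _)

lemma continuous_momentumError (P : Medium N) (G : Geometry N) (α : ℝ) (v dv : Fin N → ℤ → ℝ → ℂ)
    (I : ℕ) (i : Fin N) : Continuous (momentumError P G α v dv I i) := by
  have h1 := continuous_trigSum P.Ω (band (I + P.M)) (fluxJump P G dv i)
  have h2 := continuous_s_ofReal P
  have h3 := continuous_amplitude P G v I
  have h4 : ∀ j t, (P.s j t : ℂ) ≠ 0 := fun j t => by exact_mod_cast P.s_ne_zero j t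
  refine h1.add ((h2 i).mul (continuous_finsetSum _ fun j _ => continuous_const.mul ?_))
  exact (h3 j).div (h2 j) (h4 j)

lemma hasDerivAt_amplitude (P : Medium N) (G : Geometry N) (ω : ℂ) (v : Fin N → ℤ → ℝ → ℂ) (I : ℕ)
    (i : Fin N) (t : ℝ) :
    HasDerivAt (fun t : ℝ => Complex.exp (Complex.I * ω * t) * amplitude P G v I i t)
      (√P.δ * P.κ i t * (Complex.exp (Complex.I * ω * t) *
        (momentum P G ω v I i t - amplitudeError P G ω v I i t))) t := by
  refine (hasDerivAt_exp_mul_trigSum P ω (band I) (meanValue G v i) t).congr_deriv ?_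
  have h := mul_trigSum_eq P.Ω P.M I (P.kHat i) (fun m => P.freq ω m * meanValue G v i m) t
  rw [P.hasSymbol_κ] at h
  have hκ : (P.κ i t : ℂ) ≠ 0 := by exact_mod_cast (P.κ_pos i t).ne'
  have hδ : ((√P.δ : ℝ) : ℂ) ≠ 0 := by exact_mod_cast (Real.sqrt_pos.2 P.δ_pos).ne'
  have h2 : trigSum P.Ω (band I) (fun m => P.freq ω m * meanValue G v i m) t =
      P.κ i t * (trigSum P.Ω (band (I + P.M)) (momentumCoeff P G ω v i) t -
        trigSum P.Ω (band (I + P.M)) (conv P.M (P.kHat i)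
          (restrict (band (I + 2 * P.M) \ band I) fun m => P.freq ω m * meanValue G v i m)) t) := by
    unfold momentumCoeff
    rw [← h]
    field_simp
  rw [h2]
  unfold momentum amplitudeError
  field_simp

lemma window_flux_le (P : Medium N) (G : Geometry N) {dv : Fin N → ℤ → ℝ → ℂ} {I : ℕ} {σ : ℝ} {i : Fin N}
    (hσ : energy (I + 2 * P.M) (fun n => dv i n (G.xm i)) - energy I (fun n => dv i n (G.xm i)) +
        (energy (I + 2 * P.M) (fun n => dv i n (G.xp i)) - energy I (fun n => dv i n (G.xp i))) ≤
        P.δ ^ 2 * σ) :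
    ∑ n ∈ band (I + 2 * P.M) \ band I, ‖fluxJump P G dv i n‖ ^ 2 ≤ 2 * σ := by
  have hδ := P.δ_pos
  rw [← energy_window (by omega), ← energy_window (by omega), ← Finset.sum_add_distrib] at hσ
  have key : ∀ n, ‖fluxJump P G dv i n‖ ^ 2 ≤
      2 * (P.δ ^ 2)⁻¹ * (‖dv i n (G.xm i)‖ ^ 2 + ‖dv i n (G.xp i)‖ ^ 2) := by
    intro n
    have h1 := norm_sub_le (dv i n (G.xp i)) (dv i n (G.xm i))
    have h2 := sq_add_le ‖dv i n (G.xp i)‖ ‖dv i n (G.xm i)‖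
    rw [fluxJump, norm_mul, norm_inv, Complex.norm_real, Real.norm_of_nonneg hδ.le, mul_pow,
      inv_pow]
    calc _ ≤ (P.δ ^ 2)⁻¹ * (2 * (‖dv i n (G.xp i)‖ ^ 2 + ‖dv i n (G.xm i)‖ ^ 2)) := by
          gcongr
          exact (by gcongr : _ ≤ (_ : ℝ) ^ 2).trans h2
      _ = _ := by ring
  calc _ ≤ ∑ n ∈ band (I + 2 * P.M) \ band I,
        2 * (P.δ ^ 2)⁻¹ * (‖dv i n (G.xm i)‖ ^ 2 + ‖dv i n (G.xp i)‖ ^ 2) :=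
        Finset.sum_le_sum fun n _ => key n
    _ ≤ 2 * (P.δ ^ 2)⁻¹ * (P.δ ^ 2 * σ) := by
        rw [← Finset.mul_sum]
        gcongr
    _ = _ := by field_simp

lemma window_mass (G : Geometry N) (v : Fin N → ℤ → ℝ → ℂ) (i : Fin N) {I J : ℕ} (hIJ : I ≤ J) :
    ∑ n ∈ band J \ band I, mass G v i n = massSum G v i J - massSum G v i I := by
  have := Finset.sum_sdiff (f := fun n => mass G v i n) (band_mono hIJ)
  unfold massSum
  linarith

lemma msq_const_mul (Ω : ℝ) (c : ℂ) (h : ℝ → ℂ) :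
    msq Ω (fun t => c * h t) = ‖c‖ ^ 2 * msq Ω h := by
  unfold msq
  simp_rw [norm_mul, mul_pow]
  rw [intervalIntegral.integral_const_mul]
  ring

lemma norm_I_div_sqrt_sq (P : Medium N) : ‖Complex.I / √P.δ‖ ^ 2 = P.δ⁻¹ := by
  rw [norm_div, Complex.norm_I, Complex.norm_real, Real.norm_of_nonneg (Real.sqrt_nonneg _),
    div_pow, Real.sq_sqrt P.δ_pos.le]
  simp

/-- The force on the truncated means is given by the capacitance matrix, up to the terms cut off by
the truncation and the error in the outer flux. -/
lemma momentumError_eq (P : Medium N) (G : Geometry N) (α : ℝ) (v dv : Fin N → ℤ → ℝ → ℂ) (I : ℕ)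
    (i : Fin N) (t : ℝ) :
    momentumError P G α v dv I i t =
      trigSum P.Ω (band (I + P.M) \ band I) (fluxJump P G dv i) t + P.s i t *
        (trigSum P.Ω (band (I + P.M)) (fluxError P G α v dv i) t -
          (∑ j, G.capacitance α i j * trigSum P.Ω (band (I + P.M)) (conv P.M (P.sHat j)
            (restrict (band (I + 2 * P.M) \ band I) (meanValue G v j))) t) -
          trigSum P.Ω (band (I + P.M)) (conv P.M (P.sHat i)
            (restrict (band (I + 2 * P.M) \ band I) (fluxJump P G dv i))) t) := by
  have hs : ∀ j, (P.s j t : ℂ) ≠ 0 := fun j => by exact_mod_cast P.s_ne_zero j t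
  have h1 := mul_trigSum_eq P.Ω P.M I (P.sHat i) (fluxJump P G dv i) t
  rw [P.hasSymbol_s] at h1
  have h2 : ∀ j, amplitude P G v I j t / P.s j t =
      trigSum P.Ω (band (I + P.M)) (outerMean P G v j) t -
        trigSum P.Ω (band (I + P.M)) (conv P.M (P.sHat j)
          (restrict (band (I + 2 * P.M) \ band I) (meanValue G v j))) t := by
    intro j
    have := mul_trigSum_eq P.Ω P.M I (P.sHat j) (meanValue G v j) t
    rw [P.hasSymbol_s] at this
    unfold amplitude outerMean
    rw [← this]
    ring
  have h3 : trigSum P.Ω (band (I + P.M)) (fluxError P G α v dv i) t =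
      trigSum P.Ω (band (I + P.M)) (conv P.M (P.sHat i) (fluxJump P G dv i)) t +
        ∑ j, G.capacitance α i j * trigSum P.Ω (band (I + P.M)) (outerMean P G v j) t := by
    unfold fluxError
    rw [trigSum_add]
    congr 1
    unfold trigSum
    simp only [Finset.sum_mul, Finset.mul_sum]
    rw [Finset.sum_comm]
    exact Finset.sum_congr rfl fun j _ => Finset.sum_congr rfl fun n _ => by ring
  have h4 : trigSum P.Ω (band (I + P.M)) (fluxJump P G dv i) t =
      trigSum P.Ω (band (I + P.M) \ band I) (fluxJump P G dv i) t +
        trigSum P.Ω (band I) (fluxJump P G dv i) t :=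
    (Finset.sum_sdiff (band_mono (by omega))).symm
  have h5 : trigSum P.Ω (band I) (fluxJump P G dv i) t = P.s i t *
      (1 / P.s i t * trigSum P.Ω (band I) (fluxJump P G dv i) t) := by
    have := hs i
    field_simp
  unfold momentumError
  rw [h4, h5, h1, h3]
  simp_rw [h2, mul_sub, Finset.sum_sub_distrib]
  ring

end Approximate

namespace IsControlled

variable {N : ℕ} {P : Medium N} {G : Geometry N} {α : ℝ} {ω : ℂ} {v dv ddv : Fin N → ℤ → ℝ → ℂ}
  {Λ ρ : ℝ} {J r : ℕ}

/-- Integration of the equation over a resonator. -/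
lemma freq_mul_momentumCoeff (h : IsControlled P G α ω v dv ddv Λ ρ J r) (i : Fin N) (n : ℤ) :
    P.freq ω n * momentumCoeff P G ω v i n =
      -((P.vr : ℂ) ^ 2 / G.ell i * P.δ) * fluxJump P G dv i n := by
  have hl : (G.ell i : ℂ) ≠ 0 := by exact_mod_cast (G.ell_pos i).ne'
  have hδ : (P.δ : ℂ) ≠ 0 := by exact_mod_cast P.δ_pos.ne'
  have h1 : ∫ x in G.xm i..G.xp i, ddv i n x = dv i n (G.xp i) - dv i n (G.xm i) :=
    intervalIntegral.integral_eq_sub_of_hasDerivAt (fun x _ => h.modes.hasDerivAt_dv i n x)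
      ((h.modes.continuous i n).intervalIntegrable _ _)
  have h2 : ∫ x in G.xm i..G.xp i, (P.vr : ℂ) ^ 2 * ddv i n x =
      ∫ x in G.xm i..G.xp i,
        -(P.freq ω n * conv P.M (P.kHat i) (fun m => P.freq ω m * v i m x) n) := by
    refine intervalIntegral.integral_congr fun x hx => h.modes.resonator i n x ?_
    rwa [uIcc_of_le (G.xm_lt_xp i).le] at hx
  have h3 : ∫ x in G.xm i..G.xp i, conv P.M (P.kHat i) (fun m => P.freq ω m * v i m x) n =
      G.ell i * momentumCoeff P G ω v i n := by
    unfold momentumCoeff conv meanValue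
    rw [intervalIntegral.integral_finsetSum, Finset.mul_sum]
    · refine Finset.sum_congr rfl fun m _ => ?_
      rw [intervalIntegral.integral_const_mul, intervalIntegral.integral_const_mul]
      field_simp
    · intro m _
      have := h.continuous_v i (n - m)
      exact Continuous.intervalIntegrable (by fun_prop) _ _
  rw [intervalIntegral.integral_const_mul, h1, intervalIntegral.integral_neg,
    intervalIntegral.integral_const_mul, h3] at h2
  unfold fluxJump
  field_simp
  linear_combination h2

lemma hasDerivAt_momentum (h : IsControlled P G α ω v dv ddv Λ ρ J r) (I : ℕ) (i : Fin N) (t : ℝ) :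
    HasDerivAt (fun t : ℝ => Complex.exp (Complex.I * ω * t) * momentum P G ω v I i t)
      (√P.δ * ((P.vr : ℂ) ^ 2 / G.ell i) * (Complex.exp (Complex.I * ω * t) *
        (momentumError P G α v dv I i t -
          P.s i t * ∑ j, G.capacitance α i j * (amplitude P G v I j t / P.s j t)))) t := by
  have h1 := (hasDerivAt_exp_mul_trigSum P ω (band (I + P.M)) (momentumCoeff P G ω v i) t).const_mul
    (Complex.I / √P.δ)
  have e : (fun t : ℝ => Complex.exp (Complex.I * ω * t) * momentum P G ω v I i t) = fun t : ℝ =>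
      Complex.I / √P.δ * (Complex.exp (Complex.I * ω * t) *
        trigSum P.Ω (band (I + P.M)) (momentumCoeff P G ω v i) t) := by
    funext t
    unfold momentum
    ring
  rw [e]
  refine h1.congr_deriv ?_
  simp_rw [h.freq_mul_momentumCoeff i]
  have hδ : ((√P.δ : ℝ) : ℂ) ≠ 0 := by exact_mod_cast (Real.sqrt_pos.2 P.δ_pos).ne'
  have hδ2 : (P.δ : ℂ) = ((√P.δ : ℝ) : ℂ) ^ 2 := by
    norm_cast
    exact (Real.sq_sqrt P.δ_pos.le).symm
  rw [trigSum_mul_left, hδ2, momentumError, add_sub_cancel_right]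
  field_simp
  rw [Complex.I_sq]
  ring

lemma norm_meanValue_sq_le (h : IsControlled P G α ω v dv ddv Λ ρ J r) (i : Fin N) (n : ℤ) :
    ‖meanValue G v i n‖ ^ 2 ≤ Λ * mass G v i n := by
  refine (SpaceTimeResonators.norm_meanValue_sq_le G i n (h.continuous_v i n)).trans ?_
  exact mul_le_mul_of_nonneg_right (h.regime.inv_mem (h.regime.ell_mem i)).2.2
    (mass_nonneg G v i n)

lemma norm_freq_mul_meanValue_sq_le (h : IsControlled P G α ω v dv ddv Λ ρ J r) (i : Fin N)
    (n : ℤ) :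
    ‖P.freq ω n * meanValue G v i n‖ ^ 2 ≤ Λ * mass G (timeDeriv P ω v) i n := by
  rw [mass_timeDeriv, norm_mul, mul_pow]
  calc _ ≤ ‖P.freq ω n‖ ^ 2 * (Λ * mass G v i n) := by
        gcongr
        exact h.norm_meanValue_sq_le i n
    _ = _ := by ring

lemma msq_amplitudeError_le (h : IsControlled P G α ω v dv ddv Λ ρ J r) {I : ℕ} {σ : ℝ} (i : Fin N)
    (hσ : massSum G (timeDeriv P ω v) i (I + 2 * P.M) - massSum G (timeDeriv P ω v) i I ≤
        P.δ * σ) :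
    msq P.Ω (amplitudeError P G ω v I i) ≤ Λ ^ 3 * σ := by
  have h0 := h.regime.pos
  have hδ := P.δ_pos
  have h1 := energy_conv_window_le P.Ω_pos (fun t => (h.regime.symbol_κ i t).2.2) I
    (fun m => P.freq ω m * meanValue G v i m)
  rw [← energy_window (by omega)] at h1
  have h2 : ∑ n ∈ band (I + 2 * P.M) \ band I, ‖P.freq ω n * meanValue G v i n‖ ^ 2 ≤
      Λ * (P.δ * σ) := by
    rw [← window_mass G _ i (by omega)] at hσ
    calc _ ≤ ∑ n ∈ band (I + 2 * P.M) \ band I, Λ * mass G (timeDeriv P ω v) i n :=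
          Finset.sum_le_sum fun n _ => h.norm_freq_mul_meanValue_sq_le i n
      _ ≤ _ := by
          rw [← Finset.mul_sum]
          gcongr
  unfold amplitudeError
  rw [msq_const_mul, norm_I_div_sqrt_sq, msq_trigSum P.Ω_pos]
  calc _ ≤ P.δ⁻¹ * (Λ ^ 2 * (Λ * (P.δ * σ))) := by
        gcongr
        exact h1.trans (by gcongr)
    _ = _ := by field_simp

lemma _root_.SpaceTimeResonators.InRegime.norm_s_le (h : InRegime P G Λ) (i : Fin N) (t : ℝ) :
    ‖(P.s i t : ℂ)‖ ≤ Λ := by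
  rw [Complex.norm_real, Real.norm_eq_abs]
  exact (h.s_mem i t).2

lemma _root_.SpaceTimeResonators.InRegime.norm_sum_capacitance_le (h : InRegime P G Λ) (α : ℝ)
    (i : Fin N) (b : Fin N → ℂ) : ‖∑ j, G.capacitance α i j * b j‖ ≤
      Λ * (‖b i‖ + ‖b (G.leftNbr i)‖ + ‖b i‖ + ‖b (G.rightNbr i)‖) := by
  rw [G.sum_capacitance_mul α i b]
  have h3 := h.norm_div_gap_le (h.rightGap_mem i)
    (G.rightPhase α i * b (G.rightNbr i) - b i)
  have h4 := h.norm_div_gap_le (h.leftGap_mem i) (b i - G.leftPhase α i * b (G.leftNbr i))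
  have h5 : ‖G.rightPhase α i * b (G.rightNbr i) - b i‖ ≤ ‖b (G.rightNbr i)‖ + ‖b i‖ := by
    refine (norm_sub_le _ _).trans ?_
    rw [norm_mul, G.norm_rightPhase, one_mul]
  have h6 : ‖b i - G.leftPhase α i * b (G.leftNbr i)‖ ≤ ‖b i‖ + ‖b (G.leftNbr i)‖ := by
    refine (norm_sub_le _ _).trans ?_
    rw [norm_mul, G.norm_leftPhase, one_mul]
  have h0 := h.pos
  refine (norm_sub_le _ _).trans ((add_le_add h4 h3).trans ?_)
  have h8 := mul_le_mul_of_nonneg_left h5 h0.le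
  have h9 := mul_le_mul_of_nonneg_left h6 h0.le
  linarith

lemma msq_momentumError_le (h : IsControlled P G α ω v dv ddv Λ ρ J r) {I : ℕ} {σ : ℝ}
    (hI : I + 4 * P.M * r + 8 * P.M ≤ J) (hσ0 : 0 ≤ σ)
    (hσ : ∀ i,
      (energy (I + 2 * P.M) (fun n => dv i n (G.xm i)) - energy I (fun n => dv i n (G.xm i)) +
        (energy (I + 2 * P.M) (fun n => dv i n (G.xp i)) - energy I (fun n => dv i n (G.xp i))) ≤
        P.δ ^ 2 * σ) ∧
      (massSum G v i (I + 2 * P.M) - massSum G v i I ≤ σ)) (i : Fin N) :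
    msq P.Ω (momentumError P G α v dv I i) ≤ 10000000000 * Λ ^ 26 * (σ + ρ ^ 2 + P.δ) := by
  have h0 := h.regime.pos
  have hδ := P.δ_pos
  set c : Fin N → ℤ → ℂ := fun j => conv P.M (P.sHat j)
    (restrict (band (I + 2 * P.M) \ band I) (meanValue G v j)) with hc
  set w : Fin N → ℝ → ℂ := fun j => trigSum P.Ω (band (I + P.M)) (c j) with hw
  set S : Fin 7 → Finset ℤ := ![band (I + P.M) \ band I, band (I + P.M), band (I + P.M),
    band (I + P.M), band (I + P.M), band (I + P.M), band (I + P.M)]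
  set f : Fin 7 → ℤ → ℂ := ![fluxJump P G dv i, fluxError P G α v dv i, c i, c (G.leftNbr i), c i,
    c (G.rightNbr i), conv P.M (P.sHat i)
      (restrict (band (I + 2 * P.M) \ band I) (fluxJump P G dv i))]
  set g : Fin 7 → ℝ → ℂ := fun k => trigSum P.Ω (S k) (f k) with hg
  have hgc : ∀ k, Continuous (g k) := fun k => continuous_trigSum _ _ _
  have hle : ∀ t, ‖momentumError P G α v dv I i t‖ ≤ Λ ^ 2 * ∑ k, ‖g k t‖ := by
    intro t
    rw [momentumError_eq]
    have b1 := h.regime.norm_s_le i t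
    have b2 := h.regime.norm_sum_capacitance_le α i (fun j => w j t)
    have h1 := h.regime.one_le
    have hsum : ∑ k, ‖g k t‖ = ‖g 0 t‖ + ‖g 1 t‖ + ‖w i t‖ + ‖w (G.leftNbr i) t‖ + ‖w i t‖ +
        ‖w (G.rightNbr i) t‖ + ‖g 6 t‖ := by
      rw [Fin.sum_univ_seven]
      rfl
    change ‖g 0 t + P.s i t * (g 1 t - (∑ j, G.capacitance α i j * w j t) - g 6 t)‖ ≤ _
    rw [hsum]
    have b3 : ‖g 1 t - (∑ j, G.capacitance α i j * w j t) - g 6 t‖ ≤ ‖g 1 t‖ +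
        Λ * (‖w i t‖ + ‖w (G.leftNbr i) t‖ + ‖w i t‖ + ‖w (G.rightNbr i) t‖) + ‖g 6 t‖ :=
      (norm_sub_le _ _).trans (add_le_add_left ((norm_sub_le _ _).trans
        (add_le_add_right b2 _)) _)
    refine (norm_add_le _ _).trans ?_
    rw [norm_mul]
    have b4 : ‖(P.s i t : ℂ)‖ * ‖g 1 t - (∑ j, G.capacitance α i j * w j t) - g 6 t‖ ≤
        Λ * (‖g 1 t‖ +
        Λ * (‖w i t‖ + ‖w (G.leftNbr i) t‖ + ‖w i t‖ + ‖w (G.rightNbr i) t‖) + ‖g 6 t‖) := by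
      gcongr
    have c1 : Λ ≤ Λ ^ 2 := by nlinarith
    have c2 : 1 ≤ Λ ^ 2 := by nlinarith
    have d0 := mul_le_mul_of_nonneg_right c2 (norm_nonneg (g 0 t))
    have d1 := mul_le_mul_of_nonneg_right c1 (norm_nonneg (g 1 t))
    have d6 := mul_le_mul_of_nonneg_right c1 (norm_nonneg (g 6 t))
    calc _ ≤ _ := add_le_add_right b4 _
      _ ≤ _ := by
        ring_nf at d0 d1 d6 ⊢
        linarith
  have key := msq_le_of_le_sum P.Ω_pos Finset.univ
    (continuous_momentumError P G α v dv I i) hgc hle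
  have hwj : ∀ j, msq P.Ω (w j) ≤ Λ ^ 3 * σ := by
    intro j
    have h1 := energy_conv_window_le P.Ω_pos (fun t => (h.regime.symbol_s j t).2) I (meanValue G v j)
    rw [← energy_window (by omega)] at h1
    have h2 : ∑ n ∈ band (I + 2 * P.M) \ band I, ‖meanValue G v j n‖ ^ 2 ≤ Λ * σ := by
      have := (hσ j).2
      rw [← window_mass G _ j (by omega)] at this
      calc _ ≤ ∑ n ∈ band (I + 2 * P.M) \ band I, Λ * mass G v j n :=
            Finset.sum_le_sum fun n _ => h.norm_meanValue_sq_le j n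
        _ ≤ _ := by
            rw [← Finset.mul_sum]
            gcongr
    simp only [hw, hc]
    rw [msq_trigSum P.Ω_pos]
    calc _ ≤ Λ ^ 2 * (Λ * σ) := h1.trans (by gcongr)
      _ = _ := by ring
  have hg0 : msq P.Ω (g 0) ≤ 2 * σ := by
    change msq P.Ω (trigSum _ _ _) ≤ _
    rw [msq_trigSum P.Ω_pos]
    refine le_trans ?_ (window_flux_le P G (hσ i).1)
    exact Finset.sum_le_sum_of_subset_of_nonneg
      (Finset.sdiff_subset_sdiff (band_mono (by omega)) subset_rfl) fun _ _ _ => by positivity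
  have hg1 : msq P.Ω (g 1) ≤ 1000000000 * Λ ^ 22 * (ρ ^ 2 + P.δ) := by
    change msq P.Ω (trigSum _ _ _) ≤ _
    rw [msq_trigSum P.Ω_pos]
    exact h.energy_fluxError_le i (by omega)
  have hg6 : msq P.Ω (g 6) ≤ Λ ^ 2 * (2 * σ) := by
    change msq P.Ω (trigSum _ _ _) ≤ _
    rw [msq_trigSum P.Ω_pos]
    have h1 := energy_conv_window_le P.Ω_pos (fun t => (h.regime.symbol_s i t).2) I
      (fluxJump P G dv i)
    rw [← energy_window (by omega)] at h1
    exact h1.trans (by gcongr; exact window_flux_le P G (hσ i).1)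
  have hsum : ∑ k, msq P.Ω (g k) = msq P.Ω (g 0) + msq P.Ω (g 1) + msq P.Ω (w i) +
      msq P.Ω (w (G.leftNbr i)) + msq P.Ω (w i) + msq P.Ω (w (G.rightNbr i)) + msq P.Ω (g 6) := by
    rw [Fin.sum_univ_seven]
    rfl
  rw [hsum] at key
  refine key.trans ?_
  have a1 := hwj i
  have a2 := hwj (G.leftNbr i)
  have a3 := hwj (G.rightNbr i)
  have p1 := h.one_le_pow' 22
  have p2 := h.one_le_pow (show 2 ≤ 22 by norm_num)
  have p3 := h.one_le_pow (show 3 ≤ 22 by norm_num)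
  have hb : 0 ≤ σ + ρ ^ 2 + P.δ := by positivity
  have q1 : msq P.Ω (g 0) ≤ 2 * Λ ^ 22 * σ :=
    hg0.trans (by nlinarith)
  have q3 : Λ ^ 3 * σ ≤ Λ ^ 22 * σ := by gcongr
  have q6 : Λ ^ 2 * (2 * σ) ≤ 2 * Λ ^ 22 * σ := by nlinarith
  have tot : msq P.Ω (g 0) + msq P.Ω (g 1) + msq P.Ω (w i) +
      msq P.Ω (w (G.leftNbr i)) + msq P.Ω (w i) + msq P.Ω (w (G.rightNbr i)) + msq P.Ω (g 6) ≤
      1000000000 * Λ ^ 22 * (σ + ρ ^ 2 + P.δ) := by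
    have : 0 ≤ Λ ^ 22 * σ := by positivity
    linarith
  calc _ ≤ (Λ ^ 2) ^ 2 * (Finset.univ : Finset (Fin 7)).card *
        (1000000000 * Λ ^ 22 * (σ + ρ ^ 2 + P.δ)) := by gcongr
    _ = 7000000000 * Λ ^ 26 * (σ + ρ ^ 2 + P.δ) := by
        rw [Finset.card_univ, Fintype.card_fin]
        push_cast
        ring
    _ ≤ _ := by gcongr; norm_num

end IsControlled

/-! ### Weighted Cauchy–Schwarz inequalities and their consequences -/

/-- The sums of `(1 + |n + θ|)^{-3/2}` over the integers are bounded uniformly in `θ`. -/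
lemma exists_sum_inv_sqrt_cube_le : ∃ S : ℝ, 0 < S ∧ ∀ (θ : ℝ) (F : Finset ℤ),
    ∑ n ∈ F, (√(1 + |(n : ℝ) + θ|) ^ 3)⁻¹ ≤ S := by
  set g : ℤ → ℝ := fun n => (√(1 + |(n : ℝ)|) ^ 3)⁻¹ with hg
  have hg0 : ∀ n, 0 < g n := fun n => by positivity
  have hsum : Summable g := by
    have h1 := (Real.summable_one_div_int_add_rpow (1 / 2) (3 / 2)).2 (by norm_num)
    refine h1.of_nonneg_of_le (fun n => (hg0 n).le) fun n => ?_
    have hne : (n : ℝ) + 1 / 2 ≠ 0 := by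
      intro h0
      have h2 : (2 * n + 1 : ℤ) = 0 := by
        have : (2 * (n : ℝ) + 1) = 0 := by linarith
        exact_mod_cast this
      omega
    have hpos : 0 < |(n : ℝ) + 1 / 2| := abs_pos.2 hne
    have hle : |(n : ℝ) + 1 / 2| ≤ 1 + |(n : ℝ)| := by
      have := abs_add_le (n : ℝ) (1 / 2)
      rw [abs_of_pos (by norm_num : (0 : ℝ) < 1 / 2)] at this
      linarith
    have h3 : √(1 + |(n : ℝ)|) ^ 3 = (1 + |(n : ℝ)|) ^ (3 / 2 : ℝ) := by
      rw [Real.sqrt_eq_rpow, ← Real.rpow_natCast, ← Real.rpow_mul (by positivity)]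
      norm_num
    simp only [hg, one_div, h3]
    exact inv_anti₀ (Real.rpow_pos_of_pos (by simpa using hpos) _)
      (Real.rpow_le_rpow (abs_nonneg _) (by simpa using hle) (by norm_num))
  refine ⟨4 * (∑' n, g n + 1), by
    have : 0 ≤ ∑' n, g n := tsum_nonneg fun n => (hg0 n).le
    linarith,
    fun θ F => ?_⟩
  -- A shift by the integer part of `θ` reduces to the case `0 ≤ θ < 1`.
  set m := ⌊θ⌋
  have h1 : ∀ n : ℤ, (√(1 + |(n : ℝ) + θ|) ^ 3)⁻¹ ≤ 4 * g (n + m) := by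
    intro n
    have hfl : |(θ - m)| ≤ 1 := by
      rw [abs_le]
      have := Int.floor_le θ
      have := Int.lt_floor_add_one θ
      constructor <;> linarith
    have h2 : 1 + |((n + m : ℤ) : ℝ)| ≤ 2 * (1 + |(n : ℝ) + θ|) := by
      have := abs_sub ((n : ℝ) + θ) (θ - m)
      have e : (n : ℝ) + θ - (θ - m) = ((n + m : ℤ) : ℝ) := by push_cast; ring
      rw [e] at this
      have := abs_nonneg ((n : ℝ) + θ)
      linarith
    have h3 : √(1 + |((n + m : ℤ) : ℝ)|) ^ 3 ≤ 4 * √(1 + |(n : ℝ) + θ|) ^ 3 := by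
      have h4 : √(1 + |((n + m : ℤ) : ℝ)|) ≤ √2 * √(1 + |(n : ℝ) + θ|) := by
        rw [← Real.sqrt_mul (by norm_num)]
        exact Real.sqrt_le_sqrt h2
      have h5 : √2 ^ 3 ≤ (4 : ℝ) := by
        have e : √2 ^ 3 = 2 * √(2 : ℝ) := by
          rw [pow_succ, Real.sq_sqrt (by norm_num)]
        have : √(2 : ℝ) ≤ 2 := Real.sqrt_le_iff.2 (by norm_num)
        linarith
      calc _ ≤ (√2 * √(1 + |(n : ℝ) + θ|)) ^ 3 := by gcongr
        _ = √2 ^ 3 * √(1 + |(n : ℝ) + θ|) ^ 3 := by ring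
        _ ≤ _ := by gcongr
    have h6 : 0 < √(1 + |(n : ℝ) + θ|) ^ 3 := by positivity
    have h7 : 0 < √(1 + |((n + m : ℤ) : ℝ)|) ^ 3 := by positivity
    simp only [hg]
    rw [← div_eq_mul_inv, inv_eq_one_div, div_le_div_iff₀ h6 h7]
    linarith
  calc _ ≤ ∑ n ∈ F, 4 * g (n + m) := Finset.sum_le_sum fun n _ => h1 n
    _ = 4 * ∑ n ∈ F.map (addRightEmbedding m), g n := by
        rw [← Finset.mul_sum, Finset.sum_map]
        rfl
    _ ≤ 4 * ∑' n, g n := by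
        gcongr
        exact hsum.sum_le_tsum _ fun n _ => (hg0 n).le
    _ ≤ _ := by linarith

/-- A one-dimensional Sobolev inequality on the Fourier side: the Wiener norm is controlled by a
weighted `ℓ²` norm. -/
lemma sq_sum_le_weighted {S : ℝ} (hS : ∀ (θ : ℝ) (F : Finset ℤ),
    ∑ n ∈ F, (√(1 + |(n : ℝ) + θ|) ^ 3)⁻¹ ≤ S) {δ Λ R θ : ℝ} (hδ : 0 < δ) (hΛ : 0 < Λ)
    (hR : 1 ≤ R) (F : Finset ℤ) {f w : ℤ → ℝ}
    (hw : ∀ n ∈ F, δ * (Λ⁻¹ ^ 2 * (((n : ℝ) + θ) ^ 2 + R ^ 2)) ≤ w n) :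
    (∑ n ∈ F, f n) ^ 2 ≤ 2 * Λ ^ 2 * S / (δ * √R) * ∑ n ∈ F, w n * f n ^ 2 := by
  have hR0 : 0 < R := by linarith
  have hsR : 0 < √R := Real.sqrt_pos.2 hR0
  have hw0 : ∀ n ∈ F, 0 < w n := fun n hn => lt_of_lt_of_le (by positivity) (hw n hn)
  have hinv : ∀ n ∈ F, (w n)⁻¹ ≤ 2 * Λ ^ 2 / (δ * √R) * (√(1 + |(n : ℝ) + θ|) ^ 3)⁻¹ := by
    intro n hn
    set x := |(n : ℝ) + θ| with hx
    have hx0 : 0 ≤ x := abs_nonneg _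
    have h1 : √(1 + x) ^ 3 * √R ≤ 2 * (x ^ 2 + R ^ 2) := by
      have h2 : √(1 + x) ≤ √(R + x) := Real.sqrt_le_sqrt (by linarith)
      have h3 : √R ≤ √(R + x) := Real.sqrt_le_sqrt (by linarith)
      calc _ ≤ √(R + x) ^ 3 * √(R + x) := by gcongr
        _ = (√(R + x) ^ 2) ^ 2 := by ring
        _ = (R + x) ^ 2 := by rw [Real.sq_sqrt (by linarith)]
        _ ≤ _ := by nlinarith [sq_nonneg (R - x)]
    have h4 : δ * (Λ⁻¹ ^ 2 * (√(1 + x) ^ 3 * √R / 2)) ≤ w n := by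
      refine le_trans ?_ (hw n hn)
      rw [← sq_abs ((n : ℝ) + θ), ← hx]
      gcongr
      linarith
    calc _ ≤ (δ * (Λ⁻¹ ^ 2 * (√(1 + x) ^ 3 * √R / 2)))⁻¹ := inv_anti₀ (by positivity) h4
      _ = _ := by field_simp
  have hcs := Finset.sum_mul_sq_le_sq_mul_sq F (fun n => (√(w n))⁻¹) (fun n => √(w n) * f n)
  have e1 : ∑ n ∈ F, (√(w n))⁻¹ * (√(w n) * f n) = ∑ n ∈ F, f n :=
    Finset.sum_congr rfl fun n hn => by
      have := (Real.sqrt_pos.2 (hw0 n hn)).ne'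
      field_simp
  have e2 : ∑ n ∈ F, (√(w n))⁻¹ ^ 2 = ∑ n ∈ F, (w n)⁻¹ :=
    Finset.sum_congr rfl fun n hn => by rw [inv_pow, Real.sq_sqrt (hw0 n hn).le]
  have e3 : ∑ n ∈ F, (√(w n) * f n) ^ 2 = ∑ n ∈ F, w n * f n ^ 2 :=
    Finset.sum_congr rfl fun n hn => by rw [mul_pow, Real.sq_sqrt (hw0 n hn).le]
  rw [e1, e2, e3] at hcs
  refine hcs.trans ?_
  have hnn : 0 ≤ ∑ n ∈ F, w n * f n ^ 2 :=
    Finset.sum_nonneg fun n hn => mul_nonneg (hw0 n hn).le (sq_nonneg _)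
  refine mul_le_mul_of_nonneg_right ?_ hnn
  calc _ ≤ ∑ n ∈ F, 2 * Λ ^ 2 / (δ * √R) * (√(1 + |(n : ℝ) + θ|) ^ 3)⁻¹ := Finset.sum_le_sum hinv
    _ = 2 * Λ ^ 2 / (δ * √R) * ∑ n ∈ F, (√(1 + |(n : ℝ) + θ|) ^ 3)⁻¹ := by rw [Finset.mul_sum]
    _ ≤ 2 * Λ ^ 2 / (δ * √R) * S := by gcongr; exact hS θ F
    _ = _ := by ring

/-- The `L²(D)` norm of the `n`-th harmonic. -/
def harmonicNorm {N : ℕ} (G : Geometry N) (v : Fin N → ℤ → ℝ → ℂ) (n : ℤ) : ℝ :=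
  √(∑ i, mass G v i n)

lemma norm_freq_sq {N : ℕ} (P : Medium N) (ω : ℂ) (n : ℤ) :
    ‖P.freq ω n‖ ^ 2 = P.Ω ^ 2 * ((n : ℝ) + ω.re / P.Ω) ^ 2 + ω.im ^ 2 := by
  have hΩ := P.Ω_pos.ne'
  rw [← Complex.normSq_eq_norm_sq, Complex.normSq_apply]
  unfold Medium.freq
  simp
  field_simp
  ring

namespace IsControlled

variable {N : ℕ} {P : Medium N} {G : Geometry N} {α : ℝ} {ω : ℂ} {v dv ddv : Fin N → ℤ → ℝ → ℂ}
  {Λ ρ : ℝ} {J r : ℕ}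

lemma inv_sq_mul_δ_le (h : IsControlled P G α ω v dv ddv Λ ρ J r) :
    P.δ * Λ⁻¹ ^ 2 ≤ P.Ω ^ 2 := by
  have h0 := h.regime.pos
  have := h.regime.Ω_mem.1
  calc P.δ * Λ⁻¹ ^ 2 = (Λ⁻¹ * √P.δ) ^ 2 := by rw [mul_pow, Real.sq_sqrt P.δ_pos.le]; ring
    _ ≤ _ := by gcongr

/-- The growth rate of a Bloch wave which is carried by low harmonics is `O(√δ)`: for larger rates
the bound for the time derivatives would make all harmonics small. -/
lemma abs_im_le {S : ℝ} (hS0 : 0 < S) (hS : ∀ (θ : ℝ) (F : Finset ℤ),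
    ∑ n ∈ F, (√(1 + |(n : ℝ) + θ|) ^ 3)⁻¹ ≤ S)
    (h : IsControlled P G α ω v dv ddv Λ ρ J r) {K : ℕ} (hK : K + 4 * P.M * r + 5 * P.M ≤ J)
    (hcarry : 1 / 2 ≤ ∑ n ∈ band K, harmonicNorm G v n) :
    |ω.im| ≤ (1 + 8000000 * N * S * Λ ^ 17) ^ 2 * √P.δ := by
  have h0 := h.regime.pos
  have hδ := P.δ_pos
  set R := (1 + 8000000 * N * S * Λ ^ 17) ^ 2 with hR
  have hR1 : 1 ≤ R := one_le_pow₀ (by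
    have : 0 ≤ 8000000 * N * S * Λ ^ 17 := by positivity
    linarith)
  by_contra! hcon
  have him : R ^ 2 * P.δ ≤ ω.im ^ 2 := by
    rw [← sq_abs ω.im, ← Real.sq_sqrt hδ.le, ← mul_pow]
    gcongr
  have key := sq_sum_le_weighted hS (δ := P.δ) (Λ := Λ) (R := R) (θ := ω.re / P.Ω) hδ h0 hR1
    (band K) (f := harmonicNorm G v) (w := fun n => ‖P.freq ω n‖ ^ 2) (fun n _ => by
      rw [norm_freq_sq]
      have h1 := h.inv_sq_mul_δ_le
      have h2 : Λ⁻¹ ^ 2 ≤ 1 := pow_le_one₀ (by positivity) (inv_le_one_of_one_le₀ h.regime.one_le)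
      calc _ = P.δ * Λ⁻¹ ^ 2 * ((n : ℝ) + ω.re / P.Ω) ^ 2 + Λ⁻¹ ^ 2 * (R ^ 2 * P.δ) := by ring
        _ ≤ P.Ω ^ 2 * ((n : ℝ) + ω.re / P.Ω) ^ 2 + 1 * ω.im ^ 2 := by gcongr
        _ = _ := by ring)
  have hsum : ∑ n ∈ band K, ‖P.freq ω n‖ ^ 2 * harmonicNorm G v n ^ 2 ≤
      N * (1000000 * Λ ^ 15 * P.δ) := by
    have e : ∀ n, ‖P.freq ω n‖ ^ 2 * harmonicNorm G v n ^ 2 =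
        ∑ i, mass G (timeDeriv P ω v) i n := by
      intro n
      rw [harmonicNorm, Real.sq_sqrt (Finset.sum_nonneg fun i _ => mass_nonneg G v i n),
        Finset.mul_sum]
      simp_rw [mass_timeDeriv]
    simp_rw [e]
    rw [Finset.sum_comm]
    calc _ ≤ ∑ _i : Fin N, 1000000 * Λ ^ 15 * P.δ :=
          Finset.sum_le_sum fun i _ => h.timeMass_le_δ i hK
      _ = _ := by simp
  have hsq : √R = 1 + 8000000 * N * S * Λ ^ 17 := by
    rw [hR, Real.sqrt_sq (by positivity)]
  have hlow : (1 / 2 : ℝ) ^ 2 ≤ (∑ n ∈ band K, harmonicNorm G v n) ^ 2 := by gcongr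
  have hfin : (1 / 2 : ℝ) ^ 2 ≤ 2 * Λ ^ 2 * S / (P.δ * √R) * (N * (1000000 * Λ ^ 15 * P.δ)) :=
    hlow.trans (key.trans (by gcongr))
  rw [hsq, div_mul_eq_mul_div, le_div_iff₀ (by positivity)] at hfin
  have : (1 / 4) * P.δ * (1 + 8000000 * N * S * Λ ^ 17) ≤
      (1 / 4) * P.δ * (8000000 * N * S * Λ ^ 17) := by
    linarith
  have := le_of_mul_le_mul_left this (by positivity)
  linarith

lemma msq_freq_mul_le (h : IsControlled P G α ω v dv ddv Λ ρ J r) (I : ℕ) (i : Fin N) :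
    ∑ n ∈ band I, ‖P.freq ω n * meanValue G v i n‖ ^ 2 ≤ 2 * Λ ^ 2 * P.δ *
      (msq P.Ω (momentum P G ω v I i) + msq P.Ω (amplitudeError P G ω v I i)) := by
  have h0 := h.regime.pos
  have hδ := P.δ_pos
  rw [← msq_trigSum P.Ω_pos]
  have e : ∀ t, trigSum P.Ω (band I) (fun n => P.freq ω n * meanValue G v i n) t =
      -Complex.I * (√P.δ * P.κ i t * (momentum P G ω v I i t - amplitudeError P G ω v I i t)) := by
    intro t
    have h1 := (hasDerivAt_amplitude P G ω v I i t).unique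
      (hasDerivAt_exp_mul_trigSum P ω (band I) (meanValue G v i) t)
    have he := Complex.exp_ne_zero (Complex.I * ω * t)
    have h2 : √P.δ * P.κ i t * (momentum P G ω v I i t - amplitudeError P G ω v I i t) =
        Complex.I * trigSum P.Ω (band I) (fun n => P.freq ω n * meanValue G v i n) t := by
      refine mul_left_cancel₀ he ?_
      linear_combination h1
    rw [h2, ← mul_assoc, neg_mul, Complex.I_mul_I]
    ring
  have c1 := continuous_momentum P G ω v I i
  have c2 := continuous_amplitudeError P G ω v I i
  have h1 := msq_mono P.Ω_pos (continuous_trigSum P.Ω (band I)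
    (fun n => P.freq ω n * meanValue G v i n)) (c1.sub c2) (C := Λ ^ 2 * P.δ) (fun t => by
      rw [e, norm_mul, norm_mul, norm_mul, norm_neg, Complex.norm_I, Complex.norm_real,
        Complex.norm_real, Real.norm_of_nonneg (Real.sqrt_nonneg _),
        Real.norm_of_nonneg (P.κ_pos i t).le, one_mul, mul_pow, mul_pow, Real.sq_sqrt hδ.le,
        mul_comm P.δ]
      have := (h.regime.κ_mem i t).2
      have := (P.κ_pos i t).le
      gcongr
      rfl)
  have h2 := msq_sub_le P.Ω_pos c1 c2
  calc _ ≤ _ := h1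
    _ ≤ Λ ^ 2 * P.δ * (2 * msq P.Ω (momentum P G ω v I i) +
          2 * msq P.Ω (amplitudeError P G ω v I i)) := by gcongr; exact h2
    _ = _ := by ring

/-- The Wiener norm of the truncated means is controlled by the mean squares of amplitude and
momentum. -/
lemma sq_sum_norm_meanValue_le {S : ℝ} (hS0 : 0 < S) (hS : ∀ (θ : ℝ) (F : Finset ℤ),
    ∑ n ∈ F, (√(1 + |(n : ℝ) + θ|) ^ 3)⁻¹ ≤ S)
    (h : IsControlled P G α ω v dv ddv Λ ρ J r) (I : ℕ) (i : Fin N) :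
    (∑ n ∈ band I, ‖meanValue G v i n‖) ^ 2 ≤ 4 * Λ ^ 4 * S * (msq P.Ω (amplitude P G v I i) +
      msq P.Ω (momentum P G ω v I i) + msq P.Ω (amplitudeError P G ω v I i)) := by
  have h0 := h.regime.pos
  have hδ := P.δ_pos
  have hΛ1 : 1 ≤ Λ ^ 2 := h.one_le_pow' 2
  have key := sq_sum_le_weighted hS (δ := P.δ) (Λ := Λ) (R := 1) (θ := ω.re / P.Ω) hδ h0 le_rfl
    (band I) (f := fun n => ‖meanValue G v i n‖) (w := fun n => P.δ + ‖P.freq ω n‖ ^ 2)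
    (fun n _ => by
      rw [norm_freq_sq]
      have h1 := h.inv_sq_mul_δ_le
      have h2 : Λ⁻¹ ^ 2 ≤ 1 := pow_le_one₀ (by positivity) (inv_le_one_of_one_le₀ h.regime.one_le)
      calc _ = P.δ * Λ⁻¹ ^ 2 * ((n : ℝ) + ω.re / P.Ω) ^ 2 + Λ⁻¹ ^ 2 * P.δ := by ring
        _ ≤ P.Ω ^ 2 * ((n : ℝ) + ω.re / P.Ω) ^ 2 + 1 * P.δ := by gcongr
        _ ≤ _ := by linarith [sq_nonneg ω.im])
  have hsum : ∑ n ∈ band I, (P.δ + ‖P.freq ω n‖ ^ 2) * ‖meanValue G v i n‖ ^ 2 =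
      P.δ * msq P.Ω (amplitude P G v I i) +
        ∑ n ∈ band I, ‖P.freq ω n * meanValue G v i n‖ ^ 2 := by
    unfold amplitude
    rw [msq_trigSum P.Ω_pos, Finset.mul_sum, ← Finset.sum_add_distrib]
    exact Finset.sum_congr rfl fun n _ => by rw [norm_mul]; ring
  have h1 := h.msq_freq_mul_le I i
  have n1 := msq_nonneg P.Ω_pos (amplitude P G v I i)
  rw [hsum, Real.sqrt_one, mul_one] at key
  refine key.trans ?_
  set a := msq P.Ω (amplitude P G v I i)
  set b := msq P.Ω (momentum P G ω v I i) + msq P.Ω (amplitudeError P G ω v I i) with hb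
  rw [add_assoc, ← hb]
  calc _ ≤ 2 * Λ ^ 2 * S / P.δ * (P.δ * a + 2 * Λ ^ 2 * P.δ * b) := by gcongr
    _ = 2 * Λ ^ 2 * S * (a + 2 * Λ ^ 2 * b) := by field_simp
    _ ≤ 2 * Λ ^ 2 * S * (2 * Λ ^ 2 * a + 2 * Λ ^ 2 * b) := by
        gcongr
        nlinarith
    _ = _ := by ring

lemma harmonicNorm_le (h : IsControlled P G α ω v dv ddv Λ ρ J r) (n : ℤ) :
    harmonicNorm G v n ≤ ∑ i, (2 * Λ * ‖meanValue G v i n‖ +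
      4 * Λ * √(oscBound G Λ dv ddv i n)) := by
  have h0 := h.regime.pos
  have hsq : ∀ i, √(mass G v i n) ≤ 2 * Λ * ‖meanValue G v i n‖ +
      4 * Λ * √(oscBound G Λ dv ddv i n) := by
    intro i
    have ho := h.oscBound_nonneg i n
    have h1 : mass G v i n ≤ G.ell i * (2 * ‖meanValue G v i n‖ ^ 2 +
        8 * oscBound G Λ dv ddv i n) := by
      have hc := h.continuous_v i n
      have := intervalIntegral.integral_mono_on (μ := MeasureTheory.volume) (G.xm_lt_xp i).le
        (f := fun x => ‖v i n x‖ ^ 2) (g := fun _ => 2 * ‖meanValue G v i n‖ ^ 2 +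
          8 * oscBound G Λ dv ddv i n)
        (Continuous.intervalIntegrable (by fun_prop) _ _)
        (Continuous.intervalIntegrable (by fun_prop) _ _) (fun x hx => by
          have h2 := h.norm_sub_meanValue_le i n hx
          have h3 := norm_add_le (v i n x - meanValue G v i n) (meanValue G v i n)
          rw [sub_add_cancel] at h3
          have h4 := sq_add_le ‖v i n x - meanValue G v i n‖ ‖meanValue G v i n‖
          have h5 : ‖v i n x‖ ^ 2 ≤ (‖v i n x - meanValue G v i n‖ + ‖meanValue G v i n‖) ^ 2 := by
            gcongr
          linarith)
      rw [intervalIntegral.integral_const, smul_eq_mul] at this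
      exact this
    have h2 : mass G v i n ≤ (2 * Λ * ‖meanValue G v i n‖ +
        4 * Λ * √(oscBound G Λ dv ddv i n)) ^ 2 := by
      have hl : G.ell i ≤ Λ ^ 2 := by nlinarith [(h.regime.ell_mem i).2, h.regime.one_le]
      have hs := Real.sq_sqrt ho
      have hp : 0 ≤ Λ ^ 2 * (‖meanValue G v i n‖ * √(oscBound G Λ dv ddv i n)) := by positivity
      have hp2 : 0 ≤ Λ ^ 2 * ‖meanValue G v i n‖ ^ 2 := by positivity
      have hp3 : 0 ≤ Λ ^ 2 * oscBound G Λ dv ddv i n := by positivity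
      calc _ ≤ Λ ^ 2 * (2 * ‖meanValue G v i n‖ ^ 2 + 8 * oscBound G Λ dv ddv i n) :=
            h1.trans (by gcongr)
        _ ≤ 4 * (Λ ^ 2 * ‖meanValue G v i n‖ ^ 2) + 16 * (Λ ^ 2 * oscBound G Λ dv ddv i n) +
            16 * (Λ ^ 2 * (‖meanValue G v i n‖ * √(oscBound G Λ dv ddv i n))) := by linarith
        _ = _ := by
            linear_combination (-16 * Λ ^ 2) * hs
    exact Real.sqrt_le_iff.2 ⟨by positivity, h2⟩
  have hmn := fun i => mass_nonneg G v i n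
  have h3 : harmonicNorm G v n ≤ ∑ i, √(mass G v i n) := by
    refine Real.sqrt_le_iff.2 ⟨Finset.sum_nonneg fun i _ => Real.sqrt_nonneg _, ?_⟩
    calc _ = ∑ i, √(mass G v i n) ^ 2 := by
          exact Finset.sum_congr rfl fun i _ => (Real.sq_sqrt (hmn i)).symm
      _ ≤ _ := Finset.sum_sq_le_sq_sum_of_nonneg fun i _ => Real.sqrt_nonneg _
  exact h3.trans (Finset.sum_le_sum fun i _ => hsq i)

/-- The harmonics `|n| ≤ K` are controlled by the mean squares of the truncated means. -/
lemma sum_harmonicNorm_le {S : ℝ} (hS0 : 0 < S) (hS : ∀ (θ : ℝ) (F : Finset ℤ),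
    ∑ n ∈ F, (√(1 + |(n : ℝ) + θ|) ^ 3)⁻¹ ≤ S)
    (h : IsControlled P G α ω v dv ddv Λ ρ J r) {K I : ℕ} (hKI : K ≤ I)
    (hK : K + 4 * P.M * r + 6 * P.M ≤ J) {b : ℝ}
    (hb : ∀ i, msq P.Ω (amplitude P G v I i) ≤ b ∧ msq P.Ω (momentum P G ω v I i) ≤ b ∧
      msq P.Ω (amplitudeError P G ω v I i) ≤ b) :
    ∑ n ∈ band K, harmonicNorm G v n ≤ N * (2 * Λ * √(12 * Λ ^ 4 * S * b) +
      4 * Λ * √((2 * K + 1) * (3000000 * Λ ^ 18 * P.δ))) := by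
  have h0 := h.regime.pos
  have hi : ∀ i, 2 * Λ * ∑ n ∈ band K, ‖meanValue G v i n‖ +
      4 * Λ * ∑ n ∈ band K, √(oscBound G Λ dv ddv i n) ≤ 2 * Λ * √(12 * Λ ^ 4 * S * b) +
      4 * Λ * √((2 * K + 1) * (3000000 * Λ ^ 18 * P.δ)) := by
    intro i
    obtain ⟨b1, b2, b3⟩ := hb i
    have h1 : ∑ n ∈ band K, ‖meanValue G v i n‖ ≤ √(12 * Λ ^ 4 * S * b) := by
      refine (Finset.sum_le_sum_of_subset_of_nonneg (band_mono hKI)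
        fun _ _ _ => norm_nonneg _).trans (Real.le_sqrt_of_sq_le ?_)
      refine (h.sq_sum_norm_meanValue_le hS0 hS I i).trans ?_
      calc _ ≤ 4 * Λ ^ 4 * S * (b + b + b) := by gcongr
        _ = _ := by ring
    have h2 : ∑ n ∈ band K, √(oscBound G Λ dv ddv i n) ≤
        √((2 * K + 1) * (3000000 * Λ ^ 18 * P.δ)) := by
      refine Real.le_sqrt_of_sq_le ?_
      refine sq_sum_le_card_mul_sum_sq.trans ?_
      have hc : ((band K).card : ℝ) = 2 * K + 1 := by
        have : (band K).card = 2 * K + 1 := by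
          rw [band, Int.card_Icc]
          omega
        exact_mod_cast this
      rw [hc]
      gcongr
      refine le_trans (le_of_eq ?_) (h.sum_oscBound_le_δ i hK)
      exact Finset.sum_congr rfl fun n _ => Real.sq_sqrt (h.oscBound_nonneg i n)
    gcongr
  calc _ ≤ ∑ n ∈ band K, ∑ i, (2 * Λ * ‖meanValue G v i n‖ +
        4 * Λ * √(oscBound G Λ dv ddv i n)) := Finset.sum_le_sum fun n _ => h.harmonicNorm_le n
    _ = ∑ i, (2 * Λ * ∑ n ∈ band K, ‖meanValue G v i n‖ +
        4 * Λ * ∑ n ∈ band K, √(oscBound G Λ dv ddv i n)) := by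
        rw [Finset.sum_comm]
        simp only [Finset.sum_add_distrib, Finset.mul_sum]
    _ ≤ ∑ _i : Fin N, _ := Finset.sum_le_sum fun i _ => hi i
    _ = _ := by simp [mul_add]

end IsControlled

/-! ### Linear differential equations with bounded continuous coefficients -/

section LinearODE

variable {E : Type*} [NormedAddCommGroup E] [NormedSpace ℂ E]

lemma abs_integral_cosh_le {b : ℝ} (hb : 0 < b) (t : ℝ) :
    |∫ s in (0 : ℝ)..t, Real.cosh (b * s)| ≤ b⁻¹ * Real.cosh (b * t) := by
  have h1 : ∀ s, HasDerivAt (fun s => b⁻¹ * Real.sinh (b * s)) (Real.cosh (b * s)) s := by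
    intro s
    have h2 := ((Real.hasDerivAt_sinh (b * s)).comp s ((hasDerivAt_id s).const_mul b)).const_mul b⁻¹
    refine h2.congr_deriv ?_
    field_simp
  rw [intervalIntegral.integral_eq_sub_of_hasDerivAt (fun s _ => h1 s)
    (Continuous.intervalIntegrable (by fun_prop) _ _)]
  simp only [mul_zero, Real.sinh_zero, sub_zero, abs_mul, abs_inv, abs_of_pos hb]
  gcongr
  rw [abs_le]
  constructor
  · have := Real.sinh_lt_cosh (-(b * t))
    rw [Real.sinh_neg, Real.cosh_neg] at this
    linarith
  · exact (Real.sinh_lt_cosh _).le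

variable {A : ℝ → E →L[ℂ] E} {k : ℝ}

lemma norm_integral_apply_le (hk : ∀ t, ‖A t‖ ≤ k) {b D : ℝ} (hb : 0 < b)
    {u : ℝ → E} (hu : ∀ s, ‖u s‖ ≤ Real.cosh (b * s) * D) (t : ℝ) :
    ‖∫ s in (0 : ℝ)..t, A s (u s)‖ ≤ k * D * (b⁻¹ * Real.cosh (b * t)) := by
  have hk0 : 0 ≤ k := (norm_nonneg _).trans (hk 0)
  have hD : 0 ≤ D := by
    have := (norm_nonneg _).trans (hu 0)
    simpa using this
  have h1 := intervalIntegral.norm_integral_le_abs_of_norm_le (μ := MeasureTheory.volume) (a := 0)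
    (b := t) (f := fun s => A s (u s)) (g := fun s => k * D * Real.cosh (b * s))
    (Eventually.of_forall fun s => by
      calc ‖A s (u s)‖ ≤ ‖A s‖ * ‖u s‖ := (A s).le_opNorm _
        _ ≤ k * (Real.cosh (b * s) * D) := by
          gcongr
          · exact hk s
          · exact hu s
        _ = _ := by ring)
    (Continuous.intervalIntegrable (by fun_prop) _ _)
  rw [intervalIntegral.integral_const_mul, abs_mul, abs_of_nonneg (by positivity)] at h1
  exact h1.trans (mul_le_mul_of_nonneg_left (abs_integral_cosh_le hb t) (by positivity))

/-- Global solvability of linear equations, by a contraction in a space of functions of at most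
exponential growth. -/
lemma exists_linear_solution [CompleteSpace E] (hA : Continuous A) (hk : ∀ t, ‖A t‖ ≤ k) (x₀ : E) :
    ∃ x : ℝ → E, x 0 = x₀ ∧ ∀ t, HasDerivAt x (A t (x t)) t := by
  have hk0 : 0 ≤ k := (norm_nonneg _).trans (hk 0)
  -- In the norm with weight `(cosh (b t))⁻¹`, the integral operator has norm at most `k / b < 1 / 2`.
  set b := 2 * k + 1 with hb
  have hb0 : 0 < b := by positivity
  have hcosh : ∀ t, 0 < Real.cosh (b * t) := fun t => Real.cosh_pos _
  have hkb : k * b⁻¹ ≤ 1 / 2 := by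
    rw [← div_eq_mul_inv, div_le_iff₀ hb0]
    linarith
  set u : (BoundedContinuousFunction ℝ E) → ℝ → E := fun y s => Real.cosh (b * s) • y s with hu
  have huc : ∀ y, Continuous (u y) := fun y => by
    have := y.continuous
    simp only [hu]
    fun_prop
  have hAu : ∀ y, Continuous fun s => A s (u y s) := fun y => hA.clm_apply (huc y)
  set f : (BoundedContinuousFunction ℝ E) → ℝ → E :=
    fun y t => (Real.cosh (b * t))⁻¹ • (x₀ + ∫ s in (0 : ℝ)..t, A s (u y s)) with hf
  have hprim : ∀ y t, HasDerivAt (fun t => ∫ s in (0 : ℝ)..t, A s (u y s)) (A t (u y t)) t :=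
    fun y t => intervalIntegral.integral_hasDerivAt_right ((hAu y).intervalIntegrable _ _)
      (hAu y).aestronglyMeasurable.stronglyMeasurableAtFilter (hAu y).continuousAt
  have hfc : ∀ y, Continuous (f y) := fun y => by
    have h1 : Continuous fun t => ∫ s in (0 : ℝ)..t, A s (u y s) :=
      continuous_iff_continuousAt.2 fun t => (hprim y t).continuousAt
    have h2 : Continuous fun t : ℝ => (Real.cosh (b * t))⁻¹ :=
      Continuous.inv₀ (by fun_prop) fun t => (hcosh t).ne'
    exact h2.smul (continuous_const.add h1)
  have hsub : ∀ y z t, ‖f y t - f z t‖ ≤ 1 / 2 * dist y z := by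
    intro y z t
    have e : f y t - f z t = (Real.cosh (b * t))⁻¹ • ∫ s in (0 : ℝ)..t, A s (u y s - u z s) := by
      simp only [hf, map_sub]
      rw [intervalIntegral.integral_sub ((hAu y).intervalIntegrable _ _)
        ((hAu z).intervalIntegrable _ _), ← smul_sub]
      congr 1
      abel
    have h1 := norm_integral_apply_le hk hb0 (u := fun s => u y s - u z s) (D := dist y z)
      (fun s => by
        simp only [hu]
        rw [← smul_sub, norm_smul, Real.norm_of_nonneg (hcosh s).le, ← dist_eq_norm]
        exact mul_le_mul_of_nonneg_left (BoundedContinuousFunction.dist_coe_le_dist s)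
          (hcosh s).le) t
    rw [e, norm_smul, norm_inv, Real.norm_of_nonneg (hcosh t).le]
    calc _ ≤ (Real.cosh (b * t))⁻¹ * (k * dist y z * (b⁻¹ * Real.cosh (b * t))) :=
          mul_le_mul_of_nonneg_left h1 (inv_nonneg.2 (hcosh t).le)
      _ = k * b⁻¹ * dist y z := by
          have := (hcosh t).ne'
          field_simp
      _ ≤ _ := by gcongr
  have hbd : ∀ y t, ‖f y t‖ ≤ ‖x₀‖ + 1 / 2 * dist y 0 := by
    intro y t
    have h1 := hsub y 0 t
    have h2 : ‖f 0 t‖ ≤ ‖x₀‖ := by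
      have e : f 0 t = (Real.cosh (b * t))⁻¹ • x₀ := by simp [hf, hu]
      rw [e, norm_smul, norm_inv, Real.norm_of_nonneg (hcosh t).le]
      exact mul_le_of_le_one_left (norm_nonneg _)
        (inv_le_one_of_one_le₀ (Real.one_le_cosh _))
    have h3 := norm_add_le (f y t - f 0 t) (f 0 t)
    rw [sub_add_cancel] at h3
    linarith
  set F : BoundedContinuousFunction ℝ E → BoundedContinuousFunction ℝ E := fun y =>
    BoundedContinuousFunction.ofNormedAddCommGroup (f y) (hfc y) _ (hbd y) with hF
  have hcontr : ContractingWith (1 / 2) F := by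
    refine ⟨by norm_num, LipschitzWith.of_dist_le_mul fun y z => ?_⟩
    rw [BoundedContinuousFunction.dist_le (by positivity)]
    intro t
    rw [dist_eq_norm]
    exact (hsub y z t).trans (le_of_eq (by norm_num))
  obtain ⟨y, hy⟩ : ∃ y, F y = y := ⟨_, hcontr.fixedPoint_isFixedPt⟩
  have hyt : ∀ t, u y t = x₀ + ∫ s in (0 : ℝ)..t, A s (u y s) := by
    intro t
    have h1 : f y t = y t := congrArg (fun z : BoundedContinuousFunction ℝ E => z t) hy
    simp only [hu]
    nth_rewrite 1 [← h1]
    simp only [hf, smul_smul]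
    rw [mul_inv_cancel₀ (hcosh t).ne', one_smul]
  refine ⟨u y, by simp [hyt 0], fun t => ?_⟩
  have h2 : u y = fun t => x₀ + ∫ s in (0 : ℝ)..t, A s (u y s) := funext hyt
  nth_rewrite 1 [h2]
  exact (hprim y t).const_add x₀

lemma linear_solution_unique (hk : ∀ t, ‖A t‖ ≤ k) {x y : ℝ → E}
    (hx : ∀ t, HasDerivAt x (A t (x t)) t) (hy : ∀ t, HasDerivAt y (A t (y t)) t) {t₀ : ℝ}
    (h0 : x t₀ = y t₀) : x = y := by
  have hk0 : 0 ≤ k := (norm_nonneg _).trans (hk 0)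
  refine ODE_solution_unique_univ (v := fun t z => A t z) (s := fun _ => univ) (K := k.toNNReal)
    (fun t => ?_) (fun t => ⟨hx t, trivial⟩) (fun t => ⟨hy t, trivial⟩) h0
  refine LipschitzOnWith.of_dist_le_mul fun z _ w _ => ?_
  rw [dist_eq_norm, dist_eq_norm, ← map_sub, Real.coe_toNNReal _ hk0]
  exact (A t).le_of_opNorm_le (hk t) _

/-- Grönwall's inequality for an inhomogeneous linear equation. -/
lemma norm_le_of_hasDerivAt_linear [CompleteSpace E] (hk : ∀ t, ‖A t‖ ≤ k) {z g : ℝ → E}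
    (hg : Continuous g) (hz : ∀ t, HasDerivAt z (A t (z t) + g t) t) {T t : ℝ}
    (ht : t ∈ Icc 0 T) :
    ‖z t‖ ≤ (‖z 0‖ + ∫ s in (0 : ℝ)..T, ‖g s‖) * Real.exp (k * T) := by
  have hk0 : 0 ≤ k := (norm_nonneg _).trans (hk 0)
  set η := ∫ s in (0 : ℝ)..T, ‖g s‖ with hη
  have hprim : ∀ t, HasDerivAt (fun t => ∫ s in (0 : ℝ)..t, g s) (g t) t := fun t =>
    intervalIntegral.integral_hasDerivAt_right (hg.intervalIntegrable _ _)
      hg.aestronglyMeasurable.stronglyMeasurableAtFilter hg.continuousAt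
  have hG : ∀ t ∈ Icc 0 T, ‖∫ s in (0 : ℝ)..t, g s‖ ≤ η := fun t ht =>
    (intervalIntegral.norm_integral_le_integral_norm ht.1).trans
      (intervalIntegral.integral_mono_interval le_rfl ht.1 ht.2
        (Eventually.of_forall fun s => norm_nonneg _) (hg.norm.intervalIntegrable _ _))
  have hη0 : 0 ≤ η := (norm_nonneg _).trans (hG t ht)
  -- The difference of `z` and the primitive of `g` solves an equation with a bounded inhomogeneity.
  have hq : ∀ t, HasDerivAt (fun t => z t - ∫ s in (0 : ℝ)..t, g s) (A t (z t)) t := fun t =>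
    ((hz t).sub (hprim t)).congr_deriv (by abel)
  have key := norm_le_gronwallBound_of_norm_deriv_right_le (a := 0) (b := T) (δ := ‖z 0‖) (K := k)
    (ε := k * η) (fun t _ => (hq t).continuousAt.continuousWithinAt)
    (fun t _ => (hq t).hasDerivWithinAt) (by simp) (fun t ht => by
      have h1 := norm_add_le (z t - ∫ s in (0 : ℝ)..t, g s) (∫ s in (0 : ℝ)..t, g s)
      rw [sub_add_cancel] at h1
      have h2 := hG t (Ico_subset_Icc_self ht)
      calc _ ≤ k * ‖z t‖ := (A t).le_of_opNorm_le (hk t) _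
        _ ≤ k * (‖z t - ∫ s in (0 : ℝ)..t, g s‖ + η) := by gcongr; linarith
        _ = _ := by ring) t ht
  have hbound : gronwallBound ‖z 0‖ k (k * η) (t - 0) ≤ (‖z 0‖ + η) * Real.exp (k * T) - η := by
    rw [sub_zero]
    have he : Real.exp (k * t) ≤ Real.exp (k * T) := Real.exp_le_exp.2 (by gcongr; exact ht.2)
    rcases eq_or_ne k 0 with h0 | h0
    · rw [h0, gronwallBound_K0]
      simp
    · rw [gronwallBound_of_K_ne_0 h0]
      have : k * η / k = η := by field_simp
      rw [this]
      calc _ = (‖z 0‖ + η) * Real.exp (k * t) - η := by ring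
        _ ≤ _ := by gcongr
  have h1 := norm_add_le (z t - ∫ s in (0 : ℝ)..t, g s) (∫ s in (0 : ℝ)..t, g s)
  rw [sub_add_cancel] at h1
  have h2 := hG t ht
  linarith

/-- The solution of a linear equation with given initial value. -/
def linearFlow [CompleteSpace E] (hA : Continuous A) (hk : ∀ t, ‖A t‖ ≤ k) (x₀ : E) : ℝ → E :=
  (exists_linear_solution hA hk x₀).choose

section Flow

variable [CompleteSpace E] (hA : Continuous A) (hk : ∀ t, ‖A t‖ ≤ k)

lemma linearFlow_zero (x₀ : E) : linearFlow hA hk x₀ 0 = x₀ :=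
  (exists_linear_solution hA hk x₀).choose_spec.1

lemma hasDerivAt_linearFlow (x₀ : E) (t : ℝ) :
    HasDerivAt (linearFlow hA hk x₀) (A t (linearFlow hA hk x₀ t)) t :=
  (exists_linear_solution hA hk x₀).choose_spec.2 t

/-- The monodromy operator: the map from initial values to values at time `T`. -/
def monodromy (T : ℝ) : E →ₗ[ℂ] E where
  toFun x₀ := linearFlow hA hk x₀ T
  map_add' x y := by
    have h := linear_solution_unique hk (hasDerivAt_linearFlow hA hk (x + y))
      (y := fun t => linearFlow hA hk x t + linearFlow hA hk y t)
      (fun t => ((hasDerivAt_linearFlow hA hk x t).add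
        (hasDerivAt_linearFlow hA hk y t)).congr_deriv (by rw [map_add])) (t₀ := 0)
      (by simp only [linearFlow_zero])
    exact congrFun h T
  map_smul' c x := by
    have h := linear_solution_unique hk (hasDerivAt_linearFlow hA hk (c • x))
      (y := fun t => c • linearFlow hA hk x t)
      (fun t => ((hasDerivAt_linearFlow hA hk x t).const_smul c).congr_deriv
        (by rw [map_smul])) (t₀ := 0) (by simp only [linearFlow_zero])
    exact congrFun h T

lemma monodromy_apply (T : ℝ) (x₀ : E) : monodromy hA hk T x₀ = linearFlow hA hk x₀ T := rfl

lemma norm_monodromy_le {T : ℝ} (hT : 0 ≤ T) (x₀ : E) :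
    ‖monodromy hA hk T x₀‖ ≤ Real.exp (k * T) * ‖x₀‖ := by
  have h := norm_le_of_hasDerivAt_linear hk (z := linearFlow hA hk x₀) (g := fun _ => 0)
    continuous_const (fun t => by simpa using hasDerivAt_linearFlow hA hk x₀ t)
    (right_mem_Icc.2 hT)
  rw [linearFlow_zero] at h
  rw [monodromy_apply]
  simpa [mul_comm] using h

/-- An approximate solution stays close to the flow. -/
lemma norm_sub_monodromy_le {T : ℝ} (hT : 0 ≤ T) {y g : ℝ → E} (hg : Continuous g)
    (hy : ∀ t, HasDerivAt y (A t (y t) + g t) t) :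
    ‖y T - monodromy hA hk T (y 0)‖ ≤ (∫ s in (0 : ℝ)..T, ‖g s‖) * Real.exp (k * T) := by
  have h := norm_le_of_hasDerivAt_linear hk (z := fun t => y t - linearFlow hA hk (y 0) t) hg
    (fun t => ((hy t).sub (hasDerivAt_linearFlow hA hk (y 0) t)).congr_deriv
      (by rw [map_sub]; abel)) (right_mem_Icc.2 hT)
  rw [linearFlow_zero, sub_self, norm_zero, zero_add] at h
  exact h

/-- An eigenvector of the monodromy operator is the initial value of a Floquet solution. -/
lemma linearFlow_add_period {T : ℝ} (hper : ∀ t, A (t + T) = A t) {c : ℂ} {x₀ : E}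
    (hx : monodromy hA hk T x₀ = c • x₀) (t : ℝ) :
    linearFlow hA hk x₀ (t + T) = c • linearFlow hA hk x₀ t := by
  have h := linear_solution_unique hk (x := fun t => linearFlow hA hk x₀ (t + T))
    (y := fun t => c • linearFlow hA hk x₀ t)
    (fun t => by
      have := (hasDerivAt_linearFlow hA hk x₀ (t + T)).comp_add_const t T
      rwa [hper] at this)
    (fun t => ((hasDerivAt_linearFlow hA hk x₀ t).const_smul c).congr_deriv
        (by rw [map_smul])) (t₀ := 0)
    (by rw [zero_add, linearFlow_zero, ← monodromy_apply, hx])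
  exact congrFun h t

end Flow

end LinearODE

/-! ### Approximate eigenvalues of operators in finite dimensions -/

section Eigenvalues

variable {E : Type*} [NormedAddCommGroup E] [NormedSpace ℂ E]

lemma norm_prod_sub_apply_le {Φ : Module.End ℂ E} {B ε : ℝ} (hB : 1 ≤ B)
    (hΦ : ∀ x, ‖Φ x‖ ≤ B * ‖x‖) {c : ℂ} (hc : ‖c‖ ≤ B) {y : E} (hε : ‖Φ y - c • y‖ ≤ ε)
    (s : Multiset ℂ) (hs : ∀ a ∈ s, ‖a‖ ≤ B) :
    ‖Polynomial.aeval Φ (s.map fun a => Polynomial.X - Polynomial.C a).prod y -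
      (s.map fun a => c - a).prod • y‖ ≤ s.card * (2 * B) ^ s.card * ε := by
  have hε0 : 0 ≤ ε := (norm_nonneg _).trans hε
  suffices h : ‖(s.map fun a => c - a).prod‖ ≤ (2 * B) ^ s.card ∧
      ‖Polynomial.aeval Φ (s.map fun a => Polynomial.X - Polynomial.C a).prod y -
      (s.map fun a => c - a).prod • y‖ ≤ s.card * (2 * B) ^ s.card * ε from h.2
  induction s using Multiset.induction_on with
  | empty => simp
  | cons a s ih =>
    obtain ⟨h1, h2⟩ := ih fun b hb => hs b (Multiset.mem_cons_of_mem hb)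
    have ha : ‖a‖ ≤ B := hs a (Multiset.mem_cons_self a s)
    have hca : ‖c - a‖ ≤ 2 * B := (norm_sub_le _ _).trans (by linarith)
    set q := (s.map fun a => Polynomial.X - Polynomial.C a).prod
    set p := (s.map fun a => c - a).prod
    simp only [Multiset.map_cons, Multiset.prod_cons, Multiset.card_cons]
    refine ⟨?_, ?_⟩
    · rw [norm_mul, pow_succ']
      gcongr
    · set w := Polynomial.aeval Φ q y - p • y with hw
      have e : Polynomial.aeval Φ ((Polynomial.X - Polynomial.C a) * q) y - ((c - a) * p) • y =
          (Φ w - a • w) + p • (Φ y - c • y) := by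
        rw [hw, map_mul, map_sub, Polynomial.aeval_X, Polynomial.aeval_C, Module.End.mul_apply,
          LinearMap.sub_apply, Module.algebraMap_end_apply, map_sub, map_smul]
        module
      have h3 : ‖Φ w - a • w‖ ≤ 2 * B * ‖w‖ := by
        refine (norm_sub_le _ _).trans ?_
        rw [norm_smul]
        have := hΦ w
        have := mul_le_mul_of_nonneg_right ha (norm_nonneg w)
        linarith
      rw [e]
      refine (norm_add_le _ _).trans ?_
      rw [norm_smul p]
      calc _ ≤ 2 * B * (s.card * (2 * B) ^ s.card * ε) + (2 * B) ^ s.card * ε := by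
            gcongr
            exact h3.trans (by gcongr)
        _ ≤ 2 * B * (s.card * (2 * B) ^ s.card * ε) + (2 * B) * ((2 * B) ^ s.card * ε) := by
            have : (2 * B) ^ s.card * ε ≤ 2 * B * ((2 * B) ^ s.card * ε) :=
              le_mul_of_one_le_left (by positivity) (by linarith)
            linarith
        _ = _ := by
            push_cast
            ring

/-- An approximate eigenvalue of an operator in finite dimensions is close to an eigenvalue: by the
Cayley–Hamilton theorem, the product of its distances to the eigenvalues is small. -/
lemma exists_eigenvalue_near [FiniteDimensional ℂ E] {Φ : Module.End ℂ E} {B ε τ : ℝ} (hB : 1 ≤ B)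
    (hΦ : ∀ x, ‖Φ x‖ ≤ B * ‖x‖) {c : ℂ} (hc : ‖c‖ ≤ B) {y : E} (hy : 1 ≤ ‖y‖)
    (hε : ‖Φ y - c • y‖ ≤ ε) (hτ : 0 < τ)
    (hτε : Module.finrank ℂ E * (2 * B) ^ Module.finrank ℂ E * ε < τ ^ Module.finrank ℂ E) :
    ∃ (a : ℂ) (x : E), x ≠ 0 ∧ Φ x = a • x ∧ ‖c - a‖ < τ := by
  by_contra! hcon
  have heig : ∀ a ∈ Φ.charpoly.roots, ∃ x : E, x ≠ 0 ∧ Φ x = a • x := by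
    intro a ha
    have h1 := (Φ.hasEigenvalue_iff_isRoot_charpoly a).2 (Polynomial.isRoot_of_mem_roots ha)
    obtain ⟨x, hx⟩ := h1.exists_hasEigenvector
    exact ⟨x, hx.2, hx.apply_eq_smul⟩
  have hroots : ∀ a ∈ Φ.charpoly.roots, ‖a‖ ≤ B := by
    intro a ha
    obtain ⟨x, hx0, hx⟩ := heig a ha
    have h1 := hΦ x
    rw [hx, norm_smul] at h1
    exact le_of_mul_le_mul_right h1 (norm_pos_iff.2 hx0)
  have hsplit := IsAlgClosed.splits Φ.charpoly
  have hcard : Φ.charpoly.roots.card = Module.finrank ℂ E := by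
    rw [← hsplit.natDegree_eq_card_roots, LinearMap.charpoly_natDegree]
  have hprod : (Φ.charpoly.roots.map fun a => Polynomial.X - Polynomial.C a).prod = Φ.charpoly := by
    have := hsplit.eq_prod_roots
    rw [(LinearMap.charpoly_monic Φ).leadingCoeff, Polynomial.C_1, one_mul] at this
    exact this.symm
  have key := norm_prod_sub_apply_le hB hΦ hc hε Φ.charpoly.roots hroots
  rw [hprod, LinearMap.aeval_self_charpoly, LinearMap.zero_apply, zero_sub, norm_neg, norm_smul,
    hcard] at key
  have hlow : ∀ s : Multiset ℂ, (∀ a ∈ s, τ ≤ ‖c - a‖) →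
      τ ^ s.card ≤ ‖(s.map fun a => c - a).prod‖ := by
    intro s
    induction s using Multiset.induction_on with
    | empty => simp
    | cons a s ih =>
      intro h
      rw [Multiset.map_cons, Multiset.prod_cons, Multiset.card_cons, norm_mul, pow_succ']
      have h1 := h a (Multiset.mem_cons_self a s)
      have h2 := ih fun b hb => h b (Multiset.mem_cons_of_mem hb)
      gcongr
  have h1 := hlow Φ.charpoly.roots fun a ha => by
    obtain ⟨x, hx0, hx⟩ := heig a ha
    exact hcon a x hx0 hx
  rw [hcard] at h1
  have h2 : τ ^ Module.finrank ℂ E ≤ ‖(Φ.charpoly.roots.map fun a => c - a).prod‖ * ‖y‖ :=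
    h1.trans (le_mul_of_one_le_right (norm_nonneg _) hy)
  linarith

end Eigenvalues

/-! ### The limiting equation as a first-order system -/

/-- The phase space of the limiting equation: amplitudes and momenta. -/
abbrev State (N : ℕ) := (Fin N → ℂ) × (Fin N → ℂ)

/-- The first-order form of the limiting equation, with momenta `p_i = (√δ κ_i)⁻¹ c_i'`. -/
def generator {N : ℕ} (P : Medium N) (G : Geometry N) (α : ℝ) (t : ℝ) : State N →L[ℂ] State N :=
  LinearMap.toContinuousLinearMap
    { toFun := fun y => (fun i => √P.δ * P.κ i t * y.2 i, fun i =>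
        -(√P.δ * ((P.vr : ℂ) ^ 2 / G.ell i)) *
          (P.s i t * ∑ j, G.capacitance α i j * (y.1 j / P.s j t)))
      map_add' := fun y z => by
        ext i
        · simp [mul_add]
        · simp [mul_add, add_div, Finset.sum_add_distrib]
      map_smul' := fun c y => by
        ext i
        · simp only [Prod.smul_snd, Pi.smul_apply, smul_eq_mul, RingHom.id_apply, Prod.smul_fst]
          ring
        · simp only [Prod.smul_snd, Pi.smul_apply, smul_eq_mul, RingHom.id_apply, Prod.smul_fst,
            Finset.mul_sum]
          exact Finset.sum_congr rfl fun j _ => by ring }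

section Generator

variable {N : ℕ} {P : Medium N} {G : Geometry N} {α : ℝ}

lemma generator_apply_fst (y : State N) (i : Fin N) (t : ℝ) :
    (generator P G α t y).1 i = √P.δ * P.κ i t * y.2 i := rfl

lemma generator_apply_snd (y : State N) (i : Fin N) (t : ℝ) :
    (generator P G α t y).2 i = -(√P.δ * ((P.vr : ℂ) ^ 2 / G.ell i)) *
      (P.s i t * ∑ j, G.capacitance α i j * (y.1 j / P.s j t)) := rfl

lemma continuous_generator (P : Medium N) (G : Geometry N) (α : ℝ) :
    Continuous (generator P G α) := by
  refine continuous_clm_apply.2 fun y => ?_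
  have h1 := continuous_κ_ofReal P
  have h2 := continuous_s_ofReal P
  have h4 : ∀ j t, (P.s j t : ℂ) ≠ 0 := fun j t => by exact_mod_cast P.s_ne_zero j t
  refine Continuous.prodMk (continuous_pi fun i => ?_) (continuous_pi fun i => ?_)
  · exact (continuous_const.mul (h1 i)).mul continuous_const
  · refine continuous_const.mul ((h2 i).mul (continuous_finsetSum _ fun j _ => ?_))
    exact continuous_const.mul (continuous_const.div (h2 j) (h4 j))

lemma κ_add_period (P : Medium N) (i : Fin N) (t : ℝ) : P.κ i (t + P.T) = P.κ i t := by
  have h := trigSum_periodic P.Ω_pos (band P.M) (P.kHat i) t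
  change trigSum P.Ω (band P.M) (P.kHat i) (t + P.T) = _ at h
  rw [P.hasSymbol_κ, P.hasSymbol_κ, one_div, one_div, inv_inj] at h
  exact_mod_cast h

lemma s_add_period (P : Medium N) (i : Fin N) (t : ℝ) : P.s i (t + P.T) = P.s i t := by
  have h := trigSum_periodic P.Ω_pos (band P.M) (P.sHat i) t
  change trigSum P.Ω (band P.M) (P.sHat i) (t + P.T) = _ at h
  rw [P.hasSymbol_s, P.hasSymbol_s, one_div, one_div, inv_inj] at h
  exact_mod_cast h

lemma generator_add_period (P : Medium N) (G : Geometry N) (α t : ℝ) :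
    generator P G α (t + P.T) = generator P G α t := by
  ext y i <;>
  simp only [generator_apply_fst, generator_apply_snd, κ_add_period, s_add_period,
    ContinuousLinearMap.comp_apply]

lemma InRegime.norm_generator_le {Λ : ℝ} (h : InRegime P G Λ) (α t : ℝ) :
    ‖generator P G α t‖ ≤ 4 * Λ ^ 6 * √P.δ := by
  have h0 := h.pos
  have h1 := h.one_le
  have hd := Real.sqrt_nonneg P.δ
  refine ContinuousLinearMap.opNorm_le_bound _ (by positivity) fun y => ?_
  have hy1 : ∀ j, ‖y.1 j‖ ≤ ‖y‖ := fun j => (norm_le_pi_norm y.1 j).trans (norm_fst_le y)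
  have hy2 : ∀ j, ‖y.2 j‖ ≤ ‖y‖ := fun j => (norm_le_pi_norm y.2 j).trans (norm_snd_le y)
  have hn := norm_nonneg y
  refine norm_prod_le_iff.2 ⟨(pi_norm_le_iff_of_nonneg (by positivity)).2 fun i => ?_,
    (pi_norm_le_iff_of_nonneg (by positivity)).2 fun i => ?_⟩
  · rw [generator_apply_fst, norm_mul, norm_mul, Complex.norm_real, Complex.norm_real,
      Real.norm_of_nonneg hd, Real.norm_of_nonneg (P.κ_pos i t).le]
    have hΛ : Λ ≤ 4 * Λ ^ 6 := by
      have : Λ ^ 1 ≤ Λ ^ 6 := pow_le_pow_right₀ h1 (by norm_num)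
      have := pow_pos h0 6
      linarith
    calc _ ≤ √P.δ * Λ * ‖y‖ := by
          gcongr
          · exact (h.κ_mem i t).2
          · exact hy2 i
      _ ≤ √P.δ * (4 * Λ ^ 6) * ‖y‖ := by gcongr
      _ = _ := by ring
  · have hb : ∀ j, ‖y.1 j / P.s j t‖ ≤ Λ * ‖y‖ := by
      intro j
      have h2 := (h.inv_mem (h.s_mem j t)).2.2
      rw [norm_div, Complex.norm_real, Real.norm_eq_abs, div_eq_mul_inv, mul_comm]
      gcongr
      exact hy1 j
    have h3 := h.norm_sum_capacitance_le α i (fun j => y.1 j / P.s j t)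
    have h4 := h.norm_s_le i t
    have hv := h.inv_mem h.vr_mem
    have hl := h.inv_mem (h.ell_mem i)
    have h5 : ‖-(√P.δ * ((P.vr : ℂ) ^ 2 / G.ell i))‖ ≤ √P.δ * Λ ^ 3 := by
      rw [norm_neg, norm_mul, norm_div, norm_pow, Complex.norm_real, Complex.norm_real,
        Complex.norm_real, Real.norm_of_nonneg hd, Real.norm_of_nonneg hv.1.le,
        Real.norm_of_nonneg hl.1.le, div_eq_mul_inv]
      gcongr
      calc P.vr ^ 2 * (G.ell i)⁻¹ ≤ Λ ^ 2 * Λ := by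
            gcongr
            · exact inv_nonneg.2 hl.1.le
            · exact hv.1.le
            · exact h.vr_mem.2
            · exact hl.2.2
        _ = _ := by ring
    rw [generator_apply_snd, norm_mul, norm_mul]
    calc _ ≤ √P.δ * Λ ^ 3 * (Λ * (Λ * (Λ * ‖y‖ + Λ * ‖y‖ + Λ * ‖y‖ + Λ * ‖y‖))) := by
          gcongr
          refine h3.trans ?_
          gcongr <;> exact hb _
      _ = _ := by ring

end Generator

/-! ### Floquet solutions of the first-order system solve the limiting equation -/

section Smoothness

variable {N : ℕ} (P : Medium N)

lemma contDiff_κ (i : Fin N) : ContDiff ℝ 2 (P.κ i) := by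
  have h1 : P.κ i = fun t => ((trigSum P.Ω (band P.M) (P.kHat i) t).re)⁻¹ := by
    funext t
    rw [P.hasSymbol_κ]
    norm_cast
    simp
  rw [h1]
  have h2 : ContDiff ℝ 2 (trigSum P.Ω (band P.M) (P.kHat i)) := by
    unfold trigSum
    have h3 : ContDiff ℝ 2 (fun t : ℝ => (t : ℂ)) := Complex.ofRealCLM.contDiff
    refine ContDiff.sum fun n _ => contDiff_const.mul ?_
    exact (contDiff_const.mul h3).cexp
  refine ContDiff.inv (Complex.reCLM.contDiff.comp h2) fun t => ?_
  change (trigSum P.Ω (band P.M) (P.kHat i) t).re ≠ 0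
  rw [P.hasSymbol_κ]
  norm_cast
  simpa using (P.κ_pos i t).ne'

lemma hasDerivAt_sqrt_κ (i : Fin N) (t : ℝ) :
    HasDerivAt (fun t => √(P.κ i t)) (deriv (P.κ i) t / (2 * √(P.κ i t))) t :=
  (((contDiff_κ P i).differentiable (by norm_num)) t).hasDerivAt.sqrt (P.κ_pos i t).ne'

lemma κ_rpow (i : Fin N) (t : ℝ) : P.κ i t ^ (3 / 2 : ℝ) = √(P.κ i t) ^ 3 := by
  rw [Real.sqrt_eq_rpow, ← Real.rpow_natCast, ← Real.rpow_mul (P.κ_pos i t).le]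
  norm_num

lemma hasDerivAt_inv_sqrt_κ (i : Fin N) (t : ℝ) :
    HasDerivAt (fun t => (√(P.κ i t))⁻¹) (-(deriv (P.κ i) t / P.κ i t ^ (3 / 2 : ℝ) / 2)) t := by
  have hw := Real.sqrt_pos.2 (P.κ_pos i t)
  refine ((hasDerivAt_sqrt_κ P i t).inv hw.ne').congr_deriv ?_
  rw [κ_rpow]
  field_simp

lemma hasDerivAt_log_slope (i : Fin N) (t : ℝ) :
    HasDerivAt (fun t => deriv (P.κ i) t / P.κ i t ^ (3 / 2 : ℝ))
      (deriv (fun t => deriv (P.κ i) t / P.κ i t ^ (3 / 2 : ℝ)) t) t := by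
  have h1 : ContDiff ℝ 1 (deriv (P.κ i)) := ((contDiff_succ_iff_deriv (n := 1)).1
    (by rw [one_add_one_eq_two]; exact contDiff_κ P i)).2.2
  have h2 : (fun t => P.κ i t ^ (3 / 2 : ℝ)) = fun t => √(P.κ i t) ^ 3 := funext (κ_rpow P i)
  have h3 : Differentiable ℝ fun t => P.κ i t ^ (3 / 2 : ℝ) := by
    rw [h2]
    exact Differentiable.pow (fun t => (hasDerivAt_sqrt_κ P i t).differentiableAt) 3
  exact ((h1.differentiable (by norm_num) t).div (h3 t)
    (Real.rpow_pos_of_pos (P.κ_pos i t) _).ne').hasDerivAt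

lemma vr_sq : P.vr ^ 2 = P.κr / P.ρr :=
  Real.sq_sqrt (div_pos P.κr_pos P.ρr_pos).le

/-- A Floquet solution of the first-order system yields a quasifrequency. The weights in
`odeMatrix` come from the substitution `Ψ_i = κ_i^{-1/2} c_i`. -/
lemma isODEQuasifrequency_of_generator {P : Medium N} {G : Geometry N} {α : ℝ} {ω : ℂ}
    {x : ℝ → State N} (hx : ∀ t, HasDerivAt x (generator P G α t (x t)) t) (hx0 : x 0 ≠ 0)
    (hper : ∀ t, x (t + P.T) = Complex.exp (Complex.I * ω * P.T) • x t) :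
    P.IsODEQuasifrequency G α ω := by
  have hw : ∀ i t, 0 < √(P.κ i t) := fun i t => Real.sqrt_pos.2 (P.κ_pos i t)
  have hd : 0 < √P.δ := Real.sqrt_pos.2 P.δ_pos
  have hx1 : ContDiff ℝ 1 x := by
    refine contDiff_one_iff_deriv.2 ⟨fun t => (hx t).differentiableAt, ?_⟩
    rw [funext fun t => (hx t).deriv]
    exact (continuous_generator P G α).clm_apply
      (continuous_iff_continuousAt.2 fun t => (hx t).continuousAt)
  have hc : ∀ i t, HasDerivAt (fun t => (x t).1 i) (√P.δ * P.κ i t * (x t).2 i) t := fun i t =>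
    hasDerivAt_pi.1 (hx t).fst i
  have hp : ∀ i t, HasDerivAt (fun t => (x t).2 i) (-(√P.δ * ((P.vr : ℂ) ^ 2 / G.ell i)) *
      (P.s i t * ∑ j, G.capacitance α i j * ((x t).1 j / P.s j t))) t := fun i t =>
    hasDerivAt_pi.1 (hx t).snd i
  have hc2 : ∀ i, ContDiff ℝ 2 fun t => (x t).1 i := by
    intro i
    have h1 : ContDiff ℝ (1 + 1) fun t => (x t).1 i := by
      refine contDiff_succ_iff_deriv.2 ⟨fun t => (hc i t).differentiableAt, by simp, ?_⟩
      rw [funext fun t => (hc i t).deriv]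
      have h2 : ContDiff ℝ 1 fun t => (P.κ i t : ℂ) :=
        Complex.ofRealCLM.contDiff.comp ((contDiff_κ P i).of_le (by norm_num))
      have h3 : ContDiff ℝ 1 fun t => (x t).2 i := contDiff_pi.1 hx1.snd i
      exact (contDiff_const.mul h2).mul h3
    simpa [one_add_one_eq_two] using h1
  have hr2 : ∀ i, ContDiff ℝ 2 fun t => (((√(P.κ i t))⁻¹ : ℝ) : ℂ) := fun i =>
    Complex.ofRealCLM.contDiff.comp (((contDiff_κ P i).sqrt fun t => (P.κ_pos i t).ne').inv
      fun t => (hw i t).ne')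
  set Ψ : ℝ → Fin N → ℂ := fun t i => (((√(P.κ i t))⁻¹ : ℝ) : ℂ) * (x t).1 i with hΨ
  set q : Fin N → ℝ → ℝ := fun i t => deriv (P.κ i) t / P.κ i t ^ (3 / 2 : ℝ) with hq
  have hΨ1 : ∀ t, HasDerivAt Ψ (fun i => -((q i t : ℝ) : ℂ) / 2 * (x t).1 i +
      √P.δ * ((√(P.κ i t) : ℝ) : ℂ) * (x t).2 i) t := by
    intro t
    refine hasDerivAt_pi.2 fun i => ?_
    refine ((hasDerivAt_inv_sqrt_κ P i t).ofReal_comp.mul (hc i t)).congr_deriv ?_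
    have hwc : ((√(P.κ i t) : ℝ) : ℂ) ≠ 0 := by exact_mod_cast (hw i t).ne'
    have hκ : (P.κ i t : ℂ) = ((√(P.κ i t) : ℝ) : ℂ) ^ 2 := by
      norm_cast
      exact (Real.sq_sqrt (P.κ_pos i t).le).symm
    simp only [hq]
    rw [hκ]
    push_cast
    field_simp
  have hΨ2 : ∀ t, HasDerivAt (deriv Ψ) (fun i => -((deriv (q i) t : ℝ) : ℂ) / 2 * (x t).1 i +
      √P.δ * ((√(P.κ i t) : ℝ) : ℂ) * (-(√P.δ * ((P.vr : ℂ) ^ 2 / G.ell i)) *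
      (P.s i t * ∑ j, G.capacitance α i j * ((x t).1 j / P.s j t)))) t := by
    intro t
    rw [funext fun t => (hΨ1 t).deriv]
    refine hasDerivAt_pi.2 fun i => ?_
    set p' := -(√P.δ * ((P.vr : ℂ) ^ 2 / G.ell i)) *
      (P.s i t * ∑ j, G.capacitance α i j * ((x t).1 j / P.s j t))
    have h1 : HasDerivAt (fun t => -((q i t : ℝ) : ℂ) / 2 * (x t).1 i)
        (-((deriv (q i) t : ℝ) : ℂ) / 2 * (x t).1 i +
          -((q i t : ℝ) : ℂ) / 2 * (√P.δ * P.κ i t * (x t).2 i)) t :=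
      ((hasDerivAt_log_slope P i t).ofReal_comp.neg.div_const 2).mul (hc i t)
    have h2 : HasDerivAt (fun t => √P.δ * ((√(P.κ i t) : ℝ) : ℂ) * (x t).2 i)
        (√P.δ * ((deriv (P.κ i) t / (2 * √(P.κ i t)) : ℝ) : ℂ) * (x t).2 i +
          √P.δ * ((√(P.κ i t) : ℝ) : ℂ) * p') t :=
      ((hasDerivAt_sqrt_κ P i t).ofReal_comp.const_mul (√P.δ : ℂ)).mul (hp i t)
    refine (h1.add h2).congr_deriv ?_
    have hwc : ((√(P.κ i t) : ℝ) : ℂ) ≠ 0 := by exact_mod_cast (hw i t).ne'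
    have hκ : (P.κ i t : ℂ) = ((√(P.κ i t) : ℝ) : ℂ) ^ 2 := by
      norm_cast
      exact (Real.sq_sqrt (P.κ_pos i t).le).symm
    have h3 : ((q i t : ℝ) : ℂ) =
        ((deriv (P.κ i) t : ℝ) : ℂ) / ((√(P.κ i t) : ℝ) : ℂ) ^ 3 := by
      simp only [hq]
      rw [κ_rpow]
      push_cast
      rfl
    rw [h3, hκ]
    push_cast
    field_simp
    ring
  refine ⟨Ψ, ?_, contDiff_pi.2 fun i => (hr2 i).mul (hc2 i), fun t => ?_, fun t => ?_⟩
  · intro h0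
    have hc0 : ∀ i t, (x t).1 i = 0 := by
      intro i t
      have h1 := congrFun (congrFun h0 t) i
      have h2 : (((√(P.κ i t))⁻¹ : ℝ) : ℂ) ≠ 0 := by exact_mod_cast (inv_pos.2 (hw i t)).ne'
      exact (mul_eq_zero.1 h1).resolve_left h2
    have hp0 : ∀ i t, (x t).2 i = 0 := by
      intro i t
      have h1 := (hc i t).unique ((hasDerivAt_const t (0 : ℂ)).congr_of_eventuallyEq
        (Eventually.of_forall fun t => hc0 i t))
      have h2 : (√P.δ : ℂ) * P.κ i t ≠ 0 :=
        mul_ne_zero (by exact_mod_cast hd.ne') (by exact_mod_cast (P.κ_pos i t).ne')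
      exact (mul_eq_zero.1 h1).resolve_left h2
    exact hx0 (Prod.ext (funext fun i => hc0 i 0) (funext fun i => hp0 i 0))
  · rw [(hΨ2 t).deriv]
    have hv : (P.vr : ℂ) ^ 2 = P.κr / P.ρr := by
      exact_mod_cast vr_sq P
    have hd2 : (P.δ : ℂ) = ((√P.δ : ℝ) : ℂ) ^ 2 := by
      norm_cast
      exact (Real.sq_sqrt P.δ_pos.le).symm
    ext i
    simp only [Medium.odeMatrix, Matrix.add_mulVec, Matrix.smul_mulVec, Pi.add_apply,
      Pi.smul_apply, Pi.zero_apply, ← Matrix.mulVec_mulVec, Medium.W₁, Medium.W₂, Medium.W₃,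
      Matrix.mulVec_diagonal, smul_eq_mul]
    have e1 : ∑ j, G.capacitance α i j * ((x t).1 j / P.s j t) =
        (G.capacitance α).mulVec (Matrix.mulVec
          (Matrix.diagonal fun i => ((√(P.κ i t) / P.s i t : ℝ) : ℂ)) (Ψ t)) i := by
      rw [Matrix.mulVec, dotProduct]
      refine Finset.sum_congr rfl fun j _ => ?_
      rw [Matrix.mulVec_diagonal]
      have hwc : ((√(P.κ j t) : ℝ) : ℂ) ≠ 0 := by exact_mod_cast (hw j t).ne'
      simp only [hΨ]
      push_cast
      field_simp
    rw [← e1, hv]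
    have hwc : ((√(P.κ i t) : ℝ) : ℂ) ≠ 0 := by exact_mod_cast (hw i t).ne'
    simp only [hΨ, hq]
    push_cast
    rw [hd2]
    field_simp
    ring
  · funext i
    simp only [hΨ, hper, κ_add_period, Prod.smul_fst, Pi.smul_apply, smul_eq_mul]
    ring

end Smoothness

/-! ### Quasifrequencies of the limiting equation near a subwavelength quasifrequency -/

lemma integral_norm_le_sqrt_msq {Ω : ℝ} (hΩ : 0 < Ω) {h : ℝ → ℂ} (hh : Continuous h) {b : ℝ}
    (hb : msq Ω h ≤ b) :
    ∫ t in (0 : ℝ)..2 * Real.pi / Ω, ‖h t‖ ≤ 2 * Real.pi / Ω * √b := by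
  have hT := two_pi_div_pos hΩ
  have h1 := sq_integral_le hh.norm hT
  have h2 : (2 * Real.pi / Ω - 0) * ∫ t in (0 : ℝ)..2 * Real.pi / Ω, ‖h t‖ ^ 2 =
      (2 * Real.pi / Ω) ^ 2 * msq Ω h := by
    unfold msq
    have := Real.pi_pos
    field_simp
    ring
  rw [h2] at h1
  have hb0 : 0 ≤ b := (msq_nonneg hΩ h).trans hb
  refine abs_le_of_sq_le_sq' ?_ (by positivity) |>.2
  rw [mul_pow, Real.sq_sqrt hb0]
  exact h1.trans (by gcongr)

lemma msq_le_of_norm_le {Ω : ℝ} (hΩ : 0 < Ω) {h : ℝ → ℂ} (hh : Continuous h) {D : ℝ}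
    (hD : ∀ t ∈ Icc 0 (2 * Real.pi / Ω), ‖h t‖ ≤ D) : msq Ω h ≤ D ^ 2 := by
  have hT := two_pi_div_pos hΩ
  have h1 := intervalIntegral.integral_mono_on (μ := MeasureTheory.volume) hT.le
    (f := fun t => ‖h t‖ ^ 2) (g := fun _ => D ^ 2)
    (Continuous.intervalIntegrable (by fun_prop) _ _)
    (Continuous.intervalIntegrable (by fun_prop) _ _)
    (fun t ht => by have := hD t ht; gcongr)
  rw [intervalIntegral.integral_const, smul_eq_mul, sub_zero] at h1
  unfold msq
  have := Real.pi_pos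
  calc _ ≤ Ω / (2 * Real.pi) * (2 * Real.pi / Ω * D ^ 2) := by gcongr
    _ = _ := by field_simp

section MeanState

variable {N : ℕ}

/-- The truncated means of a Bloch wave, as a curve in the phase space of the limiting equation. -/
def meanState (P : Medium N) (G : Geometry N) (ω : ℂ) (v : Fin N → ℤ → ℝ → ℂ) (I : ℕ) (t : ℝ) :
    State N :=
  (fun i => Complex.exp (Complex.I * ω * t) * amplitude P G v I i t,
    fun i => Complex.exp (Complex.I * ω * t) * momentum P G ω v I i t)

/-- The residual of `meanState` in the limiting equation. -/
def residual (P : Medium N) (G : Geometry N) (α : ℝ) (ω : ℂ) (v dv : Fin N → ℤ → ℝ → ℂ) (I : ℕ)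
    (t : ℝ) : State N :=
  (fun i => -(√P.δ * P.κ i t * (Complex.exp (Complex.I * ω * t) * amplitudeError P G ω v I i t)),
    fun i => √P.δ * ((P.vr : ℂ) ^ 2 / G.ell i) *
      (Complex.exp (Complex.I * ω * t) * momentumError P G α v dv I i t))

lemma continuous_residual (P : Medium N) (G : Geometry N) (α : ℝ) (ω : ℂ)
    (v dv : Fin N → ℤ → ℝ → ℂ) (I : ℕ) : Continuous (residual P G α ω v dv I) := by
  have h1 := continuous_κ_ofReal P
  have h2 := continuous_amplitudeError P G ω v I
  have h3 := continuous_momentumError P G α v dv I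
  have h4 : Continuous fun t : ℝ => Complex.exp (Complex.I * ω * t) := by fun_prop
  refine Continuous.prodMk (continuous_pi fun i => ?_) (continuous_pi fun i => ?_)
  · exact ((continuous_const.mul (h1 i)).mul (h4.mul (h2 i))).neg
  · exact continuous_const.mul (h4.mul (h3 i))

lemma meanState_period (P : Medium N) (G : Geometry N) (ω : ℂ) (v : Fin N → ℤ → ℝ → ℂ) (I : ℕ) :
    meanState P G ω v I P.T = Complex.exp (Complex.I * ω * P.T) • meanState P G ω v I 0 := by
  have h1 : ∀ i, amplitude P G v I i P.T = amplitude P G v I i 0 := fun i => by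
    have := trigSum_periodic P.Ω_pos (band I) (meanValue G v i) 0
    rwa [zero_add] at this
  have h2 : ∀ i, momentum P G ω v I i P.T = momentum P G ω v I i 0 := fun i => by
    have := trigSum_periodic P.Ω_pos (band (I + P.M)) (momentumCoeff P G ω v i) 0
    rw [zero_add] at this
    unfold momentum Medium.T
    rw [this]
  ext i
  · simp [meanState, h1]
  · simp [meanState, h2]

lemma norm_exp_le {P : Medium N} {ω : ℂ} {Θ t : ℝ} (hΘ : |ω.im| * P.T ≤ Θ) (ht : |t| ≤ P.T) :
    ‖Complex.exp (Complex.I * ω * t)‖ ≤ Real.exp Θ ∧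
      Real.exp (-Θ) ≤ ‖Complex.exp (Complex.I * ω * t)‖ := by
  have e : (Complex.I * ω * t).re = -(ω.im * t) := by simp
  have h1 : |ω.im * t| ≤ Θ := by
    rw [abs_mul]
    exact (by gcongr : |ω.im| * |t| ≤ |ω.im| * P.T).trans hΘ
  rw [Complex.norm_exp, e]
  rw [abs_le] at h1
  exact ⟨Real.exp_le_exp.2 (by linarith), Real.exp_le_exp.2 (by linarith)⟩

lemma InRegime.sqrt_δ_mul_T_le {P : Medium N} {G : Geometry N} {Λ : ℝ} (h : InRegime P G Λ) :
    √P.δ * P.T ≤ 7 * Λ := by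
  have h0 := h.pos
  have h1 := h.Ω_mem.1
  have hΩ := P.Ω_pos
  have h2 : √P.δ ≤ Λ * P.Ω := by
    rwa [inv_mul_le_iff₀ h0] at h1
  unfold Medium.T
  rw [mul_div_assoc', div_le_iff₀ hΩ]
  have := Real.pi_lt_d2
  have := Real.pi_pos
  calc √P.δ * (2 * Real.pi) ≤ Λ * P.Ω * 7 := by gcongr; linarith
    _ = _ := by ring

namespace IsControlled

variable {P : Medium N} {G : Geometry N} {α : ℝ} {ω : ℂ} {v dv ddv : Fin N → ℤ → ℝ → ℂ}
  {Λ ρ : ℝ} {J r : ℕ}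

lemma hasDerivAt_meanState (h : IsControlled P G α ω v dv ddv Λ ρ J r) (I : ℕ) (t : ℝ) :
    HasDerivAt (meanState P G ω v I)
      (generator P G α t (meanState P G ω v I t) + residual P G α ω v dv I t) t := by
  refine HasDerivAt.congr_deriv (HasDerivAt.prodMk
    (hasDerivAt_pi.2 fun i => hasDerivAt_amplitude P G ω v I i t)
    (hasDerivAt_pi.2 fun i => h.hasDerivAt_momentum I i t)) ?_
  ext i
  · rw [Prod.fst_add, Pi.add_apply, generator_apply_fst]
    simp only [meanState, residual]
    ring
  · rw [Prod.snd_add, Pi.add_apply, generator_apply_snd]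
    simp only [meanState, residual, mul_div_assoc, mul_left_comm _ (Complex.exp _),
      ← Finset.mul_sum]
    ring

lemma integral_residual_le (h : IsControlled P G α ω v dv ddv Λ ρ J r) {I : ℕ} {Θ b : ℝ}
    (hΘ : |ω.im| * P.T ≤ Θ) (ha : ∀ i, msq P.Ω (amplitudeError P G ω v I i) ≤ b)
    (hm : ∀ i, msq P.Ω (momentumError P G α v dv I i) ≤ b) :
    ∫ t in (0 : ℝ)..P.T, ‖residual P G α ω v dv I t‖ ≤ 14 * N * Λ ^ 4 * Real.exp Θ * √b := by
  have h0 := h.regime.pos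
  have hd := Real.sqrt_nonneg P.δ
  have hT := P.T_pos
  have c1 := continuous_amplitudeError P G ω v I
  have c2 := continuous_momentumError P G α v dv I
  have hpt : ∀ t ∈ Icc 0 P.T, ‖residual P G α ω v dv I t‖ ≤ √P.δ * Λ ^ 3 * Real.exp Θ *
      ∑ i, (‖amplitudeError P G ω v I i t‖ + ‖momentumError P G α v dv I i t‖) := by
    intro t ht
    have he := (norm_exp_le hΘ (by rw [abs_of_nonneg ht.1]; exact ht.2)).1
    have hs : ∀ i, ‖amplitudeError P G ω v I i t‖ + ‖momentumError P G α v dv I i t‖ ≤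
        ∑ i, (‖amplitudeError P G ω v I i t‖ + ‖momentumError P G α v dv I i t‖) := fun i =>
      Finset.single_le_sum (f := fun i => ‖amplitudeError P G ω v I i t‖ +
        ‖momentumError P G α v dv I i t‖) (fun i _ => by positivity) (Finset.mem_univ i)
    have hb0 : 0 ≤ √P.δ * Λ ^ 3 * Real.exp Θ *
      ∑ i, (‖amplitudeError P G ω v I i t‖ + ‖momentumError P G α v dv I i t‖) := by positivity
    refine norm_prod_le_iff.2 ⟨(pi_norm_le_iff_of_nonneg hb0).2 fun i => ?_,
      (pi_norm_le_iff_of_nonneg hb0).2 fun i => ?_⟩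
    · have hn := norm_nonneg (momentumError P G α v dv I i t)
      have hκ : P.κ i t ≤ Λ ^ 3 := (h.regime.κ_mem i t).2.trans (by
        simpa using h.one_le_pow (show 1 ≤ 3 by norm_num))
      simp only [residual, norm_neg, norm_mul, Complex.norm_real, Real.norm_of_nonneg hd,
        Real.norm_of_nonneg (P.κ_pos i t).le]
      calc _ ≤ √P.δ * Λ ^ 3 * (Real.exp Θ * ‖amplitudeError P G ω v I i t‖) := by gcongr
        _ = √P.δ * Λ ^ 3 * Real.exp Θ * ‖amplitudeError P G ω v I i t‖ := by ring
        _ ≤ _ := by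
          gcongr
          linarith [hs i]
    · have hn := norm_nonneg (amplitudeError P G ω v I i t)
      have hv := h.regime.inv_mem h.regime.vr_mem
      have hl := h.regime.inv_mem (h.regime.ell_mem i)
      have hvl : P.vr ^ 2 / G.ell i ≤ Λ ^ 3 := by
        rw [div_eq_mul_inv]
        calc P.vr ^ 2 * (G.ell i)⁻¹ ≤ Λ ^ 2 * Λ := by
              gcongr
              · exact inv_nonneg.2 hl.1.le
              · exact hv.1.le
              · exact h.regime.vr_mem.2
              · exact hl.2.2
          _ = _ := by ring
      simp only [residual, norm_mul, norm_div, norm_pow, Complex.norm_real,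
        Real.norm_of_nonneg hd, Real.norm_of_nonneg hv.1.le, Real.norm_of_nonneg hl.1.le]
      calc _ ≤ √P.δ * Λ ^ 3 * (Real.exp Θ * ‖momentumError P G α v dv I i t‖) := by gcongr
        _ = √P.δ * Λ ^ 3 * Real.exp Θ * ‖momentumError P G α v dv I i t‖ := by ring
        _ ≤ _ := by
          gcongr
          linarith [hs i]
  have h1 := intervalIntegral.integral_mono_on (μ := MeasureTheory.volume) hT.le
    ((continuous_residual P G α ω v dv I).norm.intervalIntegrable _ _)
    (Continuous.intervalIntegrable (by fun_prop) _ _) hpt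
  rw [intervalIntegral.integral_const_mul, intervalIntegral.integral_finsetSum
    (fun i _ => Continuous.intervalIntegrable (by have := c1 i; have := c2 i; fun_prop) _ _)] at h1
  have h2 : ∀ i, ∫ t in (0 : ℝ)..P.T,
      (‖amplitudeError P G ω v I i t‖ + ‖momentumError P G α v dv I i t‖) ≤ 2 * P.T * √b := by
    intro i
    rw [intervalIntegral.integral_add ((c1 i).norm.intervalIntegrable _ _)
      ((c2 i).norm.intervalIntegrable _ _)]
    have a1 := integral_norm_le_sqrt_msq P.Ω_pos (c1 i) (ha i)
    have a2 := integral_norm_le_sqrt_msq P.Ω_pos (c2 i) (hm i)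
    change _ ≤ P.T * √b at a1 a2
    unfold Medium.T at *
    linarith
  calc _ ≤ _ := h1
    _ ≤ √P.δ * Λ ^ 3 * Real.exp Θ * ∑ _i : Fin N, 2 * P.T * √b := by
        gcongr with i
        exact h2 i
    _ = 2 * N * Λ ^ 3 * Real.exp Θ * √b * (√P.δ * P.T) := by
        simp
        ring
    _ ≤ 2 * N * Λ ^ 3 * Real.exp Θ * √b * (7 * Λ) :=
        mul_le_mul_of_nonneg_left h.regime.sqrt_δ_mul_T_le (by positivity)
    _ = _ := by ring

/-- The mean squares of amplitude and momentum are controlled by their initial values. -/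
lemma msq_meanState_le (h : IsControlled P G α ω v dv ddv Λ ρ J r) {I : ℕ} {Θ η : ℝ}
    (hΘ : |ω.im| * P.T ≤ Θ)
    (hη : ∫ t in (0 : ℝ)..P.T, ‖residual P G α ω v dv I t‖ ≤ η) (i : Fin N) :
    msq P.Ω (amplitude P G v I i) ≤
        (Real.exp Θ * Real.exp (28 * Λ ^ 7) * (‖meanState P G ω v I 0‖ + η)) ^ 2 ∧
      msq P.Ω (momentum P G ω v I i) ≤
        (Real.exp Θ * Real.exp (28 * Λ ^ 7) * (‖meanState P G ω v I 0‖ + η)) ^ 2 := by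
  have h0 := h.regime.pos
  have hkT : 4 * Λ ^ 6 * √P.δ * P.T ≤ 28 * Λ ^ 7 := by
    calc _ = 4 * Λ ^ 6 * (√P.δ * P.T) := by ring
      _ ≤ 4 * Λ ^ 6 * (7 * Λ) :=
        mul_le_mul_of_nonneg_left h.regime.sqrt_δ_mul_T_le (by positivity)
      _ = _ := by ring
  have hy : ∀ t ∈ Icc 0 P.T, ‖meanState P G ω v I t‖ ≤
      (‖meanState P G ω v I 0‖ + η) * Real.exp (28 * Λ ^ 7) := by
    intro t ht
    refine (norm_le_of_hasDerivAt_linear (h.regime.norm_generator_le α)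
      (continuous_residual P G α ω v dv I) (h.hasDerivAt_meanState I) ht).trans ?_
    gcongr
    exact add_nonneg (norm_nonneg _) ((intervalIntegral.integral_nonneg P.T_pos.le
      fun t _ => norm_nonneg (residual P G α ω v dv I t)).trans hη)
  have key : ∀ {t : ℝ} {z : ℂ}, t ∈ Icc 0 P.T →
      ‖Complex.exp (Complex.I * ω * t) * z‖ ≤ ‖meanState P G ω v I t‖ →
      ‖z‖ ≤ Real.exp Θ * Real.exp (28 * Λ ^ 7) * (‖meanState P G ω v I 0‖ + η) := by
    intro t z ht hz
    have he := (norm_exp_le hΘ (by rw [abs_of_nonneg ht.1]; exact ht.2)).2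
    rw [norm_mul] at hz
    have h1 : Real.exp (-Θ) * ‖z‖ ≤ (‖meanState P G ω v I 0‖ + η) * Real.exp (28 * Λ ^ 7) :=
      (mul_le_mul_of_nonneg_right he (norm_nonneg z)).trans (hz.trans (hy t ht))
    rw [Real.exp_neg, inv_mul_le_iff₀ (Real.exp_pos _)] at h1
    exact h1.trans (le_of_eq (by ring))
  exact ⟨msq_le_of_norm_le P.Ω_pos (continuous_amplitude P G v I i) fun t ht => key ht
      ((norm_le_pi_norm (meanState P G ω v I t).1 i).trans (norm_fst_le _)),
    msq_le_of_norm_le P.Ω_pos (continuous_momentum P G ω v I i) fun t ht => key ht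
      ((norm_le_pi_norm (meanState P G ω v I t).2 i).trans (norm_snd_le _))⟩

end IsControlled

end MeanState

section Near

variable {N : ℕ} {P : Medium N} {G : Geometry N} {α : ℝ}

/-- A quasifrequency is recovered from an eigenvalue of the monodromy operator by a logarithm. -/
lemma InRegime.exists_quasifrequency_of_eigenvalue {Λ : ℝ} (h : InRegime P G Λ) {ω : ℂ}
    {Θ τ ε : ℝ} (hΘ : |ω.im| * P.T ≤ Θ) {a : ℂ} {x : State N} (hx : x ≠ 0)
    (hax : monodromy (continuous_generator P G α) (h.norm_generator_le α) P.T x = a • x)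
    (hclose : ‖Complex.exp (Complex.I * ω * P.T) - a‖ < τ)
    (hτ : τ ≤ Real.exp (-Θ) / 2) (hτε : τ ≤ Real.exp (-Θ) * ε / Λ) :
    ∃ ω₀, P.IsODEQuasifrequency G α ω₀ ∧ ‖ω - ω₀‖ ≤ ε * √P.δ := by
  have h0 := h.pos
  have hT := P.T_pos
  have hTc : (P.T : ℂ) ≠ 0 := by exact_mod_cast hT.ne'
  set μ := Complex.exp (Complex.I * ω * P.T) with hμ
  have hμ0 : μ ≠ 0 := Complex.exp_ne_zero _
  have hμlow : Real.exp (-Θ) ≤ ‖μ‖ := (norm_exp_le hΘ (by rw [abs_of_pos hT])).2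
  have hm := Real.exp_pos (-Θ)
  set ζ := (a - μ) / μ with hζ
  have hζle : ‖ζ‖ ≤ τ / Real.exp (-Θ) := by
    rw [hζ, norm_div, norm_sub_rev]
    have : 0 ≤ τ := (norm_nonneg _).trans hclose.le
    gcongr
  have hζ2 : ‖ζ‖ ≤ 1 / 2 := by
    refine hζle.trans ?_
    rw [div_le_iff₀ hm]
    linarith
  have hζε : ‖ζ‖ ≤ ε / Λ := by
    refine hζle.trans ?_
    rw [div_le_iff₀ hm]
    exact hτε.trans (le_of_eq (by ring))
  have h1ζ : 1 + ζ = a / μ := by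
    rw [hζ]
    field_simp
    ring
  have h1ζ0 : 1 + ζ ≠ 0 := by
    intro h1
    have : ζ = -1 := by linear_combination h1
    rw [this, norm_neg, norm_one] at hζ2
    norm_num at hζ2
  set ω₀ := ω - Complex.I * Complex.log (1 + ζ) / P.T with hω₀
  have hexp : Complex.exp (Complex.I * ω₀ * P.T) = a := by
    have e : Complex.I * ω₀ * P.T = Complex.I * ω * P.T + Complex.log (1 + ζ) := by
      rw [hω₀]
      field_simp
      linear_combination -Complex.log (1 + ζ) * Complex.I_sq
    rw [e, Complex.exp_add, Complex.exp_log h1ζ0, h1ζ, ← hμ]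
    field_simp
  refine ⟨ω₀, ?_, ?_⟩
  · refine isODEQuasifrequency_of_generator
      (hasDerivAt_linearFlow (continuous_generator P G α) (h.norm_generator_le α) x)
      (by rwa [linearFlow_zero]) fun t => ?_
    rw [hexp]
    exact linearFlow_add_period _ _ (generator_add_period P G α) hax t
  · have e : ω - ω₀ = Complex.I * Complex.log (1 + ζ) / P.T := by
      rw [hω₀]
      ring
    have hlog := Complex.norm_log_one_add_half_le_self hζ2
    have hε : 0 ≤ ε := by
      have := (norm_nonneg _).trans hζε
      rwa [le_div_iff₀ h0, zero_mul] at this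
    rw [e, norm_div, norm_mul, Complex.norm_I, one_mul, Complex.norm_real,
      Real.norm_of_nonneg hT.le]
    have hTinv : P.T⁻¹ ≤ Λ * √P.δ / 6 := by
      unfold Medium.T
      rw [inv_div]
      have := Real.pi_gt_three
      have h2 := h.Ω_mem.2
      have := Real.sqrt_nonneg P.δ
      gcongr
      linarith
    calc _ = ‖Complex.log (1 + ζ)‖ * P.T⁻¹ := div_eq_mul_inv _ _
      _ ≤ 3 / 2 * (ε / Λ) * (Λ * √P.δ / 6) := by
          gcongr
          exact hlog.trans (by gcongr)
      _ = ε * √P.δ / 4 := by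
          field_simp
          ring
      _ ≤ _ := by
          have := mul_nonneg hε (Real.sqrt_nonneg P.δ)
          linarith

lemma exists_small_pos {a b c d : ℝ} (hb : 0 < b) (hd : 0 < d) :
    ∃ β > 0, a * β ≤ b ∧ c * β < d := by
  have h1 : Tendsto (fun β : ℝ => a * β) (𝓝[>] 0) (𝓝 0) := by
    have : Continuous fun β : ℝ => a * β := by fun_prop
    simpa using (this.tendsto 0).mono_left nhdsWithin_le_nhds
  have h2 : Tendsto (fun β : ℝ => c * β) (𝓝[>] 0) (𝓝 0) := by
    have : Continuous fun β : ℝ => c * β := by fun_prop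
    simpa using (this.tendsto 0).mono_left nhdsWithin_le_nhds
  obtain ⟨β, hβ, h⟩ := ((h1.eventually (gt_mem_nhds hb)).and
    ((h2.eventually (gt_mem_nhds hd)).and self_mem_nhdsWithin)).exists
  exact ⟨β, h.2, hβ.le, h.1⟩

/-- Near the quasifrequency of a Bloch wave carried by low harmonics there is a quasifrequency of
the limiting equation, if the parameters are small enough. -/
theorem exists_quasifrequency_near (N : ℕ) {Λ ε : ℝ} (hΛ : 1 ≤ Λ) (hε : 0 < ε) :
    ∃ β > 0, ∀ {P : Medium N} {G : Geometry N} {α : ℝ} {ω : ℂ} {v dv ddv : Fin N → ℤ → ℝ → ℂ}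
      {ρ : ℝ} {J r K : ℕ}, IsControlled P G α ω v dv ddv Λ ρ J r → 0 < r →
      K + 6 * P.M * r + 8 * P.M ≤ J → 1 / 2 ≤ ∑ n ∈ band K, harmonicNorm G v n →
      2000000 * N * Λ ^ 15 / r ≤ β ^ 2 → ρ ^ 2 ≤ β ^ 2 → P.δ ≤ β ^ 2 → K * P.δ ≤ β ^ 2 →
      ∃ ω₀, P.IsODEQuasifrequency G α ω₀ ∧ ‖ω - ω₀‖ ≤ ε * √P.δ := by
  have h0 : 0 < Λ := by linarith
  obtain ⟨S, hS0, hS⟩ := exists_sum_inv_sqrt_cube_le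
  set Θ := 7 * Λ * (1 + 8000000 * N * S * Λ ^ 17) ^ 2 with hΘ
  set E₁ := Real.exp Θ with hE₁
  set E₂ := Real.exp (28 * Λ ^ 7) with hE₂
  have hE₁1 : 1 ≤ E₁ := Real.one_le_exp (by positivity)
  have hE₂1 : 1 ≤ E₂ := Real.one_le_exp (by positivity)
  set B := E₁ * E₂ with hB
  have hB1 : 1 ≤ B := one_le_mul_of_one_le_of_one_le hE₁1 hE₂1
  set d := Module.finrank ℂ (State N) with hd
  -- The residual is at most `C₁ β`, and `1 / 2 ≤ C₂ ‖y‖ + C₃ β` for the initial value `y`.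
  set C₁ := 14 * N * Λ ^ 4 * E₁ * (200000 * Λ ^ 13) with hC₁
  set Q := √(12 * Λ ^ 4 * S) with hQ
  set C₂ := N * (2 * Λ * (Q * B)) with hC₂
  set C₃ := N * (2 * Λ * (Q * (B * C₁ + 200000 * Λ ^ 13)) + 4 * Λ * (3000 * Λ ^ 9)) with hC₃
  set τ := min (Real.exp (-Θ) / 2) (Real.exp (-Θ) * ε / Λ) with hτ
  have hτ0 : 0 < τ := lt_min (by positivity) (by positivity)
  obtain ⟨β, hβ0, hβ1, hβ2⟩ := exists_small_pos (a := C₃) (b := 1 / 4)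
    (c := d * (2 * B) ^ d * (4 * C₂ * (C₁ * E₂))) (d := τ ^ d) (by norm_num) (by positivity)
  refine ⟨β, hβ0, ?_⟩
  intro P G α ω v dv ddv ρ J r K h hr hJ hcarry hσ hρ hδ hKδ
  have e4 : 4 * P.M * r = 4 * (P.M * r) := by ring
  have e2 : 2 * P.M * r = 2 * (P.M * r) := by ring
  have e6 : 6 * P.M * r = 6 * (P.M * r) := by ring
  obtain ⟨I, hKI, hIK, hI⟩ := h.exists_good_truncation hr (K := K) (by omega)
  set σ := 2000000 * N * Λ ^ 15 / (r : ℝ) with hσd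
  have hσ0 : 0 ≤ σ := by positivity
  have him : |ω.im| * P.T ≤ Θ := by
    have h1 := h.abs_im_le hS0 hS (K := K) (by omega) hcarry
    calc _ ≤ (1 + 8000000 * N * S * Λ ^ 17) ^ 2 * √P.δ * P.T := by
          gcongr
          exact P.T_pos.le
      _ = (1 + 8000000 * N * S * Λ ^ 17) ^ 2 * (√P.δ * P.T) := by ring
      _ ≤ (1 + 8000000 * N * S * Λ ^ 17) ^ 2 * (7 * Λ) :=
          mul_le_mul_of_nonneg_left h.regime.sqrt_δ_mul_T_le (by positivity)
      _ = _ := by rw [hΘ]; ring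
  set b := (200000 * Λ ^ 13 * β) ^ 2 with hb
  have hbe : b = 40000000000 * Λ ^ 26 * β ^ 2 := by rw [hb]; ring
  have hsb : √b = 200000 * Λ ^ 13 * β := Real.sqrt_sq (by positivity)
  have ha : ∀ i, msq P.Ω (amplitudeError P G ω v I i) ≤ b := fun i => by
    have h3 := h.one_le_pow (show 3 ≤ 26 by norm_num)
    calc _ ≤ Λ ^ 3 * σ := h.msq_amplitudeError_le i (hI i).2.1
      _ ≤ Λ ^ 26 * β ^ 2 := by gcongr
      _ ≤ 40000000000 * (Λ ^ 26 * β ^ 2) := by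
          have : 0 ≤ Λ ^ 26 * β ^ 2 := by positivity
          linarith
      _ = _ := by rw [hbe]; ring
  have hm : ∀ i, msq P.Ω (momentumError P G α v dv I i) ≤ b := fun i => by
    have h1 := h.msq_momentumError_le (I := I) (σ := σ) (by omega) hσ0
      (fun i => ⟨(hI i).1, (hI i).2.2⟩) i
    calc _ ≤ _ := h1
      _ ≤ 10000000000 * Λ ^ 26 * (β ^ 2 + β ^ 2 + β ^ 2) := by gcongr
      _ ≤ 40000000000 * Λ ^ 26 * β ^ 2 := by
          have : 0 ≤ Λ ^ 26 * β ^ 2 := by positivity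
          linarith
      _ = _ := hbe.symm
  have hη : ∫ t in (0 : ℝ)..P.T, ‖residual P G α ω v dv I t‖ ≤ C₁ * β := by
    refine (h.integral_residual_le him ha hm).trans (le_of_eq ?_)
    rw [hsb, hC₁]
    ring
  set y := meanState P G ω v I 0 with hy
  have hC₁0 : 0 ≤ C₁ := by positivity
  have hlow : 1 / 2 ≤ C₂ * ‖y‖ + C₃ * β := by
    have hY : 0 ≤ B * (‖y‖ + C₁ * β) := by positivity
    have hbs : b ≤ (B * (‖y‖ + C₁ * β) + 200000 * Λ ^ 13 * β) ^ 2 := by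
      rw [hb]
      gcongr
      linarith
    have hms : ∀ i, msq P.Ω (amplitude P G v I i) ≤ (B * (‖y‖ + C₁ * β) + 200000 * Λ ^ 13 * β) ^ 2 ∧
        msq P.Ω (momentum P G ω v I i) ≤ (B * (‖y‖ + C₁ * β) + 200000 * Λ ^ 13 * β) ^ 2 ∧
        msq P.Ω (amplitudeError P G ω v I i) ≤ (B * (‖y‖ + C₁ * β) + 200000 * Λ ^ 13 * β) ^ 2 := by
      intro i
      have h1 := h.msq_meanState_le him hη i
      have h2 : (B * (‖y‖ + C₁ * β)) ^ 2 ≤ (B * (‖y‖ + C₁ * β) + 200000 * Λ ^ 13 * β) ^ 2 := by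
        gcongr
        have : 0 ≤ 200000 * Λ ^ 13 * β := by positivity
        linarith
      exact ⟨h1.1.trans h2, h1.2.trans h2, (ha i).trans hbs⟩
    have h1 := h.sum_harmonicNorm_le hS0 hS hKI (by omega) hms
    have h2 : √((2 * K + 1) * (3000000 * Λ ^ 18 * P.δ)) ≤ 3000 * Λ ^ 9 * β := by
      refine Real.sqrt_le_iff.2 ⟨by positivity, ?_⟩
      calc _ = 3000000 * Λ ^ 18 * (2 * (K * P.δ) + P.δ) := by ring
        _ ≤ 3000000 * Λ ^ 18 * (2 * β ^ 2 + β ^ 2) := by gcongr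
        _ = _ := by ring
    rw [Real.sqrt_mul (by positivity), Real.sqrt_sq (by positivity)] at h1
    calc _ ≤ _ := hcarry
      _ ≤ _ := h1
      _ ≤ N * (2 * Λ * (Q * (B * (‖y‖ + C₁ * β) + 200000 * Λ ^ 13 * β)) +
          4 * Λ * (3000 * Λ ^ 9 * β)) := by gcongr
      _ = _ := by
          rw [hC₂, hC₃]
          ring
  have hy4 : 1 ≤ 4 * C₂ * ‖y‖ := by linarith
  have hy0 : 0 < ‖y‖ := by
    rcases (norm_nonneg y).eq_or_lt with h1 | h1
    · rw [← h1] at hy4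
      norm_num at hy4
    · exact h1
  set Φ := monodromy (continuous_generator P G α) (h.regime.norm_generator_le α) P.T with hΦ
  have hkT : 4 * Λ ^ 6 * √P.δ * P.T ≤ 28 * Λ ^ 7 := by
    calc _ = 4 * Λ ^ 6 * (√P.δ * P.T) := by ring
      _ ≤ 4 * Λ ^ 6 * (7 * Λ) :=
        mul_le_mul_of_nonneg_left h.regime.sqrt_δ_mul_T_le (by positivity)
      _ = _ := by ring
  have hΦB : ∀ x, ‖Φ x‖ ≤ B * ‖x‖ := by
    intro x
    refine (norm_monodromy_le _ _ P.T_pos.le x).trans ?_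
    gcongr
    refine (Real.exp_le_exp.2 hkT).trans ?_
    exact le_mul_of_one_le_left (by positivity) hE₁1
  set μ := Complex.exp (Complex.I * ω * P.T) with hμ
  have hμB : ‖μ‖ ≤ B :=
    (norm_exp_le him (by rw [abs_of_pos P.T_pos])).1.trans
      (le_mul_of_one_le_right (by positivity) hE₂1)
  have hres : ‖Φ y - μ • y‖ ≤ C₁ * β * E₂ := by
    have h1 := norm_sub_monodromy_le (continuous_generator P G α) (h.regime.norm_generator_le α)
      P.T_pos.le (continuous_residual P G α ω v dv I) (h.hasDerivAt_meanState I)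
    rw [meanState_period, norm_sub_rev] at h1
    refine h1.trans ?_
    gcongr
    exact Real.exp_le_exp.2 hkT
  have hnorm : ‖Φ ((‖y‖⁻¹ : ℂ) • y) - μ • ((‖y‖⁻¹ : ℂ) • y)‖ ≤ 4 * C₂ * (C₁ * β * E₂) := by
    have e : Φ ((‖y‖⁻¹ : ℂ) • y) - μ • ((‖y‖⁻¹ : ℂ) • y) = (‖y‖⁻¹ : ℂ) • (Φ y - μ • y) := by
      rw [map_smul, smul_sub, smul_comm]
    rw [e, norm_smul, norm_inv, Complex.norm_real, norm_norm]
    have : ‖y‖⁻¹ ≤ 4 * C₂ := by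
      rw [inv_eq_one_div, div_le_iff₀ hy0]
      exact hy4
    gcongr
  obtain ⟨a, x, hx0, hx, hax⟩ := exists_eigenvalue_near hB1 hΦB hμB (y := (‖y‖⁻¹ : ℂ) • y)
    (by
      rw [norm_smul, norm_inv, Complex.norm_real, norm_norm, inv_mul_cancel₀ hy0.ne'])
    hnorm hτ0 (by
      refine lt_of_le_of_lt (le_of_eq ?_) hβ2
      ring)
  exact h.regime.exists_quasifrequency_of_eigenvalue him hx0 hx hax (min_le_left _ _)
    (min_le_right _ _)

end Near

/-! ### Families of media -/

section Families

variable {N : ℕ} {ι : Type*} {l : Filter ι} {P : ι → Medium N} {G : Geometry N}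

lemma IsHighContrastFamily.exists_inRegime (hP : IsHighContrastFamily l P) (G : Geometry N) :
    ∃ Λ, 1 ≤ Λ ∧ ∀ᶠ k in l, InRegime (P k) G Λ := by
  obtain ⟨c, hc, C, h⟩ := hP.order_one
  set f : Fin N → ℝ := fun i => (G.ell i + (G.ell i)⁻¹) + (G.leftGap i + (G.leftGap i)⁻¹) +
    (G.rightGap i + (G.rightGap i)⁻¹) with hf
  have pe := G.ell_pos
  have pl := G.leftGap_pos
  have pr := G.rightGap_pos
  have hf0 : ∀ i, 0 ≤ f i := fun i => by
    have := pe i; have := pl i; have := pr i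
    positivity
  set Λ := 1 + |C| + c⁻¹ + ∑ i, f i with hΛ
  have hs0 : 0 ≤ ∑ i, f i := Finset.sum_nonneg fun i _ => hf0 i
  have hci : 0 < c⁻¹ := inv_pos.2 hc
  have hC0 := abs_nonneg C
  have hΛ1 : 1 ≤ Λ := by linarith
  have hΛ0 : 0 < Λ := by linarith
  have hmem : ∀ {x : ℝ}, x ∈ Icc c C → x ∈ Icc Λ⁻¹ Λ := fun hx =>
    ⟨(inv_le_of_inv_le₀ hc (by linarith)).trans hx.1, hx.2.trans (by linarith [le_abs_self C])⟩
  have hfi : ∀ i, f i ≤ Λ := fun i => by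
    have := Finset.single_le_sum (f := f) (fun i _ => hf0 i) (Finset.mem_univ i)
    linarith
  have hmem2 : ∀ {x : ℝ}, 0 < x → x + x⁻¹ ≤ Λ → x ∈ Icc Λ⁻¹ Λ := fun {x} hx hle =>
    ⟨inv_le_of_inv_le₀ hx (by linarith), by linarith [inv_pos.2 hx]⟩
  refine ⟨Λ, hΛ1, h.mono fun k hk => ?_⟩
  obtain ⟨h1, h2, h3, h4⟩ := hk
  have hδ := Real.sqrt_pos.2 (P k).δ_pos
  have h3' := hmem h3
  refine ⟨hΛ1, hmem h1, hmem h2, ⟨?_, ?_⟩, fun i t => hmem (h4 i t).1, fun i t => hmem (h4 i t).2,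
    fun i => hmem2 (pe i) ?_, fun i => hmem2 (pl i) ?_, fun i => hmem2 (pr i) ?_⟩
  · exact (le_div_iff₀ hδ).1 h3'.1
  · exact (div_le_iff₀ hδ).1 h3'.2
  all_goals
    have := hfi i
    have := pe i; have := pl i; have := pr i
    have := inv_pos.2 (pe i); have := inv_pos.2 (pl i); have := inv_pos.2 (pr i)
    simp only [hf] at *
    linarith

/-- The total mass of the harmonics of a normalised wave is at most one. -/
lemma massSum_le_one {v : Fin N → ℤ → ℝ → ℂ} (h : HasSum (harmonicNorm G v) 1) (i : Fin N) (I : ℕ) :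
    massSum G v i I ≤ 1 := by
  have hnn : ∀ n, 0 ≤ harmonicNorm G v n := fun n => Real.sqrt_nonneg _
  have h1 : ∀ n, harmonicNorm G v n ≤ 1 := fun n => le_hasSum h n fun m _ => hnn m
  calc massSum G v i I ≤ ∑ n ∈ band I, harmonicNorm G v n := by
        refine Finset.sum_le_sum fun n _ => ?_
        calc mass G v i n ≤ ∑ i, mass G v i n :=
              Finset.single_le_sum (f := fun i => mass G v i n) (fun i _ => mass_nonneg G v i n)
                (Finset.mem_univ i)
          _ = harmonicNorm G v n ^ 2 := by
              rw [harmonicNorm, Real.sq_sqrt (Finset.sum_nonneg fun i _ => mass_nonneg G v i n)]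
          _ ≤ _ := by nlinarith [hnn n, h1 n]
    _ ≤ 1 := sum_le_hasSum _ (fun n _ => hnn n) h

lemma IsHighContrastFamily.tendsto_δ (hP : IsHighContrastFamily l P) :
    Tendsto (fun k => (P k).δ) l (𝓝[>] 0) :=
  tendsto_nhdsWithin_iff.2 ⟨hP.contrast, Eventually.of_forall fun k => (P k).δ_pos⟩

/-- The numbers `r` of improvement steps can be chosen such that the steps gain any power of `δ`,
while their total length `M r` is still small compared with `Ω⁻¹`. -/
lemma IsHighContrastFamily.exists_steps (hP : IsHighContrastFamily l P) {Λ : ℝ} (hΛ : 1 ≤ Λ)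
    (hreg : ∀ᶠ k in l, InRegime (P k) G Λ) :
    ∃ r : ι → ℕ, Tendsto (fun k => (r k : ℝ)) l atTop ∧
      (∀ᶠ k in l, decayRate Λ ^ r k ≤ (P k).δ ^ 2) ∧
      Tendsto (fun k => ((P k).M : ℝ) * r k * (P k).Ω) l (𝓝 0) := by
  obtain ⟨γ, hγ, hM⟩ := hP.bandwidth
  obtain ⟨A, hA⟩ := hM.bound
  -- With `r ~ δ^{-η}`, the length `M r Ω` is of order `δ^{(1 - γ) / 2 - η}`, and the gain from the
  -- steps is exponential in `δ^{-η}`.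
  set η := (1 - γ) / 4 with hη
  have hη0 : 0 < η := by have := hγ.2; rw [hη]; linarith
  have hδ := hP.tendsto_δ
  have hs : Tendsto (fun k => (P k).δ ^ (-η)) l atTop :=
    (tendsto_rpow_neg_nhdsGT_zero (neg_neg_of_pos hη0)).comp hδ
  have hΛ0 : 0 < Λ := by linarith
  refine ⟨fun k => ⌈(P k).δ ^ (-η)⌉₊, tendsto_atTop_mono (fun k => Nat.le_ceil _) hs, ?_, ?_⟩
  · have hq0 := decayRate_pos hΛ
    have hq1 : decayRate Λ < 1 := by
      unfold decayRate
      rw [div_lt_one (by positivity)]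
      linarith
    have hlog : 0 < -Real.log (decayRate Λ) := neg_pos.2 (Real.log_neg hq0 hq1)
    have h1 := (tendsto_rpow_mul_exp_neg_mul_atTop_nhds_zero (2 / η) _ hlog).comp hs
    filter_upwards [h1.eventually (gt_mem_nhds one_pos)] with k hk
    have hd := (P k).δ_pos
    simp only [Function.comp_apply, neg_neg] at hk
    have e1 : ((P k).δ ^ (-η)) ^ (2 / η) = ((P k).δ ^ 2)⁻¹ := by
      rw [← Real.rpow_mul hd.le]
      have : -η * (2 / η) = -((2 : ℕ) : ℝ) := by
        push_cast
        field_simp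
      rw [this, Real.rpow_neg hd.le, Real.rpow_natCast]
    rw [e1, inv_mul_lt_iff₀ (by positivity), mul_one] at hk
    calc decayRate Λ ^ ⌈(P k).δ ^ (-η)⌉₊ = decayRate Λ ^ (⌈(P k).δ ^ (-η)⌉₊ : ℝ) :=
          (Real.rpow_natCast _ _).symm
      _ ≤ decayRate Λ ^ ((P k).δ ^ (-η)) :=
          Real.rpow_le_rpow_of_exponent_ge hq0 hq1.le (Nat.le_ceil _)
      _ = Real.exp (Real.log (decayRate Λ) * (P k).δ ^ (-η)) := Real.rpow_def_of_pos hq0 _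
      _ ≤ _ := hk.le
  · have h1 : Tendsto (fun k => 2 * |A| * Λ * (P k).δ ^ η) l (𝓝 0) := by
      have h2 : Tendsto (fun k => (P k).δ ^ η) l (𝓝 0) := by
        have h3 := hP.contrast.rpow_const (p := η) (Or.inr hη0.le)
        rwa [Real.zero_rpow hη0.ne'] at h3
      simpa using h2.const_mul (2 * |A| * Λ)
    refine tendsto_of_tendsto_of_tendsto_of_le_of_le' tendsto_const_nhds h1
      (Eventually.of_forall fun k => ?_) ?_
    · have := (P k).Ω_pos
      positivity
    · filter_upwards [hA, hreg, hs.eventually_ge_atTop 1] with k hk hr hge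
      have hd := (P k).δ_pos
      rw [Real.norm_of_nonneg (by positivity), Real.norm_of_nonneg (by positivity)] at hk
      have hk' : ((P k).M : ℝ) ≤ |A| * (P k).δ ^ (-γ / 2) :=
        hk.trans (by gcongr; exact le_abs_self A)
      have hceil : (⌈(P k).δ ^ (-η)⌉₊ : ℝ) ≤ 2 * (P k).δ ^ (-η) := by
        have := (Nat.ceil_lt_add_one (show 0 ≤ (P k).δ ^ (-η) by positivity)).le
        linarith
      have hΩ := (P k).Ω_pos
      calc _ ≤ |A| * (P k).δ ^ (-γ / 2) * (2 * (P k).δ ^ (-η)) * (Λ * √(P k).δ) := by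
            gcongr
            exact hr.Ω_mem.2
        _ = 2 * |A| * Λ * ((P k).δ ^ (-γ / 2) * (P k).δ ^ (-η) * (P k).δ ^ (1 / 2 : ℝ)) := by
            rw [Real.sqrt_eq_rpow]
            ring
        _ = _ := by
            rw [← Real.rpow_add hd, ← Real.rpow_add hd]
            congr 2
            rw [hη]
            ring

/-- Quasifrequencies of the limiting equation approximate subwavelength quasifrequencies to any
precision relative to `√δ`. -/
theorem eventually_exists_quasifrequency_near {α : ℝ} (hP : IsHighContrastFamily l P) {ω : ι → ℂ}
    (hω : IsSubwavelengthFamily G α l P ω) {ε : ℝ} (hε : 0 < ε) :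
    ∀ᶠ k in l, ∃ ω₀, (P k).IsODEQuasifrequency G α ω₀ ∧ ‖ω k - ω₀‖ ≤ ε * √(P k).δ := by
  obtain ⟨Λ, hΛ, hreg⟩ := hP.exists_inRegime G
  obtain ⟨hω0, u, K, hKΩ, hu, hcarry⟩ := hω
  obtain ⟨r, hr, hdecay, hMr⟩ := hP.exists_steps hΛ hreg
  obtain ⟨β, hβ, hnear⟩ := exists_quasifrequency_near N hΛ hε
  set J : ι → ℕ := fun k => K k + 6 * (P k).M * r k + 8 * (P k).M with hJ
  set ρ : ι → ℝ := fun k => ‖ω k‖ + ((K k : ℝ) * (P k).Ω + 14 * ((P k).M * r k * (P k).Ω)) with hρ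
  have hρ0 : Tendsto ρ l (𝓝 0) := by
    simpa using hω0.norm.add (hKΩ.add (hMr.const_mul 14))
  have hρ2 : Tendsto (fun k => ρ k ^ 2) l (𝓝 0) := by simpa using hρ0.pow 2
  have hρ3 : Tendsto (fun k => 8 * Λ ^ 13 * ρ k ^ 2) l (𝓝 0) := by
    simpa using hρ2.const_mul (8 * Λ ^ 13)
  have hΛK : Tendsto (fun k => Λ * ((K k : ℝ) * (P k).Ω)) l (𝓝 0) := by
    simpa using hKΩ.const_mul Λ
  have hσ : Tendsto (fun k => 2000000 * N * Λ ^ 15 / (r k : ℝ)) l (𝓝 0) :=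
    hr.const_div_atTop _
  have hβ2 : 0 < β ^ 2 := by positivity
  filter_upwards [hreg, hu, hdecay, hr.eventually_ge_atTop 1,
    hcarry.eventually (lt_mem_nhds (show (1 / 2 : ℝ) < 1 by norm_num)),
    hρ2.eventually (gt_mem_nhds hβ2), hρ3.eventually (gt_mem_nhds one_pos),
    hP.contrast.eventually (gt_mem_nhds one_pos), hP.contrast.eventually (gt_mem_nhds hβ2),
    hΛK.eventually (gt_mem_nhds hβ2), hσ.eventually (gt_mem_nhds hβ2)] with
    k kreg ku kdecay kr kcarry kρ2 kρ3 kδ1 kδβ kΛK kσ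
  obtain ⟨v, dv, ddv, hmodes, hnorm⟩ := ku.1.exists_isModeSystem
  have hnorm' : ∀ n, G.normD ((P k).harmonic (ω k) (u k) n) = harmonicNorm G v n := hnorm
  have hsum : HasSum (harmonicNorm G v) 1 := by
    have := ku.2
    simp_rw [hnorm'] at this
    exact this
  simp_rw [hnorm'] at kcarry
  have hΩ := (P k).Ω_pos
  have hcontrolled : IsControlled (P k) G α (ω k) v dv ddv Λ (ρ k) (J k) (r k) := by
    refine ⟨hmodes, kreg, fun n hn => ?_, kρ3.le, kδ1.le, massSum_le_one hsum, kdecay⟩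
    have hn' : |(n : ℝ)| ≤ J k := by
      rw [mem_band] at hn
      rw [abs_le]
      exact ⟨by exact_mod_cast hn.1, by exact_mod_cast hn.2⟩
    have h1 : ‖(P k).freq (ω k) n‖ ≤ ‖ω k‖ + |(n : ℝ)| * (P k).Ω := by
      refine (norm_add_le _ _).trans ?_
      rw [norm_mul, Complex.norm_intCast, Complex.norm_real, Real.norm_of_nonneg hΩ.le]
    have h2 : ((P k).M : ℝ) ≤ (P k).M * r k := le_mul_of_one_le_right (by positivity) kr
    have h3 : ((J k : ℕ) : ℝ) ≤ K k + 14 * ((P k).M * r k) := by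
      simp only [hJ]
      push_cast
      linarith
    calc _ ≤ _ := h1
      _ ≤ ‖ω k‖ + (K k + 14 * ((P k).M * r k)) * (P k).Ω := by
          gcongr
          exact hn'.trans h3
      _ = ρ k := by
          simp only [hρ]
          ring
  refine hnear hcontrolled (by exact_mod_cast kr) le_rfl kcarry.le kσ.le kρ2.le kδβ.le ?_
  have hδ := (P k).δ_pos
  have h1 : √(P k).δ ≤ Λ * (P k).Ω := by
    have := kreg.Ω_mem.1
    rwa [inv_mul_le_iff₀ kreg.pos] at this
  have h2 : √(P k).δ ≤ 1 := Real.sqrt_le_one.2 kδ1.le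
  calc (K k : ℝ) * (P k).δ = K k * (√(P k).δ * √(P k).δ) := by rw [Real.mul_self_sqrt hδ.le]
    _ ≤ K k * (Λ * (P k).Ω * 1) := by gcongr
    _ = Λ * (K k * (P k).Ω) := by ring
    _ ≤ _ := kΛK.le

end Families

end SpaceTimeResonators

end

open SpaceTimeResonators in
theorem mainTheorem1 {N : ℕ} (G : Geometry N)
    (α : ℝ) (hα : α ∈ Set.Ioc (-Real.pi / G.L) (Real.pi / G.L))
    {ι : Type*} (l : Filter ι) (P : ι → Medium N) (hP : IsHighContrastFamily l P)
    (ω : ι → ℂ) (hω : IsSubwavelengthFamily G α l P ω) :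
    ∃ ω₀ : ι → ℂ,
      (∀ᶠ k in l, (P k).IsODEQuasifrequency G α (ω₀ k)) ∧
      (fun k => ω k - ω₀ k) =o[l] fun k => √(P k).δ := by
  -- One choice of `ω₀` serves all precisions at once: take a quasifrequency whose distance to
  -- `ω k` exceeds the infimum of all such distances by less than `δ = o(√δ)`.
  set S : ι → Set ℝ := fun k => {x | ∃ ω₀, (P k).IsODEQuasifrequency G α ω₀ ∧ x = ‖ω k - ω₀‖}
    with hS
  have hbdd : ∀ k, BddBelow (S k) := fun k => ⟨0, by rintro x ⟨ω₀, _, rfl⟩; exact norm_nonneg _⟩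
  have hex : ∀ k, ∃ ω₀, (S k).Nonempty →
      (P k).IsODEQuasifrequency G α ω₀ ∧ ‖ω k - ω₀‖ < sInf (S k) + (P k).δ := by
    intro k
    by_cases hne : (S k).Nonempty
    · obtain ⟨x, ⟨ω₀, h1, rfl⟩, h2⟩ := exists_lt_of_csInf_lt hne
        (lt_add_of_pos_right (sInf (S k)) (P k).δ_pos)
      exact ⟨ω₀, fun _ => ⟨h1, h2⟩⟩
    · exact ⟨0, fun h => absurd h hne⟩
  choose ω₀ hω₀ using hex
  have hnear : ∀ ε > 0, ∀ᶠ k in l, (S k).Nonempty ∧ sInf (S k) ≤ ε * √(P k).δ := by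
    intro ε hε
    filter_upwards [eventually_exists_quasifrequency_near hP hω hε] with k hk
    obtain ⟨z, hz, hle⟩ := hk
    exact ⟨⟨_, z, hz, rfl⟩, (csInf_le (hbdd k) ⟨z, hz, rfl⟩).trans hle⟩
  refine ⟨ω₀, (hnear 1 one_pos).mono fun k hk => (hω₀ k hk.1).1,
    Asymptotics.isLittleO_iff.2 fun ε hε => ?_⟩
  have hsqrt : Filter.Tendsto (fun k => √(P k).δ) l (nhds 0) := by
    simpa using hP.contrast.sqrt
  filter_upwards [hnear (ε / 2) (by positivity),
    hsqrt.eventually (gt_mem_nhds (show 0 < ε / 2 by positivity))] with k hk hδ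
  have h0 := Real.sqrt_nonneg (P k).δ
  have h1 : (P k).δ ≤ ε / 2 * √(P k).δ := by
    calc (P k).δ = √(P k).δ * √(P k).δ := (Real.mul_self_sqrt (P k).δ_pos.le).symm
      _ ≤ _ := by gcongr
  rw [Real.norm_of_nonneg h0]
  linarith [(hω₀ k hk.1).2, hk.2]
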